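/- **Notation.** Let $n,m,p,q$ be positive integers with $m>2$ and $\gcd(n,m)=1$. For $\theta\in\mathbb R$ let $R_x^\theta,R_z^\theta\in SO(3)$ be the rotations by $\theta$ about the $x$-axis and the $z$-axis, let $\ell$ be the line through the origin in the $x$-$y$ plane that makes the angle $2\pi n/m$ with the $x$-axis, and let $R_\ell^\theta$ be the rotation by $\theta$ about $\ell$ (products are compositions, the right factor acting first). Put $A=R_x^{2\pi/p}$, $B=R_\ell^{2\pi/q}$, and let $G_{n/m}(p,q)=\langle A,B\rangle\subset SO(3)$. Let $G(p,q)=\langle R_x^{2\pi/p},R_z^{2\pi/q}\rangle$, let $D_k$ be the dihedral group of order $2k$, let $\rho(N)$ be the exponent of $2$ in $N$, and let $[\cdot,\cdot]$ be the least common multiple. For subgroups $H_1,H_2$ of a group with $H_1\cap H_2=K$, "$G=H_1*_K H_2$" means that the canonical map from the amalgamated free product of $H_1$ and $H_2$ over $K$ is an isomorphism onto $G$. **Theorem 5.** (1) If $\rho(m)>\rho(p)=\rho(q)=1$, then, with $\alpha\mapsto A$, $\beta\mapsto B$, $\gamma\mapsto R_z^\pi$, $$G_{n/m}(p,q)=\langle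 \alpha,\beta,\gamma : \alpha^p,\ \beta^q,\ \gamma^2,\ (\alpha\gamma)^2,\ (\beta\gamma)^2,\ (\alpha^{p/2}\beta^{q/2})^{m/4}\gamma\rangle .$$ Equivalently, it is the quotient of $D_p *_{\mathbb Z_2} D_q$ by the last relation, where $\alpha$ and $\beta$ are the rotation generators of $D_p$ and $D_q$, and $\mathbb Z_2$ is generated by the common reflection $\gamma$. (2) If $\rho(m)>\rho(p)>1$ and $\rho(m)>\rho(q)>1$, let $r=[p,q,m/2]$. Then $$G_{n/m}(p,q)=G_{1/2r}(4,4)=H_1 *_{K} H_2 ,$$ where $H_1=\langle R_z^{2\pi/r},R_x^{\pi/2}\rangle$ is conjugate to $G(r,4)$ in $SO(3)$, $H_2=R_z^{\pi/r}H_1R_z^{-\pi/r}$, and $K=\langle R_z^{2\pi/r},R_x^{\pi}\rangle\cong D_r$. (3) If $\rho(m)>\rho(p)>\rho(q)=1$, let $s=[p,m/2]$. Then $$G_{n/m}(p,q)=G_{1/2s}(4,q)=H *_{K} D ,$$ where $H=\langle R_z^{2\pi/s},R_x^{\pi/2}\rangle$ is conjugate to $G(s,4)$ in $SO(3)$, $D=\langle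 B,R_z^\pi\rangle\cong D_q$, and $K=\langle B^{q/2},R_z^\pi\rangle\cong D_2$. (4) If $\rho(p)>\rho(q)=1$ and $\rho(m)=2$, let $t=[q,m/2]$. Then $$G_{n/m}(p,q)=G_{1/2t}(p,2)=E_1 *_{K} E_2 ,$$ where $E_1=\langle A,R_z^\pi\rangle\cong D_p$, $E_2=\langle R_z^{2\pi/t},B^{q/2}\rangle\cong D_t$, and $K=\langle R_z^\pi,A^{p/2}\rangle\cong D_2$. Moreover $A^{p/2}=B^{q/2}R_z^{4\pi n/m}=B_1R_z^{2\pi/t}$, where $B_1$ is the rotation by $\pi$ about the line in the $x$-$y$ plane at angle $2\pi/(2t)$ to the $x$-axis (the second generator of $G_{1/2t}(p,2)$). -/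

import Mathlib

namespace RotationGroups

noncomputable section

/-- The rotation group of Euclidean 3-space: real orthogonal `3 × 3` matrices of determinant 1. -/
abbrev SO3 : Type := Matrix.specialOrthogonalGroup (Fin 3) ℝ

/-- Rotation by the angle `θ` about the `x`-axis. -/
def rotX (θ : ℝ) : SO3 :=
  ⟨!![1, 0, 0; 0, Real.cos θ, -Real.sin θ; 0, Real.sin θ, Real.cos θ], by
    rw [Matrix.mem_specialOrthogonalGroup_iff, Matrix.mem_orthogonalGroup_iff]
    have h := Real.sin_sq_add_cos_sq θ
    constructor
    · ext i j
      fin_cases i <;> fin_cases j <;>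
        simp [Matrix.mul_apply, Fin.sum_univ_three] <;> nlinarith [h]
    · simp [Matrix.det_fin_three]
      nlinarith [h]⟩

/-- Rotation by the angle `θ` about the `z`-axis. -/
def rotZ (θ : ℝ) : SO3 :=
  ⟨!![Real.cos θ, -Real.sin θ, 0; Real.sin θ, Real.cos θ, 0; 0, 0, 1], by
    rw [Matrix.mem_specialOrthogonalGroup_iff, Matrix.mem_orthogonalGroup_iff]
    have h := Real.sin_sq_add_cos_sq θ
    constructor
    · ext i j
      fin_cases i <;> fin_cases j <;>
        simp [Matrix.mul_apply, Fin.sum_univ_three] <;> nlinarith [h]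
    · simp [Matrix.det_fin_three]
      nlinarith [h]⟩

/-- Rotation by the angle `θ` about the line of the `x`-`y` plane spanned by the unit vector
`(cos φ, sin φ, 0)`: turn that line into the `x`-axis, rotate about the `x`-axis, turn back. -/
def rotLine (φ θ : ℝ) : SO3 := rotZ φ * rotX θ * (rotZ φ)⁻¹

/-- The rotation `A` by `2π/p` about the `x`-axis. -/
def rotA (p : ℕ) : SO3 := rotX (2 * Real.pi / p)

/-- The rotation `B` by `2π/q` about the line `ℓ` of the `x`-`y` plane that makes the angle
`2πn/m` with the `x`-axis. -/
def rotB (n m q : ℕ) : SO3 := rotLine (2 * Real.pi * n / m) (2 * Real.pi / q)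

/-- The group `G_{n/m}(p,q)`, generated by `A` and `B`. -/
def GFrac (n m p q : ℕ) : Subgroup SO3 := Subgroup.closure {rotA p, rotB n m q}

/-- The group `G(p,q)`, generated by the rotation by `2π/p` about the `x`-axis and the rotation
by `2π/q` about the `z`-axis. -/
def GOrth (p q : ℕ) : Subgroup SO3 :=
  Subgroup.closure {rotX (2 * Real.pi / p), rotZ (2 * Real.pi / q)}

section Amalgam

variable {Γ : Type*} [Group Γ]

/-- The inclusions of the intersection of two subgroups into each of them. -/
def infInclusion (H₁ H₂ : Subgroup Γ) (i : Fin 2) :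
    ↥(H₁ ⊓ H₂) →* ↥((![H₁, H₂] : Fin 2 → Subgroup Γ) i) :=
  Subgroup.inclusion (by fin_cases i; exacts [inf_le_left, inf_le_right])

/-- The canonical homomorphism to `Γ` from the amalgamated free product of the subgroups `H₁` and
`H₂` of `Γ` over their intersection. -/
def amalgamHom (H₁ H₂ : Subgroup Γ) : Monoid.PushoutI (infInclusion H₁ H₂) →* Γ :=
  Monoid.PushoutI.lift (fun i => ((![H₁, H₂] : Fin 2 → Subgroup Γ) i).subtype)
    (H₁ ⊓ H₂).subtype (fun _ => rfl)

/-- `G = H₁ *_K H₂` for subgroups of an ambient group: `K` is the common subgroup of `H₁` and `H₂`,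
and the canonical homomorphism from the amalgamated free product of `H₁` and `H₂` over `K` to the
ambient group is an isomorphism onto `G`. -/
structure IsAmalgam (G H₁ H₂ K : Subgroup Γ) : Prop where
  inf_eq : H₁ ⊓ H₂ = K
  injective : Function.Injective (amalgamHom H₁ H₂)
  range_eq : (amalgamHom H₁ H₂).range = G

end Amalgam

/-- The relators `α^p, β^q, γ², (αγ)², (βγ)², (α^{p/2} β^{q/2})^{m/4} γ` in the free group on
`α, β, γ`. -/
def relators (m p q : ℕ) : Set (FreeGroup (Fin 3)) :=
  let α : FreeGroup (Fin 3) := FreeGroup.of 0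
  let β : FreeGroup (Fin 3) := FreeGroup.of 1
  let γ : FreeGroup (Fin 3) := FreeGroup.of 2
  {α ^ p, β ^ q, γ ^ 2, (α * γ) ^ 2, (β * γ) ^ 2, (α ^ (p / 2) * β ^ (q / 2)) ^ (m / 4) * γ}

/-- The homomorphism from the group of order 2 to the dihedral group that sends the generator to
the reflection `sr 0`. -/
def reflHom (k : ℕ) : Multiplicative (ZMod 2) →* DihedralGroup k where
  toFun x := if x = 1 then 1 else DihedralGroup.sr 0
  map_one' := if_pos rfl
  map_mul' x y := by
    have key : ∀ z : Multiplicative (ZMod 2), z = 1 ∨ z = Multiplicative.ofAdd 1 := by decide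
    have h1 : (Multiplicative.ofAdd (1 : ZMod 2)) ≠ 1 := by decide
    have h2 : Multiplicative.ofAdd (1 : ZMod 2) * Multiplicative.ofAdd 1 = 1 := by decide
    rcases key x with rfl | rfl <;> rcases key y with rfl | rfl <;> simp [h1, h2]

/-- The amalgamated free product `D_p *_{ℤ₂} D_q` of two dihedral groups over a subgroup of
order 2 that is generated by a reflection in each factor. -/
abbrev DihedralAmalgam (p q : ℕ) : Type :=
  Monoid.PushoutI (fun i : Fin 2 => reflHom ((![p, q] : Fin 2 → ℕ) i))

/-- The rotation of order `p` in the first factor of `D_p *_{ℤ₂} D_q`. -/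
def DihedralAmalgam.α (p q : ℕ) : DihedralAmalgam p q :=
  Monoid.PushoutI.of (φ := fun i : Fin 2 => reflHom ((![p, q] : Fin 2 → ℕ) i)) 0
    (DihedralGroup.r 1)

/-- The rotation of order `q` in the second factor of `D_p *_{ℤ₂} D_q`. -/
def DihedralAmalgam.β (p q : ℕ) : DihedralAmalgam p q :=
  Monoid.PushoutI.of (φ := fun i : Fin 2 => reflHom ((![p, q] : Fin 2 → ℕ) i)) 1
    (DihedralGroup.r 1)

/-- The common reflection in `D_p *_{ℤ₂} D_q`. -/
def DihedralAmalgam.γ (p q : ℕ) : DihedralAmalgam p q :=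
  Monoid.PushoutI.base (fun i : Fin 2 => reflHom ((![p, q] : Fin 2 → ℕ) i))
    (Multiplicative.ofAdd 1)

/-- The smallest normal subgroup of `D_p *_{ℤ₂} D_q` that contains
`(α^{p/2} β^{q/2})^{m/4} γ`. -/
def lastRelation (m p q : ℕ) : Subgroup (DihedralAmalgam p q) :=
  Subgroup.normalClosure
    {(DihedralAmalgam.α p q ^ (p / 2) * DihedralAmalgam.β p q ^ (q / 2)) ^ (m / 4) *
      DihedralAmalgam.γ p q}

instance lastRelation_normal (m p q : ℕ) : (lastRelation m p q).Normal :=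
  Subgroup.normalClosure_normal

end

end RotationGroups

open RotationGroups

/-! The rotations act on the isotropic vectors `spinor a b` of `ℂ³`, hence on the projective line
with coordinate `z = a / b`. A rotation by `θ` about the `z`-axis multiplies `z` by `exp (θ I)`; a
rotation about the horizontal line at angle `φ` fixes `z = ± exp (φ I)`. Give `ℂ` a valuation `|·|`
that extends the 2-adic one. Two facts then drive everything.

Contraction (`rotX_codisc`, `rotLine_codisc`): a rotation by `θ` about the line at angle `φ`, with
`w = exp (θ I)`, maps the outside of the disc of radius `|2| / |w - 1|` about `exp (φ I)` into that
disc. The radius is `|2|` if `w ^ 2 ≠ 1` has odd order, and `|1 - I| = |2|^(1/2)` for a quarter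
turn.

Separation (`val_two_lt_val_sub_one`, `val_one_sub_I_lt_val_sub_one`): a root of unity `w` has `|w -
1| > |2|` unless `w ^ 2 = 1`, and `|w - 1| > |1 - I|` unless `w ^ 4 = 1`. So rotations about the
`z`-axis move these discs off themselves, up to the obvious exceptions.

Each group is therefore a star of groups to which ping-pong applies. The centre is a dihedral group
about the `z`-axis; a leaf is a dihedral group `D_q` with `q ≡ 2 mod 4`, glued along `D_2`, or an
octahedral group `S_4`, glued along `D_4`. The stars are `D_p — D_{m/2} — D_q` in case 1 (the last
relation puts `γ` into the dihedral group generated by `α^{p/2}` and `β^{q/2}`, which is the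
centre), `S_4 — D_r — S_4` in case 2, `S_4 — D_s — D_q` in case 3, and `D_p — D_t` with centre
`D_p`, after the axes are interchanged, in case 4. The criterion is `isAmalgam_of_pingPong`; case 1
applies `mem_of_act_eq` to the presented group itself.

It remains to see that `A` and `B` generate the star. Products of half-turns give rotations about
the `z`-axis, quarter turns carry one axis to another (`rotLine_conj`), and Bézout combines the
orders into a least common multiple. -/

namespace RotationGroups

/-! ### Reduced words and ping-pong for a star of groups. -/

section PingPong

variable {Γ Ω ι : Type*} [Group Γ]

/-- Reduced words in the subgroups `V i`, separated by elements of `K`, that begin with an element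
of `V i` outside `K`. -/
inductive ReducedWord (K : Subgroup Γ) (V : ι → Subgroup Γ) : ι → Γ → Prop
  | base (i : ι) (v k : Γ) (hv : v ∈ V i) (hvK : v ∉ K) (hk : k ∈ K) : ReducedWord K V i (v * k)
  | step (i j : ι) (v k h : Γ) (hv : v ∈ V i) (hvK : v ∉ K) (hk : k ∈ K)
      (hred : i = j → k ∉ V i) (hh : ReducedWord K V j h) : ReducedWord K V i (v * k * h)

/-- An element of the group generated by `K` and the `V i` lies in `K` or is a reduced word, up to
left multiplication by `K`. -/
theorem mem_or_exists_reducedWord (K : Subgroup Γ) (V : ι → Subgroup Γ) {g : Γ}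
    (hg : g ∈ Subgroup.closure ((K : Set Γ) ∪ ⋃ i, (V i : Set Γ))) :
    g ∈ K ∨ ∃ k ∈ K, ∃ i h, ReducedWord K V i h ∧ g = k * h := by
  have hKmul : ∀ w ∈ K, ∀ g, (g ∈ K ∨ ∃ k ∈ K, ∃ i h, ReducedWord K V i h ∧ g = k * h) →
      (w * g ∈ K ∨ ∃ k ∈ K, ∃ i h, ReducedWord K V i h ∧ w * g = k * h) := by
    rintro w hw g (hg | ⟨k, hk, i, h, hh, rfl⟩)
    · exact Or.inl (mul_mem hw hg)
    · exact Or.inr ⟨w * k, mul_mem hw hk, i, h, hh, (mul_assoc _ _ _).symm⟩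
  have hVmul : ∀ i, ∀ w ∈ V i, ∀ g,
      (g ∈ K ∨ ∃ k ∈ K, ∃ i h, ReducedWord K V i h ∧ g = k * h) →
      (w * g ∈ K ∨ ∃ k ∈ K, ∃ i h, ReducedWord K V i h ∧ w * g = k * h) := by
    intro i w hw g hg
    by_cases hwK : w ∈ K
    · exact hKmul w hwK g hg
    rcases hg with hg | ⟨k, hk, j, h, hh, rfl⟩
    · exact Or.inr ⟨1, one_mem _, i, _, .base i w g hw hwK hg, (one_mul _).symm⟩
    by_cases hred : i = j → k ∉ V i
    · exact Or.inr ⟨1, one_mem _, i, _, .step i j w k h hw hwK hk hred hh, by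
        rw [one_mul, mul_assoc]⟩
    -- Now `k ∈ V i`, so `w * k` merges with the first syllable of the word; if the product falls
    -- into `K`, it is absorbed and the word gets shorter.
    push Not at hred
    obtain ⟨rfl, hkV⟩ := hred
    cases hh with
    | base _ v k' hv hvK hk' =>
      have hu : w * k * v ∈ V i := mul_mem (mul_mem hw hkV) hv
      by_cases huK : w * k * v ∈ K
      · left
        have := mul_mem huK hk'
        simpa only [mul_assoc] using this
      · exact Or.inr ⟨1, one_mem _, i, _, .base i _ k' hu huK hk', by simp only [mul_assoc, one_mul]⟩
    | step _ j v k' h' hv hvK hk' hred hh' =>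
      have hu : w * k * v ∈ V i := mul_mem (mul_mem hw hkV) hv
      by_cases huK : w * k * v ∈ K
      · exact Or.inr ⟨w * k * v * k', mul_mem huK hk', j, h', hh', by simp only [mul_assoc]⟩
      · exact Or.inr ⟨1, one_mem _, i, _, .step i j _ k' h' hu huK hk' hred hh', by
          simp only [mul_assoc, one_mul]⟩
  induction hg using Subgroup.closure_induction_left with
  | one => exact Or.inl (one_mem _)
  | mul_left x hx y _ ih =>
    rcases hx with hx | hx
    · exact hKmul x hx y ih
    · obtain ⟨i, hi⟩ := Set.mem_iUnion.1 hx
      exact hVmul i x hi y ih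
  | inv_mul_cancel x hx y _ ih =>
    rcases hx with hx | hx
    · exact hKmul _ (inv_mem hx) y ih
    · obtain ⟨i, hi⟩ := Set.mem_iUnion.1 hx
      exact hVmul i _ ((V i).inv_mem hi) y ih

/-- Ping-pong for a star-shaped tree of groups with centre `K` and leaves `V i`: an element of the
group generated by them lies in `K` or moves the base point into a translate of some `D i`. -/
theorem pingPong (act : Γ → Ω → Ω) (hact : ∀ g h x, act (g * h) x = act g (act h x))
    (K : Subgroup Γ) (V : ι → Subgroup Γ) (D D' : ι → Set Ω) (x₀ : Ω)
    (hV : ∀ i, ∀ v ∈ V i, v ∈ K ∨ ∀ x ∈ D' i, act v x ∈ D i)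
    (hK : ∀ i, ∀ k ∈ K, k ∈ V i ∨ ∀ x ∈ D i, act k x ∈ D' i)
    (hKd : ∀ i j, i ≠ j → ∀ k ∈ K, ∀ x ∈ D i, act k x ∈ D' j)
    (hx₀ : ∀ i, ∀ k ∈ K, act k x₀ ∈ D' i) {g : Γ}
    (hg : g ∈ Subgroup.closure ((K : Set Γ) ∪ ⋃ i, (V i : Set Γ))) :
    g ∈ K ∨ ∃ k ∈ K, ∃ i, ∃ y ∈ D i, act g x₀ = act k y := by
  have key : ∀ i h, ReducedWord K V i h → act h x₀ ∈ D i := by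
    intro i h hh
    induction hh with
    | base i v k hv hvK hk =>
      rw [hact]
      exact ((hV i v hv).resolve_left hvK) _ (hx₀ i k hk)
    | step i j v k h hv hvK hk hred _ ih =>
      rw [hact, hact]
      refine ((hV i v hv).resolve_left hvK) _ ?_
      by_cases hij : i = j
      · subst hij
        exact ((hK i k hk).resolve_left (hred rfl)) _ ih
      · exact hKd j i (Ne.symm hij) k hk _ ih
  rcases mem_or_exists_reducedWord K V hg with h | ⟨k, hk, i, h, hh, rfl⟩
  · exact Or.inl h
  · exact Or.inr ⟨k, hk, i, _, key i h hh, hact _ _ _⟩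

/-- In the situation of `pingPong`, an element that acts trivially lies in `K`. -/
theorem mem_of_act_eq (act : Γ → Ω → Ω) (hact : ∀ g h x, act (g * h) x = act g (act h x))
    (hone : ∀ x, act 1 x = x)
    (K : Subgroup Γ) (V : ι → Subgroup Γ) (D D' : ι → Set Ω) (x₀ : Ω)
    (hV : ∀ i, ∀ v ∈ V i, v ∈ K ∨ ∀ x ∈ D' i, act v x ∈ D i)
    (hK : ∀ i, ∀ k ∈ K, k ∈ V i ∨ ∀ x ∈ D i, act k x ∈ D' i)
    (hKd : ∀ i j, i ≠ j → ∀ k ∈ K, ∀ x ∈ D i, act k x ∈ D' j)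
    (hx₀ : ∀ i, ∀ k ∈ K, act k x₀ ∈ D' i) (hdisj : ∀ i, Disjoint (D i) (D' i)) {g : Γ}
    (hg : g ∈ Subgroup.closure ((K : Set Γ) ∪ ⋃ i, (V i : Set Γ))) (hfix : act g x₀ = x₀) :
    g ∈ K := by
  rcases pingPong act hact K V D D' x₀ hV hK hKd hx₀ hg with h | ⟨k, hk, i, y, hy, h⟩
  · exact h
  · exfalso
    have hy' : y = act k⁻¹ x₀ := by rw [← hfix, h, ← hact, inv_mul_cancel, hone]
    exact Set.disjoint_left.1 (hdisj i) hy (hy' ▸ hx₀ i _ (inv_mem hk))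

end PingPong

/-! ### From ping-pong to amalgamated products. -/

section Amalgam

variable {G Ω : Type*} [Group G]

theorem amalgamHom_of_zero (H₁ H₂ : Subgroup G) (h : H₁) :
    amalgamHom H₁ H₂ (Monoid.PushoutI.of (φ := infInclusion H₁ H₂) 0 h) = h :=
  Monoid.PushoutI.lift_of (φ := infInclusion H₁ H₂)
    (fun i => ((![H₁, H₂] : Fin 2 → Subgroup G) i).subtype) (H₁ ⊓ H₂).subtype (fun _ => rfl)
    (i := 0) h

theorem amalgamHom_of_one (H₁ H₂ : Subgroup G) (h : H₂) :
    amalgamHom H₁ H₂ (Monoid.PushoutI.of (φ := infInclusion H₁ H₂) 1 h) = h :=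
  Monoid.PushoutI.lift_of (φ := infInclusion H₁ H₂)
    (fun i => ((![H₁, H₂] : Fin 2 → Subgroup G) i).subtype) (H₁ ⊓ H₂).subtype (fun _ => rfl)
    (i := 1) h

theorem of_zero_eq_of_one (H₁ H₂ : Subgroup G) (g : G) (h₁ : g ∈ H₁) (h₂ : g ∈ H₂) :
    Monoid.PushoutI.of (φ := infInclusion H₁ H₂) 0 (⟨g, h₁⟩ : H₁) =
      Monoid.PushoutI.of (φ := infInclusion H₁ H₂) 1 (⟨g, h₂⟩ : H₂) :=
  (Monoid.PushoutI.of_apply_eq_base (infInclusion H₁ H₂) 0 (⟨g, h₁, h₂⟩ : ↥(H₁ ⊓ H₂))).trans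
    (Monoid.PushoutI.of_apply_eq_base (infInclusion H₁ H₂) 1 (⟨g, h₁, h₂⟩ : ↥(H₁ ⊓ H₂))).symm

theorem amalgamHom_range (H₁ H₂ : Subgroup G) : (amalgamHom H₁ H₂).range = H₁ ⊔ H₂ := by
  apply le_antisymm
  · rintro _ ⟨x, rfl⟩
    induction x using Monoid.PushoutI.induction_on with
    | of i g =>
      fin_cases i
      · exact le_sup_left (a := H₁) (b := H₂) ((amalgamHom_of_zero H₁ H₂ g).symm ▸ g.2)
      · exact le_sup_right (a := H₁) (b := H₂) ((amalgamHom_of_one H₁ H₂ g).symm ▸ g.2)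
    | base h =>
      rw [← Monoid.PushoutI.of_apply_eq_base (infInclusion H₁ H₂) 0]
      exact le_sup_left (a := H₁) (b := H₂)
        ((amalgamHom_of_zero H₁ H₂ (infInclusion H₁ H₂ 0 h)).symm ▸ h.2.1)
    | mul x y hx hy => rw [map_mul]; exact mul_mem hx hy
  · refine sup_le (fun h hh => ?_) (fun h hh => ?_)
    · exact ⟨_, amalgamHom_of_zero H₁ H₂ ⟨h, hh⟩⟩
    · exact ⟨_, amalgamHom_of_one H₁ H₂ ⟨h, hh⟩⟩

/-- The ping-pong criterion for an amalgamated product: `H₁` is generated by `K` and `V₁`, while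
`H₂` is generated by its intersection with `K` and by `V₂`. -/
theorem isAmalgam_of_pingPong (act : G → Ω → Ω)
    (hact : ∀ g h x, act (g * h) x = act g (act h x)) (hone : ∀ x, act 1 x = x)
    (H₁ H₂ K : Subgroup G) (V : Fin 2 → Subgroup G) (D D' : Fin 2 → Set Ω) (x₀ : Ω)
    (hV : ∀ i, ∀ v ∈ V i, v ∈ K ∨ ∀ x ∈ D' i, act v x ∈ D i)
    (hK : ∀ i, ∀ k ∈ K, k ∈ V i ∨ ∀ x ∈ D i, act k x ∈ D' i)
    (hKd : ∀ i j, i ≠ j → ∀ k ∈ K, ∀ x ∈ D i, act k x ∈ D' j)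
    (hx₀ : ∀ i, ∀ k ∈ K, act k x₀ ∈ D' i) (hdisj : ∀ i, Disjoint (D i) (D' i))
    (h₁ : H₁ = Subgroup.closure ((K : Set G) ∪ V 0))
    (h₂ : H₂ = Subgroup.closure (((K ⊓ H₂ : Subgroup G) : Set G) ∪ V 1)) :
    IsAmalgam (H₁ ⊔ H₂) H₁ H₂ (K ⊓ H₂) := by
  have hKH : K ≤ H₁ := fun k hk => h₁ ▸ Subgroup.subset_closure (Or.inl hk)
  have hVH : V 0 ≤ H₁ := fun k hk => h₁ ▸ Subgroup.subset_closure (Or.inr hk)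
  have hVH' : V 1 ≤ H₂ := fun k hk => h₂ ▸ Subgroup.subset_closure (Or.inr hk)
  have hinf : H₁ ⊓ H₂ ≤ K := by
    rintro g ⟨hg₁, hg₂⟩
    -- Ping-pong is played with each leaf alone. An element of both factors outside `K` would move
    -- `x₀` into a `K`-translate of `D 0` and into a `K`-translate of `D 1`; but `K` carries `D 0`
    -- into `D' 1`, which is disjoint from `D 1`.
    have a₁ := pingPong (ι := Unit) act hact K (fun _ => V 0) (fun _ => D 0) (fun _ => D' 0) x₀
      (fun _ => hV 0) (fun _ => hK 0) (fun i j hij => (hij rfl).elim) (fun _ => hx₀ 0)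
      (g := g) (by simpa [Set.iUnion_const] using h₁ ▸ hg₁)
    have a₂ := pingPong (ι := Unit) act hact (K ⊓ H₂) (fun _ => V 1) (fun _ => D 1)
      (fun _ => D' 1) x₀
      (fun _ v hv => (hV 1 v hv).imp_left fun h => ⟨h, hVH' hv⟩) (fun _ k hk => hK 1 k hk.1)
      (fun i j hij => (hij rfl).elim) (fun _ k hk => hx₀ 1 k hk.1)
      (g := g) (by simpa only [Set.iUnion_const] using h₂ ▸ hg₂)
    rcases a₁ with h | ⟨k, hk, -, y, hy, e⟩
    · exact h
    rcases a₂ with h | ⟨k', hk', -, y', hy', e'⟩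
    · exact h.1
    exfalso
    have : y' = act (k'⁻¹ * k) y := by
      rw [hact, ← e, e', ← hact, inv_mul_cancel, hone]
    exact Set.disjoint_left.1 (hdisj 1) hy'
      (this ▸ hKd 0 1 (by decide) _ (mul_mem (inv_mem hk'.1) hk) y hy)
  refine ⟨le_antisymm (fun g hg => ⟨hinf hg, hg.2⟩) (fun g hg => ⟨hKH hg.1, hg.2⟩), ?_,
    amalgamHom_range H₁ H₂⟩
  let ι₁ : H₁ →* Monoid.PushoutI (infInclusion H₁ H₂) :=
    Monoid.PushoutI.of (φ := infInclusion H₁ H₂) 0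
  let ι₂ : H₂ →* Monoid.PushoutI (infInclusion H₁ H₂) :=
    Monoid.PushoutI.of (φ := infInclusion H₁ H₂) 1
  have hι : ∀ g (a : g ∈ H₁) (b : g ∈ H₂), ι₁ ⟨g, a⟩ = ι₂ ⟨g, b⟩ := of_zero_eq_of_one H₁ H₂
  have hι₁ : ∀ g a, amalgamHom H₁ H₂ (ι₁ ⟨g, a⟩) = g := fun g a => amalgamHom_of_zero H₁ H₂ ⟨g, a⟩
  have hι₂ : ∀ g a, amalgamHom H₁ H₂ (ι₂ ⟨g, a⟩) = g := fun g a => amalgamHom_of_one H₁ H₂ ⟨g, a⟩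
  -- The same game in the abstract amalgam, acting through `amalgamHom`: an element of the kernel
  -- fixes `x₀`, so it lies in the copy of `K`, where `amalgamHom` is injective.
  let K' := (K.subgroupOf H₁).map ι₁
  let V' : Fin 2 → Subgroup (Monoid.PushoutI (infInclusion H₁ H₂)) :=
    ![((V 0).subgroupOf H₁).map ι₁, ((V 1).subgroupOf H₂).map ι₂]
  have hK' : ∀ x ∈ K', ∃ k, ∃ h : k ∈ H₁, k ∈ K ∧ ι₁ ⟨k, h⟩ = x := by
    rintro _ ⟨⟨k, hk⟩, hk', rfl⟩
    exact ⟨k, hk, hk', rfl⟩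
  have hgen : ∀ x, x ∈ Subgroup.closure ((K' : Set (Monoid.PushoutI (infInclusion H₁ H₂))) ∪
      ⋃ i, (V' i : Set (Monoid.PushoutI (infInclusion H₁ H₂)))) := by
    have g₁ : ∀ h, ι₁ h ∈ Subgroup.closure ((K' : Set (Monoid.PushoutI (infInclusion H₁ H₂))) ∪
      ⋃ i, (V' i : Set (Monoid.PushoutI (infInclusion H₁ H₂)))) := by
      rintro ⟨h, hh⟩
      have hh' := hh
      rw [h₁] at hh'
      induction hh' using Subgroup.closure_induction with
      | mem x hx =>
        rcases hx with hx | hx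
        · exact Subgroup.subset_closure (Or.inl ⟨⟨x, hh⟩, hx, rfl⟩)
        · exact Subgroup.subset_closure (Or.inr (Set.mem_iUnion.2 ⟨0, ⟨x, hh⟩, hx, rfl⟩))
      | one => exact (map_one ι₁).symm ▸ one_mem _
      | mul x y hx hy ihx ihy =>
        rw [← h₁] at hx hy
        have := mul_mem (ihx hx) (ihy hy)
        rwa [← map_mul] at this
      | inv x hx ihx =>
        rw [← h₁] at hx
        have := inv_mem (ihx hx)
        rwa [← map_inv] at this
    have g₂ : ∀ h, ι₂ h ∈ Subgroup.closure ((K' : Set (Monoid.PushoutI (infInclusion H₁ H₂))) ∪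
      ⋃ i, (V' i : Set (Monoid.PushoutI (infInclusion H₁ H₂)))) := by
      rintro ⟨h, hh⟩
      have hh' := hh
      rw [h₂] at hh'
      induction hh' using Subgroup.closure_induction with
      | mem x hx =>
        rcases hx with hx | hx
        -- `K ⊓ H₂` lies in the amalgamated subgroup, so the two copies of `x` agree.
        · exact hι x (hKH hx.1) hh ▸ g₁ _
        · exact Subgroup.subset_closure (Or.inr (Set.mem_iUnion.2 ⟨1, ⟨x, hh⟩, hx, rfl⟩))
      | one => exact (map_one ι₂).symm ▸ one_mem _
      | mul x y hx hy ihx ihy =>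
        rw [← h₂] at hx hy
        have := mul_mem (ihx hx) (ihy hy)
        rwa [← map_mul] at this
      | inv x hx ihx =>
        rw [← h₂] at hx
        have := inv_mem (ihx hx)
        rwa [← map_inv] at this
    intro x
    induction x using Monoid.PushoutI.induction_on with
    | of i g =>
      fin_cases i
      · exact g₁ g
      · exact g₂ g
    | base h =>
      rw [← Monoid.PushoutI.of_apply_eq_base (infInclusion H₁ H₂) 0]
      exact g₁ _
    | mul x y hx hy => exact mul_mem hx hy
  rw [injective_iff_map_eq_one]
  intro x hx
  have hxK : x ∈ K' := by
    refine mem_of_act_eq (fun g y => act (amalgamHom H₁ H₂ g) y) (fun g h y => by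
      simp only [map_mul, hact]) (fun y => by simp only [map_one, hone]) K' V' D D' x₀ ?_ ?_ ?_ ?_
      hdisj (hgen x) (by simp only [hx, hone])
    · intro i
      fin_cases i
      · rintro _ ⟨⟨v, hvH⟩, hv, rfl⟩
        refine (hV 0 v hv).imp (fun h => ⟨⟨v, hvH⟩, h, rfl⟩) (fun h x hx => ?_)
        rw [hι₁]
        exact h x hx
      · rintro _ ⟨⟨v, hvH⟩, hv, rfl⟩
        refine (hV 1 v hv).imp (fun h => ⟨⟨v, hKH h⟩, h, hι _ _ _⟩) (fun h x hx => ?_)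
        rw [hι₂]
        exact h x hx
    · intro i x hx
      obtain ⟨k, hkH, hk, rfl⟩ := hK' x hx
      refine (hK i k hk).imp (fun h => ?_) (fun h x hx => ?_)
      · fin_cases i
        · exact ⟨⟨k, hkH⟩, h, rfl⟩
        · exact ⟨⟨k, hVH' h⟩, h, (hι _ _ _).symm⟩
      · rw [hι₁]
        exact h x hx
    · intro i j hij x hx y hy
      obtain ⟨k, hkH, hk, rfl⟩ := hK' x hx
      rw [hι₁]
      exact hKd i j hij k hk y hy
    · intro i x hx
      obtain ⟨k, hkH, hk, rfl⟩ := hK' x hx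
      rw [hι₁]
      exact hx₀ i k hk
  obtain ⟨k, hkH, hk, rfl⟩ := hK' x hxK
  rw [hι₁] at hx
  subst hx
  exact map_one ι₁

end Amalgam

end RotationGroups

namespace RotationGroups

/-! ### 2-adic distances of roots of unity from 1. -/

section Valuation

/-- There is a valuation of `ℂ` that extends the `2`-adic one. -/
theorem exists_valuation_two_lt_one : ∃ O : ValuationSubring ℂ, O.valuation 2 < 1 := by
  -- `2` generates a proper ideal of the image of `ℤ` in `ℂ`, and some valuation ring of `ℂ` has
  -- this ideal among its nonunits.
  have hI : Ideal.span {(2 : (⊥ : Subring ℂ))} ≠ ⊤ := by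
    rw [Ne, Ideal.span_singleton_eq_top]
    intro h
    obtain ⟨⟨x, hx⟩, h⟩ := h.exists_right_inv
    obtain ⟨k, rfl⟩ := Subring.mem_bot.1 hx
    have h' : (2 : ℂ) * (k : ℂ) = 1 := congrArg Subtype.val h
    have h'' : 2 * k = 1 := by exact_mod_cast h'
    omega
  obtain ⟨O, -, hO⟩ := Ideal.image_subset_nonunits_valuationSubring _ hI
  exact ⟨O, (O.mem_nonunits_iff).1 (hO ⟨2, Ideal.mem_span_singleton_self _, rfl⟩)⟩

variable {Γ₀ : Type*} [LinearOrderedCommGroupWithZero Γ₀] (v : Valuation ℂ Γ₀)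

theorem val_eq_one_of_pow_eq_one {w : ℂ} {N : ℕ} (hN : N ≠ 0) (hw : w ^ N = 1) : v w = 1 := by
  have : v w ^ N = 1 := by rw [← map_pow, hw, map_one]
  exact (pow_eq_one_iff_of_nonneg zero_le hN).1 this

theorem val_natCast_le_one (n : ℕ) : v (n : ℂ) ≤ 1 := by
  induction n with
  | zero => simp
  | succ n ih => push_cast; exact v.map_add_le ih (map_one v).le

theorem val_pow_sub_one_le {w : ℂ} (hw : v w ≤ 1) (j : ℕ) : v (w ^ j - 1) ≤ v (w - 1) := by
  have h1 : v (∑ i ∈ Finset.range j, w ^ i) ≤ 1 :=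
    v.map_sum_le fun i _ => by rw [map_pow]; exact pow_le_one' hw i
  rw [← geom_sum_mul, map_mul]
  exact mul_le_of_le_one_left' h1

variable {v} (h2 : v 2 < 1)
include h2

theorem val_odd_natCast {n : ℕ} (hn : Odd n) : v (n : ℂ) = 1 := by
  obtain ⟨k, rfl⟩ := hn
  push_cast
  rw [add_comm]
  refine v.map_one_add_of_lt ?_
  rw [map_mul]
  exact lt_of_le_of_lt (mul_le_of_le_one_right' (val_natCast_le_one v k)) h2

/-- If `w ≠ 1` has odd order, then `w - 1` is a `2`-adic unit. -/
theorem val_sub_one_of_odd {w : ℂ} {N : ℕ} (hN : Odd N) (hw : w ^ N = 1) (hw1 : w ≠ 1) :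
    v (w - 1) = 1 := by
  have hvw := val_eq_one_of_pow_eq_one v hN.pos.ne' hw
  refine le_antisymm (v.map_sub_le hvw.le (map_one v).le) ?_
  by_contra! hlt
  -- The powers of `w` sum to `0`; if they were all congruent to `1`, the sum would be congruent to
  -- `N`, which is odd and so a unit.
  have hsum : ∑ i ∈ Finset.range N, w ^ i = 0 := by
    have := geom_sum_mul w N
    rw [hw, sub_self] at this
    exact (mul_eq_zero.1 this).resolve_right (sub_ne_zero.2 hw1)
  have hN' : ∑ i ∈ Finset.range N, (w ^ i - 1) = -(N : ℂ) := by
    rw [Finset.sum_sub_distrib, hsum]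
    simp
  have : v (∑ i ∈ Finset.range N, (w ^ i - 1)) < 1 :=
    v.map_sum_lt one_ne_zero fun i _ => (val_pow_sub_one_le v hvw.le i).trans_lt hlt
  rw [hN', Valuation.map_neg, val_odd_natCast h2 hN] at this
  exact lt_irrefl _ this

omit h2 in
theorem val_one_sub_I_sq : v (1 - Complex.I) ^ 2 = v 2 := by
  have h : (1 - Complex.I) ^ 2 = -(Complex.I * 2) := by
    linear_combination Complex.I_sq
  have hI : v Complex.I = 1 := val_eq_one_of_pow_eq_one v (N := 4) (by norm_num) Complex.I_pow_four
  rw [← map_pow, h, Valuation.map_neg, map_mul, hI, one_mul]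

theorem val_one_sub_I_lt_one : v (1 - Complex.I) < 1 := by
  rw [← pow_lt_one_iff (two_ne_zero), val_one_sub_I_sq]
  exact h2

omit h2 in
theorem val_one_sub_I_ne_zero : v (1 - Complex.I) ≠ 0 := by
  rw [Valuation.ne_zero_iff]
  intro h
  have := congrArg Complex.im h
  simp at this

theorem val_two_lt_val_one_sub_I : v 2 < v (1 - Complex.I) := by
  rw [← val_one_sub_I_sq, sq]
  exact mul_lt_of_lt_one_left (zero_lt_iff.2 val_one_sub_I_ne_zero) (val_one_sub_I_lt_one h2)

omit h2 in
theorem val_eq_of_sq_eq_neg_one {u : ℂ} (hu : u ^ 2 = -1) : v (u - 1) = v (1 - Complex.I) := by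
  have h : (u - Complex.I) * (u + Complex.I) = 0 := by
    linear_combination hu - Complex.I_sq
  have hI : v Complex.I = 1 := val_eq_one_of_pow_eq_one v (N := 4) (by norm_num) Complex.I_pow_four
  rcases mul_eq_zero.1 h with h | h
  · rw [sub_eq_zero.1 h, v.map_sub_swap]
  · rw [eq_neg_of_add_eq_zero_left h, show -Complex.I - 1 = -(Complex.I * (1 - Complex.I)) by
      linear_combination -Complex.I_sq, Valuation.map_neg, map_mul, hI, one_mul]

/-- Squaring never increases the distance from `1`, since `w - 1` divides `w ^ 2 - 1`. Repeated
squaring ends at a square root of `-1`, at distance `|2|^(1/2)`, or at a nontrivial root of odd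
order, at distance `1`. -/
theorem val_two_lt_val_sub_one {w : ℂ} {N : ℕ} (hN : N ≠ 0) (hw : w ^ N = 1) (hw2 : w ^ 2 ≠ 1) :
    v 2 < v (w - 1) := by
  obtain ⟨k, M, hM, rfl⟩ := Nat.exists_eq_two_pow_mul_odd hN
  clear hN
  induction k generalizing w with
  | zero =>
    rw [pow_zero, one_mul] at hw
    rw [val_sub_one_of_odd h2 hM hw (by rintro rfl; simp at hw2)]
    exact h2
  | succ k ih =>
    have hvw := val_eq_one_of_pow_eq_one v (by have := hM.pos; positivity) hw
    by_cases h4 : (w ^ 2) ^ 2 = 1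
    · have hu : w ^ 2 = -1 := (sq_eq_one_iff.1 h4).resolve_left hw2
      rw [val_eq_of_sq_eq_neg_one hu]
      exact val_two_lt_val_one_sub_I h2
    · refine (ih (w := w ^ 2) h4 ?_).trans_le (val_pow_sub_one_le v hvw.le 2)
      rw [← pow_mul, ← hw]
      ring_nf

/-- Repeated squaring again, now stopping at a primitive eighth root of unity: there `(w - 1) * (w +
1) = w ^ 2 - 1` has the value of `1 - I`, and the factor `w + 1` has value below `1`, so the
inequality is strict. -/
theorem val_one_sub_I_lt_val_sub_one {w : ℂ} {N : ℕ} (hN : N ≠ 0) (hw : w ^ N = 1)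
    (hw4 : w ^ 4 ≠ 1) : v (1 - Complex.I) < v (w - 1) := by
  obtain ⟨k, M, hM, rfl⟩ := Nat.exists_eq_two_pow_mul_odd hN
  clear hN
  induction k generalizing w with
  | zero =>
    rw [pow_zero, one_mul] at hw
    rw [val_sub_one_of_odd h2 hM hw (by rintro rfl; simp at hw4)]
    exact val_one_sub_I_lt_one h2
  | succ k ih =>
    have hvw := val_eq_one_of_pow_eq_one v (by have := hM.pos; positivity) hw
    by_cases h8 : (w ^ 2) ^ 4 = 1
    · have hu : (w ^ 2) ^ 2 = -1 := by
        have : (w ^ 4) ^ 2 = 1 := by rw [← h8]; ring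
        rw [← (sq_eq_one_iff.1 this).resolve_left hw4]
        ring
      have hlt : v (w + 1) < 1 := by
        rw [← pow_lt_one_iff (two_ne_zero), ← map_pow,
          show (w + 1) ^ 2 = (w ^ 2 - 1) + 2 * (w + 1) by ring]
        refine v.map_add_lt ?_ ?_
        · rw [val_eq_of_sq_eq_neg_one hu]
          exact val_one_sub_I_lt_one h2
        · rw [map_mul]
          exact (mul_le_of_le_one_right' (v.map_add_le hvw.le (map_one v).le)).trans_lt h2
      have h1 : v (w - 1) ≠ 0 := by
        rw [Valuation.ne_zero_iff, sub_ne_zero]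
        rintro rfl
        simp at hw4
      rw [← val_eq_of_sq_eq_neg_one hu, show w ^ 2 - 1 = (w - 1) * (w + 1) by ring, map_mul]
      exact mul_lt_of_lt_one_right (zero_lt_iff.2 h1) hlt
    · refine (ih (w := w ^ 2) h8 ?_).trans_le (val_pow_sub_one_le v hvw.le 2)
      rw [← pow_mul, ← hw]
      ring_nf

/-- Already `w ^ 2 - 1` is a unit, because `w ^ 2` is nontrivial of odd order, and `w - 1` divides
it. -/
theorem val_sub_one_eq_one {w : ℂ} {M : ℕ} (hM : Odd M) (hw : w ^ (2 * M) = 1) (hw2 : w ^ 2 ≠ 1) :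
    v (w - 1) = 1 := by
  have hvw := val_eq_one_of_pow_eq_one v (mul_ne_zero two_ne_zero hM.pos.ne') hw
  refine le_antisymm (v.map_sub_le hvw.le (map_one v).le) ?_
  rw [← val_sub_one_of_odd h2 hM (by rw [← pow_mul, hw]) hw2]
  exact val_pow_sub_one_le v hvw.le 2

end Valuation

end RotationGroups

namespace RotationGroups

noncomputable section

/-! ### Identities between rotations about the axes and about horizontal lines. -/

section Rotations

theorem rotX_zero : rotX 0 = 1 := by
  apply Subtype.ext
  ext i j
  fin_cases i <;> fin_cases j <;> simp [rotX]

theorem rotZ_zero : rotZ 0 = 1 := by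
  apply Subtype.ext
  ext i j
  fin_cases i <;> fin_cases j <;> simp [rotZ]

theorem rotX_add (a b : ℝ) : rotX (a + b) = rotX a * rotX b := by
  apply Subtype.ext
  ext i j
  fin_cases i <;> fin_cases j <;>
    simp [rotX, Real.cos_add, Real.sin_add] <;> ring

theorem rotZ_add (a b : ℝ) : rotZ (a + b) = rotZ a * rotZ b := by
  apply Subtype.ext
  ext i j
  fin_cases i <;> fin_cases j <;>
    simp [rotZ, Real.cos_add, Real.sin_add] <;> ring

theorem rotX_neg (a : ℝ) : rotX (-a) = (rotX a)⁻¹ := by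
  rw [eq_inv_iff_mul_eq_one, ← rotX_add, neg_add_cancel, rotX_zero]

theorem rotZ_neg (a : ℝ) : rotZ (-a) = (rotZ a)⁻¹ := by
  rw [eq_inv_iff_mul_eq_one, ← rotZ_add, neg_add_cancel, rotZ_zero]

theorem rotX_two_pi : rotX (2 * Real.pi) = 1 := by
  rw [← rotX_zero]
  apply Subtype.ext
  simp [rotX]

theorem rotZ_two_pi : rotZ (2 * Real.pi) = 1 := by
  rw [← rotZ_zero]
  apply Subtype.ext
  simp [rotZ]

theorem rotX_pow (a : ℝ) (k : ℕ) : rotX a ^ k = rotX (k * a) := by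
  induction k with
  | zero => simp [rotX_zero]
  | succ k ih => rw [pow_succ, ih, ← rotX_add]; push_cast; ring_nf

theorem rotZ_pow (a : ℝ) (k : ℕ) : rotZ a ^ k = rotZ (k * a) := by
  induction k with
  | zero => simp [rotZ_zero]
  | succ k ih => rw [pow_succ, ih, ← rotZ_add]; push_cast; ring_nf

theorem rotX_zpow (a : ℝ) (k : ℤ) : rotX a ^ k = rotX (k * a) := by
  cases k with
  | ofNat k => simp [rotX_pow]
  | negSucc k => simp only [zpow_negSucc, rotX_pow, ← rotX_neg]; push_cast; ring_nf

theorem rotZ_zpow (a : ℝ) (k : ℤ) : rotZ a ^ k = rotZ (k * a) := by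
  cases k with
  | ofNat k => simp [rotZ_pow]
  | negSucc k => simp only [zpow_negSucc, rotZ_pow, ← rotZ_neg]; push_cast; ring_nf

theorem rotX_pi_mul_rotZ (a : ℝ) : rotX Real.pi * rotZ a = rotZ (-a) * rotX Real.pi := by
  apply Subtype.ext
  ext i j
  fin_cases i <;> fin_cases j <;>
    simp [rotX, rotZ]

theorem rotZ_pi_mul_rotX (a : ℝ) : rotZ Real.pi * rotX a = rotX (-a) * rotZ Real.pi := by
  apply Subtype.ext
  ext i j
  fin_cases i <;> fin_cases j <;>
    simp [rotX, rotZ]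

/-- Both sides are the rotation by `θ` about the `y`-axis. -/
theorem rotZ_conj_rotX (θ : ℝ) : rotZ (Real.pi / 2) * rotX θ * rotZ (-(Real.pi / 2)) =
    rotX (-(Real.pi / 2)) * rotZ θ * rotX (Real.pi / 2) := by
  apply Subtype.ext
  ext i j
  fin_cases i <;> fin_cases j <;>
    simp [rotX, rotZ]

theorem rotLine_zero_left (θ : ℝ) : rotLine 0 θ = rotX θ := by
  simp [rotLine, rotZ_zero]

theorem rotLine_add (φ a b : ℝ) : rotLine φ (a + b) = rotLine φ a * rotLine φ b := by
  simp [rotLine, rotX_add, mul_assoc]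

theorem rotLine_pow (φ a : ℝ) (k : ℕ) : rotLine φ a ^ k = rotLine φ (k * a) := by
  rw [rotLine, conj_pow, rotX_pow, rotLine]

theorem rotLine_zpow (φ a : ℝ) (k : ℤ) : rotLine φ a ^ k = rotLine φ (k * a) := by
  rw [rotLine, conj_zpow, rotX_zpow, rotLine]

theorem rotLine_neg (φ a : ℝ) : rotLine φ (-a) = (rotLine φ a)⁻¹ := by
  rw [rotLine, rotX_neg, rotLine]; group

theorem rotLine_two_pi (φ : ℝ) : rotLine φ (2 * Real.pi) = 1 := by
  simp [rotLine, rotX_two_pi]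

theorem rotZ_conj_rotLine (φ ψ θ : ℝ) :
    rotZ φ * rotLine ψ θ * (rotZ φ)⁻¹ = rotLine (φ + ψ) θ := by
  simp only [rotLine, rotZ_add, mul_inv_rev, mul_assoc]

/-- Horizontal half-turns differ only by rotations about the `z`-axis; this is what lets one
dihedral group about the `z`-axis contain half-turns about several of the lines in play. -/
theorem rotLine_pi (φ : ℝ) : rotLine φ Real.pi = rotZ (2 * φ) * rotX Real.pi := by
  rw [rotLine, ← rotZ_neg, mul_assoc, rotX_pi_mul_rotZ, neg_neg, ← mul_assoc, ← rotZ_add, two_mul]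

theorem rotLine_pi_mul_rotZ (φ a : ℝ) :
    rotLine φ Real.pi * rotZ a = rotZ (-a) * rotLine φ Real.pi := by
  rw [rotLine_pi, mul_assoc, rotX_pi_mul_rotZ, ← mul_assoc, ← mul_assoc, ← rotZ_add, ← rotZ_add,
    add_comm]

theorem rotZ_pi_mul_rotLine (φ a : ℝ) :
    rotZ Real.pi * rotLine φ a = rotLine φ (-a) * rotZ Real.pi := by
  have h : ∀ b, rotZ Real.pi * rotZ b = rotZ b * rotZ Real.pi := fun b => by
    rw [← rotZ_add, ← rotZ_add, add_comm]
  rw [rotLine, rotLine, ← rotZ_neg]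
  simp only [mul_assoc]
  rw [← h, ← mul_assoc (rotX (-a)), ← rotZ_pi_mul_rotX, ← mul_assoc, h]
  simp only [mul_assoc]

end Rotations

/-! ### The action on isotropic vectors, and how it moves 2-adic discs. -/

section Spinor

open Complex

/-- The action of a rotation on `ℂ³`. -/
def complexAct (g : SO3) (x : Fin 3 → ℂ) : Fin 3 → ℂ :=
  ((g : Matrix (Fin 3) (Fin 3) ℝ).map ((↑) : ℝ → ℂ)).mulVec x

theorem complexAct_mul (g h : SO3) (x : Fin 3 → ℂ) :
    complexAct (g * h) x = complexAct g (complexAct h x) := by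
  simp only [complexAct, Matrix.mulVec_mulVec]
  congr 1
  exact Matrix.map_mul (f := Complex.ofRealHom)

theorem complexAct_one (x : Fin 3 → ℂ) : complexAct 1 x = x := by
  simp [complexAct]

/-- The parametrization of the cone of isotropic vectors of `ℂ³` by `ℂ²`. -/
def spinor (a b : ℂ) : Fin 3 → ℂ := ![b ^ 2 - a ^ 2, I * (a ^ 2 + b ^ 2), 2 * (a * b)]

/-- The coordinates determine `a ^ 2`, `b ^ 2` and `a * b`, hence the pair up to a common sign,
which no valuation sees. -/
theorem spinor_eq {a b c d : ℂ} (h : spinor a b = spinor c d) :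
    (a = c ∧ b = d) ∨ (a = -c ∧ b = -d) := by
  have h0 : b ^ 2 - a ^ 2 = d ^ 2 - c ^ 2 := congrFun h 0
  have h1 : I * (a ^ 2 + b ^ 2) = I * (c ^ 2 + d ^ 2) := congrFun h 1
  have h2 : 2 * (a * b) = 2 * (c * d) := congrFun h 2
  have h1' := mul_left_cancel₀ I_ne_zero h1
  have h2' := mul_left_cancel₀ two_ne_zero h2
  have hb : b ^ 2 = d ^ 2 := by linear_combination (h0 + h1') / 2
  have ha : a ^ 2 = c ^ 2 := by linear_combination (h1' - h0) / 2
  rcases sq_eq_sq_iff_eq_or_eq_neg.1 ha with rfl | rfl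
  · by_cases ha0 : a = 0
    · subst ha0
      rcases sq_eq_sq_iff_eq_or_eq_neg.1 hb with rfl | rfl
      · exact Or.inl ⟨rfl, rfl⟩
      · exact Or.inr ⟨by simp, rfl⟩
    · exact Or.inl ⟨rfl, mul_left_cancel₀ ha0 h2'⟩
  · by_cases hc0 : c = 0
    · subst hc0
      rcases sq_eq_sq_iff_eq_or_eq_neg.1 hb with rfl | rfl
      · exact Or.inl ⟨by simp, rfl⟩
      · exact Or.inr ⟨rfl, rfl⟩
    · exact Or.inr ⟨rfl, mul_left_cancel₀ hc0 (by linear_combination -h2')⟩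

theorem exp_half_mul_exp_neg_half (θ : ℝ) : exp ((θ / 2 : ℝ) * I) * exp (-(θ / 2 : ℝ) * I) = 1 := by
  rw [← Complex.exp_add, neg_mul, add_neg_cancel, Complex.exp_zero]

theorem exp_half_sq (θ : ℝ) : exp ((θ / 2 : ℝ) * I) ^ 2 = exp (θ * I) := by
  rw [← Complex.exp_nat_mul]; push_cast; ring_nf

theorem exp_neg_half_sq (θ : ℝ) : exp (-(θ / 2 : ℝ) * I) ^ 2 = exp (-θ * I) := by
  rw [← Complex.exp_nat_mul]; push_cast; ring_nf

/-- The half angles come from the double cover `SU(2) → SO(3)`; on `a / b` the map is multiplication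
by `exp (θ I)`. -/
theorem complexAct_rotZ_spinor (θ : ℝ) (a b : ℂ) : complexAct (rotZ θ) (spinor a b) =
    spinor (exp ((θ / 2 : ℝ) * I) * a) (exp (-(θ / 2 : ℝ) * I) * b) := by
  have hEF := exp_half_mul_exp_neg_half θ
  have hc : ((Real.cos θ : ℝ) : ℂ) =
      (exp ((θ / 2 : ℝ) * I) ^ 2 + exp (-(θ / 2 : ℝ) * I) ^ 2) / 2 := by
    rw [exp_half_sq, exp_neg_half_sq, ofReal_cos, Complex.cos]
  have hs : ((Real.sin θ : ℝ) : ℂ) =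
      (exp (-(θ / 2 : ℝ) * I) ^ 2 - exp ((θ / 2 : ℝ) * I) ^ 2) * I / 2 := by
    rw [exp_half_sq, exp_neg_half_sq, ofReal_sin, Complex.sin]
  set E := exp ((θ / 2 : ℝ) * I)
  set F := exp (-(θ / 2 : ℝ) * I)
  ext i
  fin_cases i <;>
    simp [-ofReal_cos, -ofReal_sin, complexAct, rotZ, spinor, Matrix.mulVec, dotProduct,
      Fin.sum_univ_three, hc, hs]
  · linear_combination (E ^ 2 - F ^ 2) / 2 * (a ^ 2 + b ^ 2) * I_sq
  · ring
  · linear_combination -(a * b) * hEF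

/-- The matrix in `SU(2)` above `rotX θ` is diagonal in the coordinates `a + b` and `a - b`, so `a /
b = ±1` are fixed. -/
theorem complexAct_rotX_spinor (θ : ℝ) (a b : ℂ) : complexAct (rotX θ) (spinor a b) =
    spinor ((exp ((θ / 2 : ℝ) * I) * (a + b) + exp (-(θ / 2 : ℝ) * I) * (a - b)) / 2)
      ((exp ((θ / 2 : ℝ) * I) * (a + b) - exp (-(θ / 2 : ℝ) * I) * (a - b)) / 2) := by
  have hEF := exp_half_mul_exp_neg_half θ
  have hc : ((Real.cos θ : ℝ) : ℂ) =
      (exp ((θ / 2 : ℝ) * I) ^ 2 + exp (-(θ / 2 : ℝ) * I) ^ 2) / 2 := by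
    rw [exp_half_sq, exp_neg_half_sq, ofReal_cos, Complex.cos]
  have hs : ((Real.sin θ : ℝ) : ℂ) =
      (exp (-(θ / 2 : ℝ) * I) ^ 2 - exp ((θ / 2 : ℝ) * I) ^ 2) * I / 2 := by
    rw [exp_half_sq, exp_neg_half_sq, ofReal_sin, Complex.sin]
  set E := exp ((θ / 2 : ℝ) * I)
  set F := exp (-(θ / 2 : ℝ) * I)
  ext i
  fin_cases i <;>
    simp [-ofReal_cos, -ofReal_sin, complexAct, rotX, spinor, Matrix.mulVec, dotProduct,
      Fin.sum_univ_three, hc, hs]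
  · linear_combination -(b ^ 2 - a ^ 2) * hEF
  · ring
  · linear_combination (F ^ 2 - E ^ 2) / 2 * (a ^ 2 + b ^ 2) * I_sq

variable {Γ₀ : Type*} [LinearOrderedCommGroupWithZero Γ₀] (v : Valuation ℂ Γ₀)

/-- The isotropic vectors in the disc of radius `c` about `exp (φ i)`. -/
def disc (φ : ℝ) (c : Γ₀) : Set (Fin 3 → ℂ) :=
  {x | ∃ a b, (a ≠ 0 ∨ b ≠ 0) ∧ x = spinor a b ∧ v (a - exp (φ * I) * b) ≤ c * v b}

/-- The isotropic vectors outside the disc of radius `c` about `exp (φ i)`. -/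
def codisc (φ : ℝ) (c : Γ₀) : Set (Fin 3 → ℂ) :=
  {x | ∃ a b, (a ≠ 0 ∨ b ≠ 0) ∧ x = spinor a b ∧ c * v b < v (a - exp (φ * I) * b)}

theorem disjoint_disc_codisc (φ : ℝ) (c : Γ₀) : Disjoint (disc v φ c) (codisc v φ c) := by
  rw [Set.disjoint_left]
  rintro x ⟨a, b, -, rfl, h⟩ ⟨a', b', -, h', h''⟩
  rcases spinor_eq h' with ⟨rfl, rfl⟩ | ⟨rfl, rfl⟩
  · exact absurd h h''.not_ge
  · rw [Valuation.map_neg, show -a' - exp (φ * I) * -b' = -(a' - exp (φ * I) * b') by ring,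
      Valuation.map_neg] at h
    exact absurd h h''.not_ge

variable {v}

theorem val_exp_half {θ : ℝ} (hθ : v (exp (θ * I)) = 1) :
    v (exp ((θ / 2 : ℝ) * I)) = 1 ∧ v (exp (-(θ / 2 : ℝ) * I)) = 1 := by
  have h1 : v (exp ((θ / 2 : ℝ) * I)) = 1 := by
    have : v (exp ((θ / 2 : ℝ) * I)) ^ 2 = 1 := by rw [← map_pow, exp_half_sq, hθ]
    exact (pow_eq_one_iff_of_nonneg zero_le two_ne_zero).1 this
  refine ⟨h1, ?_⟩
  have := congrArg v (exp_half_mul_exp_neg_half θ)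
  rwa [map_mul, h1, one_mul, map_one] at this

theorem rotZ_spinor_val {θ φ : ℝ} (hθ : v (exp (θ * I)) = 1) (a b : ℂ) :
    v (exp ((θ / 2 : ℝ) * I) * a - exp ((θ + φ : ℝ) * I) * (exp (-(θ / 2 : ℝ) * I) * b)) =
      v (a - exp (φ * I) * b) ∧ v (exp (-(θ / 2 : ℝ) * I) * b) = v b := by
  obtain ⟨h1, h2⟩ := val_exp_half hθ
  refine ⟨?_, by rw [map_mul, h2, one_mul]⟩
  have hEF := exp_half_mul_exp_neg_half θ
  have : exp ((θ + φ : ℝ) * I) = exp ((θ / 2 : ℝ) * I) ^ 2 * exp (φ * I) := by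
    rw [exp_half_sq, ← Complex.exp_add]; push_cast; ring_nf
  rw [this, show exp ((θ / 2 : ℝ) * I) * a -
    exp ((θ / 2 : ℝ) * I) ^ 2 * exp (φ * I) * (exp (-(θ / 2 : ℝ) * I) * b) =
    exp ((θ / 2 : ℝ) * I) * (a - exp (φ * I) * b) by
      linear_combination -exp ((θ / 2 : ℝ) * I) * exp (φ * I) * b * hEF, map_mul, h1, one_mul]

theorem rotZ_disc {θ : ℝ} (hθ : v (exp (θ * I)) = 1) {φ : ℝ} {c : Γ₀} {x : Fin 3 → ℂ}
    (hx : x ∈ disc v φ c) : complexAct (rotZ θ) x ∈ disc v (θ + φ) c := by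
  obtain ⟨a, b, h0, rfl, h⟩ := hx
  refine ⟨_, _, by simpa [Complex.exp_ne_zero] using h0, complexAct_rotZ_spinor θ a b, ?_⟩
  rw [(rotZ_spinor_val hθ a b).1, (rotZ_spinor_val (φ := φ) hθ a b).2]
  exact h

theorem rotZ_codisc {θ : ℝ} (hθ : v (exp (θ * I)) = 1) {φ : ℝ} {c : Γ₀} {x : Fin 3 → ℂ}
    (hx : x ∈ codisc v φ c) : complexAct (rotZ θ) x ∈ codisc v (θ + φ) c := by
  obtain ⟨a, b, h0, rfl, h⟩ := hx
  refine ⟨_, _, by simpa [Complex.exp_ne_zero] using h0, complexAct_rotZ_spinor θ a b, ?_⟩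
  rw [(rotZ_spinor_val hθ a b).1, (rotZ_spinor_val (φ := φ) hθ a b).2]
  exact h

theorem complexAct_rotX_pi_spinor (a b : ℂ) :
    complexAct (rotX Real.pi) (spinor a b) = spinor (I * b) (I * a) := by
  have h1 : exp ((Real.pi / 2 : ℝ) * I) = I := by
    push_cast; exact Complex.exp_pi_div_two_mul_I
  have h2 : exp (-(Real.pi / 2 : ℝ) * I) = -I := by
    push_cast; rw [← neg_div]; exact Complex.exp_neg_pi_div_two_mul_I
  rw [complexAct_rotX_spinor, h1, h2]
  congr 1 <;> ring

/-- The half-turn inverts `a / b`. As `c < 1`, the disc consists of elements of value `1`, on which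
inversion is an isometry. -/
theorem rotX_pi_disc {φ : ℝ} (hφ : v (exp (φ * I)) = 1) {c : Γ₀} (hc : c < 1) {x : Fin 3 → ℂ}
    (hx : x ∈ disc v φ c) : complexAct (rotX Real.pi) x ∈ disc v (-φ) c := by
  obtain ⟨a, b, h0, rfl, h⟩ := hx
  refine ⟨_, _, by simpa [or_comm] using h0, complexAct_rotX_pi_spinor a b, ?_⟩
  have hI : v I = 1 := val_eq_one_of_pow_eq_one v (N := 4) (by norm_num) I_pow_four
  have hinv : exp (φ * I) * exp ((-φ : ℝ) * I) = 1 := by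
    rw [← Complex.exp_add]; push_cast; rw [neg_mul, add_neg_cancel, Complex.exp_zero]
  have hφ' : v (exp ((-φ : ℝ) * I)) = 1 := by
    have := congrArg v hinv
    rwa [map_mul, hφ, one_mul, map_one] at this
  have hb : v b ≠ 0 := by
    intro hb
    rw [hb, mul_zero, nonpos_iff_eq_zero, Valuation.zero_iff] at h
    rw [Valuation.zero_iff] at hb
    subst hb
    simp at h h0
    exact h0 h
  have hab : v a = v b := by
    have h1 : v (exp (φ * I) * b) = v b := by rw [map_mul, hφ, one_mul]
    rw [← h1]
    refine v.map_eq_of_sub_lt (h.trans_lt ?_)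
    rw [h1]
    exact mul_lt_of_lt_one_left (zero_lt_iff.2 hb) hc
  rw [show I * b - exp ((-φ : ℝ) * I) * (I * a) =
    -(I * exp ((-φ : ℝ) * I) * (a - exp (φ * I) * b)) by linear_combination (-I * b) * hinv,
    Valuation.map_neg, map_mul, map_mul, map_mul, hI, hφ', one_mul, one_mul, one_mul, hab]
  exact h

/-- The contraction behind every ping-pong below. Let `w = exp (θ I)` and let `(a', b')` be the
image. Then `|a' - b'| = |a - b|`, while `2 b'` is `(w - 1) (a - b) + 2 w b` up to a unit. Outside
the disc the first summand dominates, because `c |w - 1| = |2|`; hence `|a' - b'| = c |b'|`. -/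
theorem rotX_codisc {θ : ℝ} (hθ : v (exp (θ * I)) = 1) {c : Γ₀} (hc : c * v (exp (θ * I) - 1) = v 2)
    {x : Fin 3 → ℂ} (hx : x ∈ codisc v 0 c) : complexAct (rotX θ) x ∈ disc v 0 c := by
  obtain ⟨a, b, h0, rfl, h⟩ := hx
  have hEF := exp_half_mul_exp_neg_half θ
  have hE2 := exp_half_sq θ
  obtain ⟨h1, h2⟩ := val_exp_half hθ
  refine ⟨_, _, ?_, complexAct_rotX_spinor θ a b, ?_⟩
  · by_contra! hcon
    have e1 : exp ((θ / 2 : ℝ) * I) * (a + b) = 0 := by linear_combination hcon.1 + hcon.2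
    have e2 : exp (-(θ / 2 : ℝ) * I) * (a - b) = 0 := by linear_combination hcon.1 - hcon.2
    have e1' := (mul_eq_zero.1 e1).resolve_left (Complex.exp_ne_zero _)
    have e2' := (mul_eq_zero.1 e2).resolve_left (Complex.exp_ne_zero _)
    rcases h0 with h0 | h0
    · exact h0 (by linear_combination (e1' + e2') / 2)
    · exact h0 (by linear_combination (e1' - e2') / 2)
  · rw [ofReal_zero, zero_mul, Complex.exp_zero, one_mul] at h ⊢
    set E := exp ((θ / 2 : ℝ) * I)
    set F := exp (-(θ / 2 : ℝ) * I)
    set w := exp (θ * I)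
    rw [show (E * (a + b) + F * (a - b)) / 2 - (E * (a + b) - F * (a - b)) / 2 = F * (a - b) by
      ring, map_mul, h2, one_mul]
    have hw : v (w - 1) ≠ 0 := by
      intro h0
      rw [h0, mul_zero, eq_comm, Valuation.zero_iff] at hc
      norm_num at hc
    have hlt : v (2 * w * b) < v ((w - 1) * (a - b)) := by
      rw [map_mul, map_mul, map_mul, hθ, mul_one, ← hc, mul_comm c, mul_assoc]
      exact mul_lt_mul_of_pos_left h (zero_lt_iff.2 hw)
    have hden : v 2 * v ((E * (a + b) - F * (a - b)) / 2) = v (w - 1) * v (a - b) := by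
      rw [← map_mul v (w - 1), ← v.map_add_eq_of_lt_left hlt, ← one_mul (v 2), ← h1, ← map_mul,
        ← map_mul]
      congr 1
      linear_combination (a + b) * hE2 - (a - b) * hEF
    rw [← hc, mul_right_comm, mul_comm (v (w - 1))] at hden
    exact (mul_right_cancel₀ hw hden).ge

theorem rotLine_codisc {θ φ : ℝ} (hφ : v (exp (φ * I)) = 1) (hθ : v (exp (θ * I)) = 1) {c : Γ₀}
    (hc : c * v (exp (θ * I) - 1) = v 2) {x : Fin 3 → ℂ} (hx : x ∈ codisc v φ c) :
    complexAct (rotLine φ θ) x ∈ disc v φ c := by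
  have hφ' : v (exp ((-φ : ℝ) * I)) = 1 := by
    rw [ofReal_neg, neg_mul, Complex.exp_neg, map_inv₀, hφ, inv_one]
  rw [rotLine, complexAct_mul, complexAct_mul, ← rotZ_neg]
  have h1 := rotZ_codisc hφ' hx
  rw [neg_add_cancel] at h1
  have h2 := rotZ_disc hφ (rotX_codisc hθ hc h1)
  rwa [add_zero] at h2

/-- Two discs whose centres are far apart are disjoint. -/
theorem disc_subset_codisc {φ ψ : ℝ} {c c' : Γ₀} (hc : c < v (exp (φ * I) - exp (ψ * I)))
    (hc' : c' < v (exp (φ * I) - exp (ψ * I))) : disc v φ c ⊆ codisc v ψ c' := by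
  rintro x ⟨a, b, h0, rfl, h⟩
  have hb : v b ≠ 0 := by
    intro hb
    rw [hb, mul_zero, nonpos_iff_eq_zero, Valuation.zero_iff] at h
    rw [Valuation.zero_iff] at hb
    subst hb
    simp at h h0
    exact h0 h
  refine ⟨a, b, h0, rfl, ?_⟩
  have hlt : v (a - exp (φ * I) * b) < v ((exp (φ * I) - exp (ψ * I)) * b) := by
    rw [map_mul]
    exact h.trans_lt (mul_lt_mul_of_pos_right hc (zero_lt_iff.2 hb))
  rw [show a - exp (ψ * I) * b = (a - exp (φ * I) * b) + (exp (φ * I) - exp (ψ * I)) * b by ring,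
    v.map_add_eq_of_lt_right hlt, map_mul]
  exact mul_lt_mul_of_pos_right hc' (zero_lt_iff.2 hb)

/-- In an ultrametric disc every point is a centre. -/
theorem disc_mono_center {φ ψ : ℝ} {c : Γ₀} (hc : v (exp (φ * I) - exp (ψ * I)) ≤ c) :
    disc v φ c ⊆ disc v ψ c := by
  rintro x ⟨a, b, h0, rfl, h⟩
  refine ⟨a, b, h0, rfl, ?_⟩
  rw [show a - exp (ψ * I) * b = (a - exp (φ * I) * b) + (exp (φ * I) - exp (ψ * I)) * b by ring]
  refine v.map_add_le h ?_
  rw [map_mul]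
  exact mul_le_mul_left hc _

theorem codisc_mono_center {φ ψ : ℝ} {c : Γ₀} (hc : v (exp (φ * I) - exp (ψ * I)) ≤ c) :
    codisc v φ c ⊆ codisc v ψ c := by
  rintro x ⟨a, b, h0, rfl, h⟩
  refine ⟨a, b, h0, rfl, ?_⟩
  by_contra! hle
  refine h.not_ge ?_
  rw [show a - exp (φ * I) * b = (a - exp (ψ * I) * b) - (exp (φ * I) - exp (ψ * I)) * b by ring]
  refine v.map_sub_le hle ?_
  rw [map_mul]
  exact mul_le_mul_left hc _

theorem spinor_one_zero_mem_codisc (φ : ℝ) (c : Γ₀) {a : ℂ} (ha : a ≠ 0) :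
    spinor a 0 ∈ codisc v φ c :=
  ⟨a, 0, Or.inl ha, rfl, by simpa [zero_lt_iff] using ha⟩

theorem spinor_zero_one_mem_codisc {φ : ℝ} (hφ : v (exp (φ * I)) = 1) {c : Γ₀} (hc : c < 1) {b : ℂ}
    (hb : b ≠ 0) : spinor 0 b ∈ codisc v φ c := by
  refine ⟨0, b, Or.inr hb, rfl, ?_⟩
  rw [zero_sub, Valuation.map_neg, map_mul, hφ]
  exact mul_lt_mul_of_pos_right hc (zero_lt_iff.2 ((Valuation.ne_zero_iff v).2 hb))

end Spinor

end

end RotationGroups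

namespace RotationGroups

noncomputable section

/-! ### Dihedral groups from a rotation and a reflection. -/

section Dihedral

variable {G : Type*} [Group G] {g t : G}

theorem mul_zpow_of_dihedral (hgt : t * g = g⁻¹ * t) (k : ℤ) : t * g ^ k = (g ^ k)⁻¹ * t := by
  have : t * g ^ k * t⁻¹ = (g ^ k)⁻¹ := by
    rw [← conj_zpow, hgt, mul_inv_cancel_right, inv_zpow]
  rw [← this, inv_mul_cancel_right]

/-- The elements of the group generated by a rotation `g` and a reflection `t`. -/
theorem exists_zpow_of_mem_closure_pair (ht : t * t = 1) (hgt : t * g = g⁻¹ * t) {x : G}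
    (hx : x ∈ Subgroup.closure {g, t}) : ∃ k : ℤ, x = g ^ k ∨ x = g ^ k * t := by
  have htmul : ∀ y, (∃ k : ℤ, y = g ^ k ∨ y = g ^ k * t) →
      ∃ k : ℤ, t * y = g ^ k ∨ t * y = g ^ k * t := by
    rintro _ ⟨k, rfl | rfl⟩
    · exact ⟨-k, Or.inr (by rw [mul_zpow_of_dihedral hgt, zpow_neg])⟩
    · exact ⟨-k, Or.inl (by
        rw [← mul_assoc, mul_zpow_of_dihedral hgt, mul_assoc, ht, mul_one, zpow_neg])⟩
  have hgmul : ∀ (l : ℤ) (y : G), (∃ k : ℤ, y = g ^ k ∨ y = g ^ k * t) →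
      ∃ k : ℤ, g ^ l * y = g ^ k ∨ g ^ l * y = g ^ k * t := by
    rintro l _ ⟨k, rfl | rfl⟩
    · exact ⟨l + k, Or.inl (zpow_add _ _ _).symm⟩
    · exact ⟨l + k, Or.inr (by rw [zpow_add, mul_assoc])⟩
  induction hx using Subgroup.closure_induction_left with
  | one => exact ⟨0, Or.inl (zpow_zero g).symm⟩
  | mul_left x hx y _ ih =>
    rcases hx with rfl | rfl
    · simpa using hgmul 1 y ih
    · exact htmul y ih
  | inv_mul_cancel x hx y _ ih =>
    rcases hx with rfl | rfl
    · simpa using hgmul (-1) y ih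
    · rw [inv_eq_of_mul_eq_one_right ht]
      exact htmul y ih

theorem zpow_eq_zpow_of_intCast_eq {n : ℕ} (hg : g ^ n = 1) {a b : ℤ}
    (h : (a : ZMod n) = (b : ZMod n)) : g ^ a = g ^ b := by
  obtain ⟨c, hc⟩ := (ZMod.intCast_eq_intCast_iff_dvd_sub a b n).1 h
  rw [show b = a + n * c by omega, zpow_add, zpow_mul, zpow_natCast, hg, one_zpow, mul_one]

/-- The homomorphism from the dihedral group given by a rotation `g` and a reflection `t`. -/
def dihedralLift (n : ℕ) (hg : g ^ n = 1) (ht : t * t = 1) (hgt : t * g = g⁻¹ * t) :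
    DihedralGroup n →* G :=
  MonoidHom.mk'
    -- `sr i` is `sr 0 * r i`, so it goes to `t * g ^ i`. The choice of an integer representative of
    -- `i` is harmless because `g ^ n = 1`.
    (fun x => match x with
      | .r i => g ^ (i.cast : ℤ)
      | .sr i => t * g ^ (i.cast : ℤ))
    (by
      have hsub : ∀ i j : ZMod n,
          g ^ ((j - i).cast : ℤ) = (g ^ (i.cast : ℤ))⁻¹ * g ^ (j.cast : ℤ) := by
        intro i j
        rw [← zpow_neg, ← zpow_add]
        apply zpow_eq_zpow_of_intCast_eq hg
        push_cast
        ring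
      have hadd : ∀ i j : ZMod n, g ^ ((i + j).cast : ℤ) = g ^ (i.cast : ℤ) * g ^ (j.cast : ℤ) := by
        intro i j
        rw [← zpow_add]
        apply zpow_eq_zpow_of_intCast_eq hg
        push_cast
        rfl
      rintro (i | i) (j | j)
      · exact hadd i j
      · change t * g ^ ((j - i).cast : ℤ) = g ^ (i.cast : ℤ) * (t * g ^ (j.cast : ℤ))
        rw [hsub, ← mul_assoc, ← mul_assoc, ← zpow_neg, mul_zpow_of_dihedral hgt, zpow_neg, inv_inv]
      · change t * g ^ ((i + j).cast : ℤ) = t * g ^ (i.cast : ℤ) * g ^ (j.cast : ℤ)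
        rw [hadd, mul_assoc]
      · change g ^ ((j - i).cast : ℤ) = t * g ^ (i.cast : ℤ) * (t * g ^ (j.cast : ℤ))
        rw [hsub, mul_zpow_of_dihedral hgt, mul_assoc, ← mul_assoc t t, ht, one_mul])

theorem dihedralLift_r_one (n : ℕ) (hg : g ^ n = 1) (ht : t * t = 1) (hgt : t * g = g⁻¹ * t) :
    dihedralLift n hg ht hgt (.r 1) = g := by
  change g ^ ((1 : ZMod n).cast : ℤ) = g
  conv_rhs => rw [← zpow_one g]
  apply zpow_eq_zpow_of_intCast_eq hg
  rw [ZMod.intCast_zmod_cast, Int.cast_one]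

theorem dihedralLift_sr_zero (n : ℕ) (hg : g ^ n = 1) (ht : t * t = 1) (hgt : t * g = g⁻¹ * t) :
    dihedralLift n hg ht hgt (.sr 0) = t := by
  change t * g ^ ((0 : ZMod n).cast : ℤ) = t
  rw [show g ^ ((0 : ZMod n).cast : ℤ) = g ^ (0 : ℤ) from zpow_eq_zpow_of_intCast_eq hg (by
    rw [ZMod.intCast_zmod_cast, Int.cast_zero]), zpow_zero, mul_one]

/-- A rotation of order `n` and a reflection generate a dihedral group. -/
theorem nonempty_closure_pair_mulEquiv_dihedralGroup (n : ℕ) (hg : orderOf g = n) (ht : t * t = 1)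
    (hgt : t * g = g⁻¹ * t) (htg : t ∉ Subgroup.zpowers g) :
    Nonempty (Subgroup.closure {g, t} ≃* DihedralGroup n) := by
  have hgn : g ^ n = 1 := hg ▸ pow_orderOf_eq_one g
  let f := dihedralLift n hgn ht hgt
  have hr : f (.r 1) = g := dihedralLift_r_one n hgn ht hgt
  have hs : f (.sr 0) = t := dihedralLift_sr_zero n hgn ht hgt
  have hinj : Function.Injective f := by
    rw [injective_iff_map_eq_one]
    rintro (i | i) hi
    · change g ^ (i.cast : ℤ) = 1 at hi
      rw [← orderOf_dvd_iff_zpow_eq_one, hg, ← CharP.intCast_eq_zero_iff (ZMod n)] at hi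
      rw [ZMod.intCast_zmod_cast] at hi
      rw [hi]; rfl
    · change t * g ^ (i.cast : ℤ) = 1 at hi
      exact absurd (eq_inv_of_mul_eq_one_left hi ▸ inv_mem (Subgroup.zpow_mem_zpowers g _)) htg
  have hrange : f.range = Subgroup.closure {g, t} := by
    apply le_antisymm
    · have hgm : g ∈ Subgroup.closure {g, t} := Subgroup.subset_closure (by simp)
      have htm : t ∈ Subgroup.closure {g, t} := Subgroup.subset_closure (by simp)
      rintro _ ⟨i | i, rfl⟩
      · exact zpow_mem hgm (i.cast : ℤ)
      · exact mul_mem htm (zpow_mem hgm (i.cast : ℤ))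
    · rw [Subgroup.closure_le]
      rintro x (rfl | rfl)
      · exact ⟨_, hr⟩
      · exact ⟨_, hs⟩
  exact ⟨((MonoidHom.ofInjective hinj).trans (MulEquiv.subgroupCongr hrange)).symm⟩

end Dihedral

/-! ### Ping-pong estimates for the leaves and for the central dihedral group. -/

section Local

open Complex

theorem exp_pow_eq_one_of_int (N : ℕ) (hN : N ≠ 0) (k : ℤ) :
    exp ((k * (2 * Real.pi / N) : ℝ) * I) ^ N = 1 := by
  rw [← Complex.exp_nat_mul, Complex.exp_eq_one_iff]
  refine ⟨k, ?_⟩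
  have : (N : ℂ) ≠ 0 := by exact_mod_cast hN
  push_cast
  field_simp

theorem exists_of_exp_pow_eq_one {θ : ℝ} {d : ℕ} (h : exp (θ * I) ^ d = 1) :
    ∃ m : ℤ, d * θ = m * (2 * Real.pi) := by
  rw [← Complex.exp_nat_mul, Complex.exp_eq_one_iff] at h
  obtain ⟨m, hm⟩ := h
  refine ⟨m, ?_⟩
  have : (d * θ - m * (2 * Real.pi) : ℂ) * I = 0 := by linear_combination hm
  have := (mul_eq_zero.1 this).resolve_right I_ne_zero
  exact_mod_cast sub_eq_zero.1 this

variable {Γ₀ : Type*} [LinearOrderedCommGroupWithZero Γ₀] {v : Valuation ℂ Γ₀}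

theorem val_exp_int (N : ℕ) (hN : N ≠ 0) (k : ℤ) :
    v (exp ((k * (2 * Real.pi / N) : ℝ) * I)) = 1 :=
  val_eq_one_of_pow_eq_one v hN (exp_pow_eq_one_of_int N hN k)

theorem exp_pi_mul_I' : exp ((Real.pi : ℝ) * I) = -1 := Complex.exp_pi_mul_I

theorem val_exp_pi : v (exp ((Real.pi : ℝ) * I)) = 1 := by
  rw [exp_pi_mul_I', Valuation.map_neg, map_one]

theorem val_exp_sub_exp (θ : ℝ) {φ : ℝ} (hφ : v (exp (φ * I)) = 1) :
    v (exp ((θ + φ : ℝ) * I) - exp (φ * I)) = v (exp (θ * I) - 1) := by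
  rw [show exp ((θ + φ : ℝ) * I) - exp (φ * I) = (exp (θ * I) - 1) * exp (φ * I) by
    push_cast; rw [add_mul, Complex.exp_add]; ring, map_mul, hφ, mul_one]

theorem val_exp_neg {φ : ℝ} (hφ : v (exp (φ * I)) = 1) : v (exp ((-φ : ℝ) * I)) = 1 := by
  rw [ofReal_neg, neg_mul, Complex.exp_neg, map_inv₀, hφ, inv_one]

theorem val_exp_add {φ ψ : ℝ} (hφ : v (exp (φ * I)) = 1) (hψ : v (exp (ψ * I)) = 1) :
    v (exp ((φ + ψ : ℝ) * I)) = 1 := by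
  rw [ofReal_add, add_mul, Complex.exp_add, map_mul, hφ, hψ, one_mul]

theorem rotLine_pi_disc {φ : ℝ} (hφ : v (exp (φ * I)) = 1) {c : Γ₀} (hc : c < 1) {x : Fin 3 → ℂ}
    (hx : x ∈ disc v φ c) : complexAct (rotLine φ Real.pi) x ∈ disc v φ c := by
  rw [rotLine_pi, complexAct_mul, two_mul]
  have := rotZ_disc (val_exp_add hφ hφ) (rotX_pi_disc hφ hc hx)
  rwa [add_neg_cancel_right] at this

theorem rotLine_pi_mul_self (φ : ℝ) : rotLine φ Real.pi * rotLine φ Real.pi = 1 := by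
  rw [← rotLine_add, ← two_mul, rotLine_two_pi]

theorem rotZ_pi_mul_self : rotZ Real.pi * rotZ Real.pi = 1 := by
  rw [← rotZ_add, ← two_mul, rotZ_two_pi]

/-- An involution that preserves the disc also preserves its complement among the nonzero isotropic
vectors. -/
theorem rotLine_pi_codisc {φ : ℝ} (hφ : v (exp (φ * I)) = 1) {c : Γ₀} (hc : c < 1) {x : Fin 3 → ℂ}
    (hx : x ∈ codisc v φ c) : complexAct (rotLine φ Real.pi) x ∈ codisc v φ c := by
  by_contra hcon
  obtain ⟨a, b, h0, rfl, h⟩ := id hx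
  have hd : complexAct (rotLine φ Real.pi) (spinor a b) ∈ disc v φ c := by
    rw [rotLine_pi, complexAct_mul, complexAct_rotX_pi_spinor, complexAct_rotZ_spinor] at hcon ⊢
    refine ⟨_, _, ?_, rfl, ?_⟩
    · simpa [Complex.exp_ne_zero, or_comm] using h0
    · by_contra! hlt
      exact hcon ⟨_, _, by simpa [Complex.exp_ne_zero, or_comm] using h0, rfl, hlt⟩
  have := rotLine_pi_disc hφ hc hd
  rw [← complexAct_mul, rotLine_pi_mul_self, complexAct_one] at this
  exact Set.disjoint_left.1 (disjoint_disc_codisc v φ c) this hx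

theorem rotZ_disc_self {θ φ : ℝ} (hθ : v (exp (θ * I)) = 1) (hφ : v (exp (φ * I)) = 1) {c : Γ₀}
    (hc : v (exp (θ * I) - 1) ≤ c) {x : Fin 3 → ℂ} (hx : x ∈ disc v φ c) :
    complexAct (rotZ θ) x ∈ disc v φ c :=
  disc_mono_center (by rwa [val_exp_sub_exp θ hφ]) (rotZ_disc hθ hx)

theorem rotZ_codisc_self {θ φ : ℝ} (hθ : v (exp (θ * I)) = 1) (hφ : v (exp (φ * I)) = 1) {c : Γ₀}
    (hc : v (exp (θ * I) - 1) ≤ c) {x : Fin 3 → ℂ} (hx : x ∈ codisc v φ c) :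
    complexAct (rotZ θ) x ∈ codisc v φ c :=
  codisc_mono_center (by rwa [val_exp_sub_exp θ hφ]) (rotZ_codisc hθ hx)

theorem val_exp_pi_sub_one : v (exp ((Real.pi : ℝ) * I) - 1) = v 2 := by
  rw [exp_pi_mul_I', ← Valuation.map_neg]; norm_num

/-- A dihedral group of order `2p`, `p ≡ 2 mod 4`, of rotations about a horizontal line: every
element outside the Klein four-group maps the outside of the disc into the disc. -/
theorem dihedral_codisc (h2 : v 2 < 1) {p : ℕ} {M : ℕ} (hM : Odd M) (hp : p = 2 * M) {φ : ℝ}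
    (hφ : v (exp (φ * I)) = 1) {k : ℤ} (hk : ¬ (M : ℤ) ∣ k) {x : Fin 3 → ℂ}
    (hx : x ∈ codisc v φ (v 2)) :
    complexAct (rotLine φ (2 * Real.pi / p) ^ k) x ∈ disc v φ (v 2) := by
  have hp0 : p ≠ 0 := by have := hM.pos; omega
  rw [rotLine_zpow]
  refine rotLine_codisc hφ (val_exp_int p hp0 k) ?_ hx
  have hw := exp_pow_eq_one_of_int p hp0 k
  rw [hp] at hw
  -- Since `M` does not divide `k`, the eigenvalue `w` has `w ^ 2 ≠ 1`, and `w ^ 2` has odd order;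
  -- so `w - 1` is a unit and the contraction radius is `v 2`.
  rw [val_sub_one_eq_one h2 hM (by rw [hp]; exact hw), mul_one]
  intro h1
  obtain ⟨m, hm⟩ := exists_of_exp_pow_eq_one h1
  refine hk ⟨m, ?_⟩
  have hM0 : (M : ℝ) ≠ 0 := by exact_mod_cast hM.pos.ne'
  rw [hp] at hm
  push_cast at hm
  field_simp at hm
  exact_mod_cast hm

theorem mem_or_dihedral_codisc (h2 : v 2 < 1) {p : ℕ} {M : ℕ} (hM : Odd M) (hp : p = 2 * M) {φ : ℝ}
    (hφ : v (exp (φ * I)) = 1) {g : SO3}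
    (hg : g ∈ Subgroup.closure {rotLine φ (2 * Real.pi / p), rotZ Real.pi}) :
    g ∈ Subgroup.closure {rotLine φ Real.pi, rotZ Real.pi} ∨
      ∀ x ∈ codisc v φ (v 2), complexAct g x ∈ disc v φ (v 2) := by
  obtain ⟨k, hk⟩ := exists_zpow_of_mem_closure_pair rotZ_pi_mul_self
    (by rw [rotZ_pi_mul_rotLine, rotLine_neg]) hg
  by_cases hMk : (M : ℤ) ∣ k
  · left
    have hpow : rotLine φ (2 * Real.pi / p) ^ k ∈
        Subgroup.closure {rotLine φ Real.pi, rotZ Real.pi} := by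
      obtain ⟨j, rfl⟩ := hMk
      have hM0 : (M : ℝ) ≠ 0 := by exact_mod_cast hM.pos.ne'
      rw [zpow_mul, zpow_natCast, rotLine_pow, hp]
      push_cast
      rw [show (M : ℝ) * (2 * Real.pi / (2 * M)) = Real.pi by field_simp]
      exact zpow_mem (Subgroup.subset_closure (by simp)) _
    rcases hk with rfl | rfl
    · exact hpow
    · exact mul_mem hpow (Subgroup.subset_closure (by simp))
  · right
    intro x hx
    rcases hk with rfl | rfl
    · exact dihedral_codisc h2 hM hp hφ hMk hx
    · rw [complexAct_mul]
      exact dihedral_codisc h2 hM hp hφ hMk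
        (rotZ_codisc_self val_exp_pi hφ val_exp_pi_sub_one.le hx)

theorem exp_half_pi_mul_I' : exp ((Real.pi / 2 : ℝ) * I) = I := by
  push_cast; exact Complex.exp_pi_div_two_mul_I

theorem rotZ_half_pi_pow_four : rotZ (Real.pi / 2) ^ 4 = 1 := by
  rw [rotZ_pow, ← rotZ_two_pi]; congr 1; push_cast; ring

theorem rotZ_half_pi_sq : rotZ (Real.pi / 2) ^ 2 = rotZ Real.pi := by
  rw [rotZ_pow]; congr 1; push_cast; ring

theorem rotLine_half_pi_sq (φ : ℝ) :
    rotLine φ (Real.pi / 2) * rotLine φ (Real.pi / 2) = rotLine φ Real.pi := by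
  rw [← rotLine_add, add_halves]

/-- The braid relation between quarter turns about perpendicular axes. -/
theorem rotLine_braid (φ : ℝ) :
    rotLine φ (Real.pi / 2) * rotZ (Real.pi / 2) * rotLine φ (Real.pi / 2) =
      rotZ (Real.pi / 2) * rotLine φ (Real.pi / 2) * rotZ (Real.pi / 2) := by
  have h := rotZ_conj_rotX (Real.pi / 2)
  rw [rotZ_neg, rotX_neg, mul_inv_eq_iff_eq_mul] at h
  have h0 : rotX (Real.pi / 2) * rotZ (Real.pi / 2) * rotX (Real.pi / 2) =
      rotZ (Real.pi / 2) * rotX (Real.pi / 2) * rotZ (Real.pi / 2) := by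
    have h' := congrArg (rotX (Real.pi / 2) * ·) h
    simp only [← mul_assoc, mul_inv_cancel, one_mul] at h'
    exact h'
  have hc : rotZ φ * rotZ (Real.pi / 2) * (rotZ φ)⁻¹ = rotZ (Real.pi / 2) := by
    rw [← rotZ_neg, ← rotZ_add, ← rotZ_add]; ring_nf
  have h1 := congrArg (fun y => rotZ φ * y * (rotZ φ)⁻¹) h0
  simp only [← conj_mul, hc] at h1
  exact h1

/-- The octahedral group consists of a dihedral group of order 8 and one more double coset. -/
theorem mem_octahedral (φ : ℝ) {g : SO3}
    (hg : g ∈ Subgroup.closure {rotLine φ (Real.pi / 2), rotZ (Real.pi / 2)}) :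
    g ∈ Subgroup.closure {rotZ (Real.pi / 2), rotLine φ Real.pi} ∨
      ∃ d ∈ Subgroup.closure {rotZ (Real.pi / 2), rotLine φ Real.pi},
      ∃ d' ∈ Subgroup.closure {rotZ (Real.pi / 2), rotLine φ Real.pi},
        g = d * rotLine φ (Real.pi / 2) * d' := by
  set s := rotLine φ (Real.pi / 2) with hs
  set z := rotZ (Real.pi / 2) with hz
  set h := rotLine φ Real.pi with hh
  set E := Subgroup.closure {z, h} with hE
  have hzE : z ∈ E := Subgroup.subset_closure (by simp)
  have hhE : h ∈ E := Subgroup.subset_closure (by simp)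
  have hss : s * s = h := rotLine_half_pi_sq φ
  have hz4 : z ^ 4 = 1 := rotZ_half_pi_pow_four
  have hbraid : s * z * s = z * s * z := rotLine_braid φ
  have hzzs : z ^ 2 * s = s⁻¹ * z ^ 2 := by
    rw [hz, rotZ_half_pi_sq, hs, rotZ_pi_mul_rotLine, rotLine_neg]
  have hszzs : s * z ^ 2 * s = z ^ 2 := by rw [mul_assoc, hzzs, mul_inv_cancel_left]
  have hEmul : ∀ d ∈ E, ∀ g, (g ∈ E ∨ ∃ d ∈ E, ∃ d' ∈ E, g = d * s * d') →
      (d * g ∈ E ∨ ∃ d' ∈ E, ∃ d'' ∈ E, d * g = d' * s * d'') := by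
    rintro d hd g (hg | ⟨d', hd', d'', hd'', rfl⟩)
    · exact Or.inl (mul_mem hd hg)
    · exact Or.inr ⟨d * d', mul_mem hd hd', d'', hd'', by simp only [mul_assoc]⟩
  -- `E ∪ E s E` absorbs each `s z ^ k s`: `s s = h`, the braid relation gives `s z s = z s z`, a
  -- half-turn about the `z`-axis inverts `s` so that `s z² s = z²`, and `k = 3` reduces to `k = 1`.
  have hszs : ∀ k : ℤ, s * z ^ k * s ∈ E ∨ ∃ d ∈ E, ∃ d' ∈ E, s * z ^ k * s = d * s * d' := by
    intro k
    have hmod : z ^ k = z ^ (k % 4) := by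
      conv_lhs => rw [← Int.emod_add_mul_ediv k 4]
      rw [zpow_add, zpow_mul, show z ^ (4 : ℤ) = 1 from mod_cast hz4, one_zpow, mul_one]
    have hcases : k % 4 = 0 ∨ k % 4 = 1 ∨ k % 4 = 2 ∨ k % 4 = 3 := by omega
    rw [hmod]
    rcases hcases with hk | hk | hk | hk <;> rw [hk]
    · left; rw [zpow_zero, mul_one, hss]; exact hhE
    · right; exact ⟨z, hzE, z, hzE, by rw [zpow_one, hbraid]⟩
    · left; rw [show z ^ (2 : ℤ) = z ^ 2 from mod_cast rfl, hszzs]; exact pow_mem hzE 2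
    · right
      refine ⟨z, hzE, z * h⁻¹ * z ^ 2, mul_mem (mul_mem hzE (inv_mem hhE)) (pow_mem hzE 2), ?_⟩
      rw [show z ^ (3 : ℤ) = z * z ^ 2 by rw [← pow_succ']; exact mod_cast rfl]
      calc s * (z * z ^ 2) * s = s * z * (z ^ 2 * s) := by simp only [mul_assoc]
        _ = s * z * s * (s * s)⁻¹ * z ^ 2 := by rw [hzzs]; group
        _ = z * s * (z * h⁻¹ * z ^ 2) := by rw [hbraid, hss]; simp only [mul_assoc]
  have hsmul : ∀ g, (g ∈ E ∨ ∃ d ∈ E, ∃ d' ∈ E, g = d * s * d') →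
      (s * g ∈ E ∨ ∃ d' ∈ E, ∃ d'' ∈ E, s * g = d' * s * d'') := by
    rintro g (hg | ⟨d, hd, d', hd', rfl⟩)
    · exact Or.inr ⟨1, one_mem _, g, hg, by rw [one_mul]⟩
    -- `h` is a power of `s`, so it slides past `s`, and only the products `s z ^ k s` matter.
    · have hcomm : h * s = s * h := by rw [← hss, mul_assoc]
      have hE' : ∀ y ∈ E, ∀ g, (g ∈ E ∨ ∃ d ∈ E, ∃ d' ∈ E, g = d * s * d') →
          (g * y ∈ E ∨ ∃ d' ∈ E, ∃ d'' ∈ E, g * y = d' * s * d'') := by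
        rintro y hy g (hg | ⟨e, he, e', he', rfl⟩)
        · exact Or.inl (mul_mem hg hy)
        · exact Or.inr ⟨e, he, e' * y, mul_mem he' hy, by simp only [mul_assoc]⟩
      obtain ⟨k, rfl | rfl⟩ := exists_zpow_of_mem_closure_pair (rotLine_pi_mul_self φ)
        (by rw [rotLine_pi_mul_rotZ, rotZ_neg]) hd
      · have := hE' d' hd' _ (hszs k)
        simpa only [mul_assoc] using this
      · have := hE' (h * d') (mul_mem hhE hd') _ (hszs k)
        rw [show s * (z ^ k * h * s * d') = s * z ^ k * s * (h * d') by
          rw [mul_assoc (z ^ k), hcomm]; simp only [mul_assoc]]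
        exact this
  induction hg using Subgroup.closure_induction_left with
  | one => exact Or.inl (one_mem _)
  | mul_left x hx y _ ih =>
    rcases hx with rfl | rfl
    · exact hsmul y ih
    · exact hEmul _ hzE y ih
  | inv_mul_cancel x hx y _ ih =>
    rcases hx with rfl | rfl
    · have := hEmul _ (inv_mem hhE) _ (hsmul y ih)
      rwa [← mul_assoc, show h⁻¹ * s = s⁻¹ by rw [← hss]; group] at this
    · exact hEmul _ (inv_mem hzE) y ih

theorem val_I_sub_one : v (I - 1) = v (1 - I) := v.map_sub_swap _ _

/-- Every element of the octahedral group outside the dihedral group of order 8 maps the outside of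
the disc into the disc. -/
theorem mem_or_octahedral_codisc (h2 : v 2 < 1) {φ : ℝ} (hφ : v (exp (φ * I)) = 1) {g : SO3}
    (hg : g ∈ Subgroup.closure {rotLine φ (Real.pi / 2), rotZ (Real.pi / 2)}) :
    g ∈ Subgroup.closure {rotZ (Real.pi / 2), rotLine φ Real.pi} ∨
      ∀ x ∈ codisc v φ (v (1 - I)), complexAct g x ∈ disc v φ (v (1 - I)) := by
  have hI : v I = 1 := val_eq_one_of_pow_eq_one v (N := 4) (by norm_num) I_pow_four
  have hθ : v (exp ((Real.pi / 2 : ℝ) * I)) = 1 := by rw [exp_half_pi_mul_I', hI]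
  have hc : v (exp ((Real.pi / 2 : ℝ) * I) - 1) ≤ v (1 - I) := by
    rw [exp_half_pi_mul_I', val_I_sub_one]
  have hθ' := val_exp_neg hθ
  have hc' : v (exp ((-(Real.pi / 2) : ℝ) * I) - 1) ≤ v (1 - I) := by
    rw [ofReal_neg, neg_mul, Complex.exp_neg, exp_half_pi_mul_I',
      show I⁻¹ - 1 = I⁻¹ * (1 - I) by rw [mul_sub, inv_mul_cancel₀ I_ne_zero, mul_one],
      map_mul, map_inv₀, hI, inv_one, one_mul]
  have h1 := val_one_sub_I_lt_one h2
  have hinv : (rotLine φ Real.pi)⁻¹ = rotLine φ Real.pi :=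
    inv_eq_of_mul_eq_one_right (rotLine_pi_mul_self φ)
  -- A quarter turn about the `z`-axis moves the centre by `v (I - 1)`, exactly the radius, so the
  -- dihedral group of order 8 preserves the disc and its outside. Only the middle factor `rotLine φ
  -- (π / 2)` contracts.
  have hE : ∀ d ∈ Subgroup.closure {rotZ (Real.pi / 2), rotLine φ Real.pi},
      (∀ x ∈ disc v φ (v (1 - I)), complexAct d x ∈ disc v φ (v (1 - I))) ∧
      (∀ x ∈ codisc v φ (v (1 - I)), complexAct d x ∈ codisc v φ (v (1 - I))) := by
    intro d hd
    induction hd using Subgroup.closure_induction_left with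
    | one => simp [complexAct_one]
    | mul_left y hy d _ ih =>
      simp only [complexAct_mul]
      rcases hy with rfl | rfl
      · exact ⟨fun x hx => rotZ_disc_self hθ hφ hc (ih.1 x hx),
          fun x hx => rotZ_codisc_self hθ hφ hc (ih.2 x hx)⟩
      · exact ⟨fun x hx => rotLine_pi_disc hφ h1 (ih.1 x hx),
          fun x hx => rotLine_pi_codisc hφ h1 (ih.2 x hx)⟩
    | inv_mul_cancel y hy d _ ih =>
      simp only [complexAct_mul]
      rcases hy with rfl | rfl
      · rw [← rotZ_neg]
        exact ⟨fun x hx => rotZ_disc_self hθ' hφ hc' (ih.1 x hx),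
          fun x hx => rotZ_codisc_self hθ' hφ hc' (ih.2 x hx)⟩
      · rw [hinv]
        exact ⟨fun x hx => rotLine_pi_disc hφ h1 (ih.1 x hx),
          fun x hx => rotLine_pi_codisc hφ h1 (ih.2 x hx)⟩
  refine (mem_octahedral φ hg).imp_right ?_
  rintro ⟨d, hd, d', hd', rfl⟩ x hx
  rw [complexAct_mul, complexAct_mul]
  refine (hE d hd).1 _ (rotLine_codisc hφ hθ ?_ ((hE d' hd').2 x hx))
  -- The radius `v (1 - I)` is right for a quarter turn because its square is `v 2`.
  rw [exp_half_pi_mul_I', val_I_sub_one, ← sq, val_one_sub_I_sq]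

/-- The elements of the dihedral group that contains the rotations by multiples of `2π/N` about the
`z`-axis and the half-turns about the `x`-axis and the line at angle `φ`. -/
theorem exists_of_mem_center {N : ℕ} {φ : ℝ} {l : ℤ} (hl : 2 * φ = l * (2 * Real.pi / N)) {k : SO3}
    (hk : k ∈ Subgroup.closure {rotZ (2 * Real.pi / N), rotX Real.pi}) :
    ∃ j : ℤ, k = rotZ (j * (2 * Real.pi / N)) ∨
      k = rotZ (j * (2 * Real.pi / N)) * rotLine φ Real.pi := by
  obtain ⟨j, hj⟩ := exists_zpow_of_mem_closure_pair
    (by rw [← rotX_add, ← two_mul, rotX_two_pi]) (by rw [rotX_pi_mul_rotZ, rotZ_neg]) hk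
  rw [rotZ_zpow] at hj
  rcases hj with rfl | rfl
  · exact ⟨j, Or.inl rfl⟩
  · refine ⟨j - l, Or.inr ?_⟩
    rw [rotLine_pi, ← mul_assoc, ← rotZ_add, hl]
    congr 2
    push_cast
    ring

/-- An element of the central dihedral group outside the edge group maps the disc outside itself. -/
theorem mem_or_center_disc {N d : ℕ} (hN : N ≠ 0) (hd : d ≠ 0) {φ : ℝ} {l : ℤ}
    (hl : 2 * φ = l * (2 * Real.pi / N)) (hφ : v (exp (φ * I)) = 1) {c : Γ₀} (hc1 : c < 1)
    (hc : ∀ w : ℂ, w ^ N = 1 → w ^ d ≠ 1 → c < v (w - 1)) {V : Subgroup SO3}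
    (hVz : rotZ (2 * Real.pi / d) ∈ V) (hVl : rotLine φ Real.pi ∈ V) {k : SO3}
    (hk : k ∈ Subgroup.closure {rotZ (2 * Real.pi / N), rotX Real.pi}) :
    k ∈ V ∨ ∀ x ∈ disc v φ c, complexAct k x ∈ codisc v φ c := by
  obtain ⟨j, hj⟩ := exists_of_mem_center hl hk
  have hw := exp_pow_eq_one_of_int N hN j
  have hθ := val_exp_int (v := v) N hN j
  -- If `w ^ d = 1`, the angle is a multiple of `2π/d` and the element lies in `V`; otherwise the
  -- centre moves by more than the radius.
  by_cases h1 : exp ((j * (2 * Real.pi / N) : ℝ) * I) ^ d = 1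
  · left
    obtain ⟨m, hm⟩ := exists_of_exp_pow_eq_one h1
    have hd0 : (d : ℝ) ≠ 0 := by exact_mod_cast hd
    have hz : rotZ (j * (2 * Real.pi / N)) ∈ V := by
      have : (j * (2 * Real.pi / N) : ℝ) = m * (2 * Real.pi / d) := by
        rw [← mul_div_assoc (m : ℝ), ← hm]; field_simp
      rw [this, ← rotZ_zpow]
      exact zpow_mem hVz m
    rcases hj with rfl | rfl
    · exact hz
    · exact mul_mem hz hVl
  · right
    have hlt := hc _ hw h1
    rw [← val_exp_sub_exp _ hφ] at hlt
    have hz : ∀ x ∈ disc v φ c, complexAct (rotZ (j * (2 * Real.pi / N))) x ∈ codisc v φ c :=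
      fun x hx => disc_subset_codisc hlt hlt (rotZ_disc hθ hx)
    intro x hx
    rcases hj with rfl | rfl
    · exact hz x hx
    · rw [complexAct_mul]
      exact hz _ (rotLine_pi_disc hφ hc1 hx)

/-- The centre `exp (φ I)` goes to a point whose quotient by `exp (ψ I)` has `N`-th power `-1`; by
`hc` and `hc'` this quotient is farther from `1` than either radius, so the discs of different
leaves never meet. -/
theorem center_disc_codisc {N : ℕ} (hN : N ≠ 0) {φ ψ : ℝ} {l : ℤ}
    (hl : 2 * φ = l * (2 * Real.pi / N)) (hφ : v (exp (φ * I)) = 1) (hψ : v (exp (ψ * I)) = 1)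
    (hφψ : exp ((φ - ψ : ℝ) * I) ^ N = -1) {c c' : Γ₀} (hc1 : c < 1)
    (hc : ∀ w : ℂ, w ^ N = -1 → c < v (w - 1)) (hc' : ∀ w : ℂ, w ^ N = -1 → c' < v (w - 1))
    {k : SO3} (hk : k ∈ Subgroup.closure {rotZ (2 * Real.pi / N), rotX Real.pi})
    {x : Fin 3 → ℂ} (hx : x ∈ disc v φ c) : complexAct k x ∈ codisc v ψ c' := by
  obtain ⟨j, hj⟩ := exists_of_mem_center hl hk
  have hw := exp_pow_eq_one_of_int N hN j
  have hθ := val_exp_int (v := v) N hN j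
  set θ := (j * (2 * Real.pi / N) : ℝ)
  have hw' : exp ((θ + (φ - ψ) : ℝ) * I) ^ N = -1 := by
    rw [ofReal_add, add_mul, Complex.exp_add, mul_pow, hw, hφψ, one_mul]
  have hval := val_exp_sub_exp (θ + (φ - ψ)) hψ
  rw [show θ + (φ - ψ) + ψ = θ + φ by ring] at hval
  have hz : ∀ x ∈ disc v φ c, complexAct (rotZ θ) x ∈ codisc v ψ c' := fun x hx =>
    disc_subset_codisc (by rw [hval]; exact hc _ hw') (by rw [hval]; exact hc' _ hw')
      (rotZ_disc hθ hx)
  rcases hj with rfl | rfl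
  · exact hz x hx
  · rw [complexAct_mul]
    exact hz _ (rotLine_pi_disc hφ hc1 hx)

/-- The base point is `a / b = ∞`, a fixed point of the rotations about the `z`-axis. The central
group sends it to itself or to `0`, and both lie outside any disc of radius less than `1` about a
point of value `1`. -/
theorem center_base_codisc {N : ℕ} {φ : ℝ} (hφ : v (exp (φ * I)) = 1) {c : Γ₀} (hc1 : c < 1)
    {k : SO3} (hk : k ∈ Subgroup.closure {rotZ (2 * Real.pi / N), rotX Real.pi}) :
    complexAct k (spinor 1 0) ∈ codisc v φ c := by
  obtain ⟨j, hj⟩ := exists_of_mem_center (φ := 0) (l := 0) (by simp) hk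
  rcases hj with rfl | rfl
  · rw [complexAct_rotZ_spinor, mul_zero]
    exact spinor_one_zero_mem_codisc φ c (by simp [Complex.exp_ne_zero])
  · rw [rotLine_zero_left, complexAct_mul, complexAct_rotX_pi_spinor, complexAct_rotZ_spinor,
      mul_zero, mul_zero]
    exact spinor_zero_one_mem_codisc hφ hc1 (by simp [Complex.exp_ne_zero])

end Local

end

end RotationGroups

namespace RotationGroups

noncomputable section

/-! ### Orders of rotations and the dihedral groups they generate. -/

section Orders

theorem exists_of_rotX_eq_one {θ : ℝ} (h : rotX θ = 1) : ∃ m : ℤ, θ = m * (2 * Real.pi) := by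
  have h1 : Real.cos θ = 1 := by
    have := congrFun (congrFun (congrArg Subtype.val h) 1) 1
    simpa [rotX] using this
  obtain ⟨m, hm⟩ := (Real.cos_eq_one_iff θ).1 h1
  exact ⟨m, hm.symm⟩

theorem exists_of_rotZ_eq_one {θ : ℝ} (h : rotZ θ = 1) : ∃ m : ℤ, θ = m * (2 * Real.pi) := by
  have h1 : Real.cos θ = 1 := by
    have := congrFun (congrFun (congrArg Subtype.val h) 0) 0
    simpa [rotZ] using this
  obtain ⟨m, hm⟩ := (Real.cos_eq_one_iff θ).1 h1
  exact ⟨m, hm.symm⟩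

theorem natCast_dvd_of_mul_angle {N : ℕ} (hN : N ≠ 0) {k m : ℤ}
    (h : (k * (2 * Real.pi / N) : ℝ) = m * (2 * Real.pi)) : (N : ℤ) ∣ k := by
  have hN' : (N : ℝ) ≠ 0 := by exact_mod_cast hN
  refine ⟨m, ?_⟩
  field_simp at h
  exact_mod_cast h

theorem orderOf_rotZ {N : ℕ} (hN : N ≠ 0) : orderOf (rotZ (2 * Real.pi / N)) = N := by
  have hN' : (N : ℝ) ≠ 0 := by exact_mod_cast hN
  apply Nat.dvd_antisymm
  · apply orderOf_dvd_of_pow_eq_one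
    rw [rotZ_pow, mul_div_cancel₀ _ hN', rotZ_two_pi]
  · have h := pow_orderOf_eq_one (rotZ (2 * Real.pi / N))
    rw [rotZ_pow] at h
    obtain ⟨m, hm⟩ := exists_of_rotZ_eq_one h
    exact Int.natCast_dvd_natCast.1 (natCast_dvd_of_mul_angle hN (m := m) (by exact_mod_cast hm))

theorem orderOf_rotLine (φ : ℝ) {N : ℕ} (hN : N ≠ 0) :
    orderOf (rotLine φ (2 * Real.pi / N)) = N := by
  have hN' : (N : ℝ) ≠ 0 := by exact_mod_cast hN
  apply Nat.dvd_antisymm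
  · apply orderOf_dvd_of_pow_eq_one
    rw [rotLine_pow, mul_div_cancel₀ _ hN', rotLine_two_pi]
  · have h := pow_orderOf_eq_one (rotLine φ (2 * Real.pi / N))
    rw [rotLine_pow, rotLine, conj_eq_one_iff] at h
    obtain ⟨m, hm⟩ := exists_of_rotX_eq_one h
    exact Int.natCast_dvd_natCast.1 (natCast_dvd_of_mul_angle hN (m := m) (by exact_mod_cast hm))

theorem rotX_ne_rotZ_pi (θ : ℝ) : rotX θ ≠ rotZ Real.pi := by
  intro h
  have := congrFun (congrFun (congrArg Subtype.val h) 0) 0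
  simp [rotX, rotZ] at this
  linarith

theorem rotX_pi_ne_rotZ (θ : ℝ) : rotX Real.pi ≠ rotZ θ := by
  intro h
  have := congrFun (congrFun (congrArg Subtype.val h) 2) 2
  simp [rotX, rotZ] at this
  linarith

theorem nonempty_center_mulEquiv {N : ℕ} (hN : N ≠ 0) :
    Nonempty (Subgroup.closure {rotZ (2 * Real.pi / N), rotX Real.pi} ≃* DihedralGroup N) := by
  refine nonempty_closure_pair_mulEquiv_dihedralGroup N (orderOf_rotZ hN)
    (by rw [← rotX_add, ← two_mul, rotX_two_pi]) (by rw [rotX_pi_mul_rotZ, rotZ_neg]) ?_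
  rintro ⟨k, hk⟩
  simp only [rotZ_zpow] at hk
  exact rotX_pi_ne_rotZ _ hk.symm

theorem nonempty_line_mulEquiv (φ : ℝ) {N : ℕ} (hN : N ≠ 0) :
    Nonempty (Subgroup.closure {rotLine φ (2 * Real.pi / N), rotZ Real.pi} ≃*
      DihedralGroup N) := by
  refine nonempty_closure_pair_mulEquiv_dihedralGroup N (orderOf_rotLine φ hN)
    rotZ_pi_mul_self (by rw [rotZ_pi_mul_rotLine, rotLine_neg]) ?_
  rintro ⟨k, hk⟩
  simp only [rotLine_zpow] at hk
  have h : rotX (k * (2 * Real.pi / N)) = rotZ Real.pi := by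
    rw [rotLine, mul_inv_eq_iff_eq_mul, ← rotZ_add, add_comm, rotZ_add] at hk
    exact mul_left_cancel hk
  exact rotX_ne_rotZ_pi _ h

end Orders

/-! ### Membership of rotations in a subgroup of `SO(3)`. -/

section Generation

variable {S : Subgroup SO3}

theorem rotZ_int_mem {a : ℝ} (h : rotZ a ∈ S) (k : ℤ) : rotZ (k * a) ∈ S := by
  rw [← rotZ_zpow]; exact zpow_mem h k

theorem rotZ_div_mem_of_dvd {N d : ℕ} (hN : N ≠ 0) (hd : d ∣ N) (h : rotZ (2 * Real.pi / N) ∈ S) :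
    rotZ (2 * Real.pi / d) ∈ S := by
  obtain ⟨e, rfl⟩ := hd
  have hd0 : (d : ℝ) ≠ 0 := by
    have : d ≠ 0 := by rintro rfl; simp at hN
    exact_mod_cast this
  have he0 : (e : ℝ) ≠ 0 := by
    have : e ≠ 0 := by rintro rfl; simp at hN
    exact_mod_cast this
  have := rotZ_int_mem h e
  rwa [show ((e : ℤ) : ℝ) * (2 * Real.pi / ((d * e : ℕ) : ℝ)) = 2 * Real.pi / d by
    push_cast; field_simp] at this

theorem rotLine_div_mem_of_dvd {φ : ℝ} {N d : ℕ} (hN : N ≠ 0) (hd : d ∣ N)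
    (h : rotLine φ (2 * Real.pi / N) ∈ S) : rotLine φ (2 * Real.pi / d) ∈ S := by
  obtain ⟨e, rfl⟩ := hd
  have hd0 : (d : ℝ) ≠ 0 := by
    have : d ≠ 0 := by rintro rfl; simp at hN
    exact_mod_cast this
  have he0 : (e : ℝ) ≠ 0 := by
    have : e ≠ 0 := by rintro rfl; simp at hN
    exact_mod_cast this
  have := pow_mem h e
  rwa [rotLine_pow, show (e : ℝ) * (2 * Real.pi / ((d * e : ℕ) : ℝ)) = 2 * Real.pi / d by
    push_cast; field_simp] at this

/-- Bézout: `2π / lcm a b = 2π · gcd a b / (a b)` is an integral combination of the two angles. -/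
theorem rotZ_lcm_mem {a b : ℕ} (ha : a ≠ 0) (hb : b ≠ 0) (h₁ : rotZ (2 * Real.pi / a) ∈ S)
    (h₂ : rotZ (2 * Real.pi / b) ∈ S) : rotZ (2 * Real.pi / Nat.lcm a b) ∈ S := by
  have h := mul_mem (rotZ_int_mem h₂ (Nat.gcdA a b)) (rotZ_int_mem h₁ (Nat.gcdB a b))
  rw [← rotZ_add] at h
  convert h using 2
  have hg : (Nat.gcd a b : ℝ) = a * (Nat.gcdA a b : ℤ) + b * (Nat.gcdB a b : ℤ) := by
    exact_mod_cast Nat.gcd_eq_gcd_ab a b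
  have hl : (Nat.gcd a b : ℝ) * Nat.lcm a b = a * b := by exact_mod_cast Nat.gcd_mul_lcm a b
  have ha' : (a : ℝ) ≠ 0 := by exact_mod_cast ha
  have hb' : (b : ℝ) ≠ 0 := by exact_mod_cast hb
  have hl' : (Nat.lcm a b : ℝ) ≠ 0 := by exact_mod_cast Nat.lcm_ne_zero ha hb
  rw [div_eq_iff hl']
  field_simp
  linear_combination (Nat.lcm a b : ℝ) * hg - hl

theorem rotZ_mem_of_coprime {n N : ℕ} (hN : N ≠ 0) (hn : Nat.Coprime n N)
    (h : rotZ (n * (2 * Real.pi / N)) ∈ S) : rotZ (2 * Real.pi / N) ∈ S := by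
  have h' := rotZ_int_mem h (Nat.gcdA n N)
  have h1 : rotZ (2 * Real.pi) ∈ S := rotZ_two_pi ▸ one_mem S
  have h'' := mul_mem h' (rotZ_int_mem h1 (Nat.gcdB n N))
  rw [← rotZ_add] at h''
  convert h'' using 2
  have hg : (1 : ℝ) = n * (Nat.gcdA n N : ℤ) + N * (Nat.gcdB n N : ℤ) := by
    have := Nat.gcd_eq_gcd_ab n N
    rw [hn] at this
    exact_mod_cast this
  have hN' : (N : ℝ) ≠ 0 := by exact_mod_cast hN
  field_simp
  linear_combination hg

theorem rotZ_two_mul_sub_mem {φ ψ : ℝ} (h₁ : rotLine φ Real.pi ∈ S) (h₂ : rotLine ψ Real.pi ∈ S) :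
    rotZ (2 * (φ - ψ)) ∈ S := by
  have := mul_mem h₁ h₂
  rwa [rotLine_pi, rotLine_pi, mul_assoc, ← mul_assoc (rotX Real.pi), rotX_pi_mul_rotZ, mul_assoc,
    ← rotX_add, ← two_mul Real.pi, rotX_two_pi, mul_one, ← rotZ_add,
    show 2 * φ + -(2 * ψ) = 2 * (φ - ψ) by ring] at this

theorem rotLine_add_mem {a φ θ : ℝ} (ha : rotZ a ∈ S) (h : rotLine φ θ ∈ S) :
    rotLine (a + φ) θ ∈ S := by
  rw [← rotZ_conj_rotLine]
  exact mul_mem (mul_mem ha h) (inv_mem ha)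

theorem rotX_pi_mem_iff_rotLine {φ : ℝ} (h : rotZ (2 * φ) ∈ S) :
    rotX Real.pi ∈ S ↔ rotLine φ Real.pi ∈ S := by
  rw [rotLine_pi]
  exact (Subgroup.mul_mem_cancel_left S h).symm

/-- Both sides are the rotation by `θ` about the horizontal line at angle `φ + π/2`. -/
theorem rotLine_conj (φ θ : ℝ) :
    rotZ (Real.pi / 2) * rotLine φ θ * (rotZ (Real.pi / 2))⁻¹ =
      (rotLine φ (Real.pi / 2))⁻¹ * rotZ θ * rotLine φ (Real.pi / 2) := by
  have h := rotZ_conj_rotX θ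
  rw [rotZ_neg, rotX_neg] at h
  have hX : ∀ a, MulAut.conj (rotZ φ) (rotX a) = rotLine φ a := fun a => rfl
  have hZ : ∀ a, MulAut.conj (rotZ φ) (rotZ a) = rotZ a := fun a => by
    rw [MulAut.conj_apply, ← rotZ_add, add_comm, rotZ_add, mul_inv_cancel_right]
  have h1 := congrArg (MulAut.conj (rotZ φ)) h
  simpa only [map_mul, map_inv, hX, hZ] using h1

/-- In the presence of the two quarter turns, a rotation of any order about the line can be traded
for one about the `z`-axis. This is why generators of order 4 can replace those of order divisible
by 4. -/
theorem rotLine_mem_iff_rotZ_mem {φ θ : ℝ} (hl : rotLine φ (Real.pi / 2) ∈ S)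
    (hz : rotZ (Real.pi / 2) ∈ S) : rotLine φ θ ∈ S ↔ rotZ θ ∈ S := by
  have h := rotLine_conj φ θ
  rw [← S.mul_mem_cancel_left hz, ← S.mul_mem_cancel_right (inv_mem hz), h,
    S.mul_mem_cancel_right hl, S.mul_mem_cancel_left (inv_mem hl)]

/-- A quarter turn about the `x`-axis interchanges the `y`-axis and the `z`-axis, so no quarter turn
about the `z`-axis is needed here. -/
theorem rotLine_half_pi_mem_iff_rotZ_mem {θ : ℝ} (hx : rotX (Real.pi / 2) ∈ S) :
    rotLine (Real.pi / 2) θ ∈ S ↔ rotZ θ ∈ S := by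
  have h := rotLine_conj 0 θ
  rw [rotLine_zero_left, rotLine_zero_left] at h
  rw [rotLine, h, S.mul_mem_cancel_right hx, S.mul_mem_cancel_left (inv_mem hx)]

end Generation

/-! ### Exponents of 2 and least common multiples. -/

section Arithmetic

theorem padicValNat_two_lcm {a b : ℕ} (ha : a ≠ 0) (hb : b ≠ 0) :
    padicValNat 2 (Nat.lcm a b) = max (padicValNat 2 a) (padicValNat 2 b) := by
  simp only [← Nat.factorization_def _ Nat.prime_two, Nat.factorization_lcm ha hb,
    Finsupp.sup_apply]

theorem exists_odd_of_padicValNat_eq_one {a : ℕ} (h : padicValNat 2 a = 1) :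
    ∃ M, Odd M ∧ a = 2 * M := by
  have h0 : a ≠ 0 := by rintro rfl; simp at h
  have h2 : 2 ^ 1 ∣ a := (padicValNat_dvd_iff_le h0).2 h.ge
  have h4 : ¬ 2 ^ 2 ∣ a := fun h' => by
    have := (padicValNat_dvd_iff_le h0).1 h'
    omega
  obtain ⟨M, rfl⟩ := h2
  refine ⟨M, ?_, by ring⟩
  rw [← Nat.not_even_iff_odd]
  rintro ⟨k, rfl⟩
  exact h4 ⟨k, by ring⟩

theorem four_dvd_of_one_lt_padicValNat {a : ℕ} (h : 1 < padicValNat 2 a) : 4 ∣ a := by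
  have h0 : a ≠ 0 := by rintro rfl; simp at h
  exact (padicValNat_dvd_iff_le h0 (n := 2)).2 h

theorem odd_of_coprime_of_two_dvd {n m : ℕ} (hnm : Nat.Coprime n m) (hm : 2 ∣ m) : Odd n :=
  Nat.Coprime.odd_of_right (hnm.coprime_dvd_right hm)

/-- The exponent of 2 in `a` is at most that in `m / 2`, so the lcm has the same 2-part as `m / 2`
and the cofactor is odd. -/
theorem exists_odd_lcm_half {a m : ℕ} (ha : a ≠ 0) (hm : m ≠ 0)
    (h : padicValNat 2 a < padicValNat 2 m) :
    ∃ u, Odd u ∧ 2 * Nat.lcm a (m / 2) = m * u := by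
  have h2 : 2 ∣ m := by
    have := (padicValNat_dvd_iff_le (p := 2) hm (n := 1)).2 (by omega)
    simpa using this
  have hm2 : m / 2 ≠ 0 := by omega
  obtain ⟨u, hu⟩ := Nat.dvd_lcm_right a (m / 2)
  have hl := Nat.lcm_ne_zero ha hm2
  have hu0 : u ≠ 0 := by rintro rfl; exact hl (by simpa using hu)
  refine ⟨u, ?_, ?_⟩
  · have h1 := padicValNat_two_lcm ha hm2
    rw [hu, padicValNat.mul hm2 hu0, padicValNat.div h2] at h1
    rw [← Nat.not_even_iff_odd, even_iff_two_dvd]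
    intro h3
    have := (padicValNat_dvd_iff_le (p := 2) hu0 (n := 1)).1 (by simpa using h3)
    omega
  · rw [hu, ← mul_assoc, Nat.mul_div_cancel' h2]

end Arithmetic

end

end RotationGroups

namespace RotationGroups

noncomputable section

open Complex

/-! ### The angle of the second axis as a multiple of `π/N`. -/

section Angles

/-- Measures the angle of `ℓ` in units of `π/N`. When `n * u` is odd, `exp_odd_mul_pow` gives the
`N`-th power `-1` that separates the two axes. -/
theorem line_angle_eq {n m u N : ℕ} (hm : m ≠ 0) (hN : N ≠ 0) (h : 2 * N = m * u) :
    2 * Real.pi * n / m = (n * u : ℕ) * (Real.pi / N) := by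
  have hm' : (m : ℝ) ≠ 0 := by exact_mod_cast hm
  have hN' : (N : ℝ) ≠ 0 := by exact_mod_cast hN
  have h' : (2 : ℝ) * N = m * u := by exact_mod_cast h
  field_simp
  push_cast
  linear_combination (n : ℝ) * h'

theorem exp_odd_mul_pow {N j : ℕ} (hN : N ≠ 0) (hj : Odd j) :
    exp ((j * (Real.pi / N) : ℝ) * I) ^ N = -1 := by
  have hN' : (N : ℂ) ≠ 0 := by exact_mod_cast hN
  rw [← Complex.exp_nat_mul]
  have : (N : ℂ) * ((j * (Real.pi / N) : ℝ) * I) = j * (Real.pi * I) := by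
    push_cast
    field_simp
  rw [this, Complex.exp_nat_mul, Complex.exp_pi_mul_I, hj.neg_one_pow]

theorem exp_neg_pow {φ : ℝ} {N : ℕ} (h : exp (φ * I) ^ N = -1) :
    exp ((-φ : ℝ) * I) ^ N = -1 := by
  rw [ofReal_neg, neg_mul, Complex.exp_neg, inv_pow, h]
  norm_num

theorem two_mul_line_angle (j N : ℕ) :
    2 * ((j : ℝ) * (Real.pi / N)) = (j : ℤ) * (2 * Real.pi / N) := by
  push_cast; ring

variable {Γ₀ : Type*} [LinearOrderedCommGroupWithZero Γ₀] {v : Valuation ℂ Γ₀}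

theorem val_exp_of_pow_eq_neg_one {φ : ℝ} {N : ℕ} (hN : N ≠ 0) (h : exp (φ * I) ^ N = -1) :
    v (exp (φ * I)) = 1 :=
  val_eq_one_of_pow_eq_one v (N := N * 2) (by omega) (by rw [pow_mul, h]; norm_num)

/-- As `N` is even, `w ^ 2 = 1` would force `w ^ N = 1`. The next lemma argues in the same way with
`w ^ 4`. -/
theorem val_two_lt_of_pow_eq_neg_one (h2 : v 2 < 1) {N : ℕ} (hN : N ≠ 0) (h : 2 ∣ N) {w : ℂ}
    (hw : w ^ N = -1) : v 2 < v (w - 1) := by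
  refine val_two_lt_val_sub_one h2 (N := N * 2) (by omega) (by rw [pow_mul, hw]; norm_num) ?_
  obtain ⟨k, rfl⟩ := h
  intro h'
  rw [pow_mul, h', one_pow] at hw
  norm_num at hw

theorem val_one_sub_I_lt_of_pow_eq_neg_one (h2 : v 2 < 1) {N : ℕ} (hN : N ≠ 0) (h : 4 ∣ N) {w : ℂ}
    (hw : w ^ N = -1) : v (1 - I) < v (w - 1) := by
  refine val_one_sub_I_lt_val_sub_one h2 (N := N * 2) (by omega) (by rw [pow_mul, hw]; norm_num) ?_
  obtain ⟨k, rfl⟩ := h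
  intro h'
  rw [pow_mul, h', one_pow] at hw
  norm_num at hw

theorem zero_angle : v (exp (((0 : ℝ) : ℂ) * I)) = 1 := by simp

end Angles

/-! ### Simpler generators for `G_{n/m}(p,q)`. -/

section Generators

theorem rotA_eq (p : ℕ) : rotA p = rotLine 0 (2 * Real.pi / p) := (rotLine_zero_left _).symm

theorem rotB_eq (n m q : ℕ) : rotB n m q = rotLine (2 * Real.pi * n / m) (2 * Real.pi / q) := rfl

theorem rotLine_pow_half {φ : ℝ} {q : ℕ} (hq : q ≠ 0) (h : 2 ∣ q) :
    rotLine φ (2 * Real.pi / q) ^ (q / 2) = rotLine φ Real.pi := by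
  obtain ⟨k, rfl⟩ := h
  have hk : (k : ℝ) ≠ 0 := by
    have : k ≠ 0 := by omega
    exact_mod_cast this
  rw [rotLine_pow, Nat.mul_div_cancel_left _ (by norm_num)]
  congr 1
  push_cast
  field_simp

theorem two_pi_div_two : 2 * Real.pi / ((2 : ℕ) : ℝ) = Real.pi := by push_cast; ring

theorem two_pi_div_four : 2 * Real.pi / ((4 : ℕ) : ℝ) = Real.pi / 2 := by push_cast; ring

variable {S : Subgroup SO3}

theorem rotLine_pi_mem {φ : ℝ} {q : ℕ} (hq : q ≠ 0) (h : 2 ∣ q)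
    (hm : rotLine φ (2 * Real.pi / q) ∈ S) : rotLine φ Real.pi ∈ S :=
  two_pi_div_two ▸ rotLine_div_mem_of_dvd hq h hm

theorem rotLine_half_pi_mem {φ : ℝ} {q : ℕ} (hq : q ≠ 0) (h : 4 ∣ q)
    (hm : rotLine φ (2 * Real.pi / q) ∈ S) : rotLine φ (Real.pi / 2) ∈ S :=
  two_pi_div_four ▸ rotLine_div_mem_of_dvd hq h hm

theorem rotZ_half_pi_mem {N : ℕ} (hN : N ≠ 0) (h : 4 ∣ N)
    (hm : rotZ (2 * Real.pi / N) ∈ S) : rotZ (Real.pi / 2) ∈ S :=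
  two_pi_div_four ▸ rotZ_div_mem_of_dvd hN h hm

theorem rotZ_pi_mem {N : ℕ} (hN : N ≠ 0) (h : 2 ∣ N)
    (hm : rotZ (2 * Real.pi / N) ∈ S) : rotZ Real.pi ∈ S :=
  two_pi_div_two ▸ rotZ_div_mem_of_dvd hN h hm

/-- The product of the half-turns about the two axes generates the rotations by multiples of
`4π/m` about the `z`-axis. -/
theorem rotZ_half_mem {n m : ℕ} (hm : m ≠ 0) (h2 : 2 ∣ m) (hnm : Nat.Coprime n m)
    (hA : rotLine 0 Real.pi ∈ S) (hB : rotLine (2 * Real.pi * n / m) Real.pi ∈ S) :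
    rotZ (2 * Real.pi / (m / 2 : ℕ)) ∈ S := by
  have hd : m / 2 ∣ m := Nat.div_dvd_of_dvd h2
  refine rotZ_mem_of_coprime (n := n) (by omega) (hnm.coprime_dvd_right hd) ?_
  have h := rotZ_two_mul_sub_mem hB hA
  have hm' : (m : ℝ) ≠ 0 := by exact_mod_cast hm
  convert h using 2
  rw [Nat.cast_div h2 (by norm_num)]
  push_cast
  field_simp
  ring

/-- Odd multiples of `π/N` differ by multiples of `2π/N`, that is, by rotations that `S` contains.
-/
theorem rotLine_mem_iff_of_odd {j N : ℕ} (hj : Odd j) (hz : rotZ (2 * Real.pi / N) ∈ S) (θ : ℝ) :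
    rotLine (j * (Real.pi / N)) θ ∈ S ↔ rotLine (Real.pi / N) θ ∈ S := by
  obtain ⟨k, rfl⟩ := hj
  have e : ((2 * k + 1 : ℕ) : ℝ) * (Real.pi / N) = ((k : ℤ) : ℝ) * (2 * Real.pi / N) + Real.pi / N := by
    push_cast; ring
  constructor
  · intro h
    have := rotLine_add_mem (rotZ_int_mem hz (-(k : ℤ))) h
    rw [e] at this
    convert this using 2
    push_cast; ring
  · intro h
    rw [e]
    exact rotLine_add_mem (rotZ_int_mem hz k) h

/-- `A` and `B` have quarter turns among their powers, and the product of their half-turns gives the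
rotations by `4π/m` about the `z`-axis, among them a quarter turn since `8 ∣ m`. Conjugating by
quarter turns yields rotations by `2π/p` and `2π/q` about the `z`-axis, and together these give
order `r`. The right-hand side depends on `r` alone, so the same lemma handles `G_{1/2r}(4,4)`. -/
theorem gFrac_eq_of_four_dvd {n m p q r u : ℕ} (hm : m ≠ 0) (hp : p ≠ 0) (hq : q ≠ 0)
    (hnm : Nat.Coprime n m) (hp4 : 4 ∣ p) (hq4 : 4 ∣ q) (hm8 : 8 ∣ m)
    (hr : r = Nat.lcm (Nat.lcm p q) (m / 2)) (hu : Odd u) (hru : 2 * r = m * u) :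
    GFrac n m p q = Subgroup.closure
      {rotZ (2 * Real.pi / r), rotX (Real.pi / 2), rotLine (Real.pi / r) (Real.pi / 2)} := by
  have h2m : 2 ∣ m := dvd_trans (by norm_num) hm8
  have hm2 : m / 2 ≠ 0 := by omega
  have hr0 : r ≠ 0 := hr ▸ Nat.lcm_ne_zero (Nat.lcm_ne_zero hp hq) hm2
  have hn : Odd n := odd_of_coprime_of_two_dvd hnm h2m
  have hj : Odd (n * u) := hn.mul hu
  have hpr : p ∣ r := hr ▸ (Nat.dvd_lcm_left p q).trans (Nat.dvd_lcm_left _ _)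
  have hqr : q ∣ r := hr ▸ (Nat.dvd_lcm_right p q).trans (Nat.dvd_lcm_left _ _)
  apply le_antisymm
  · rw [GFrac, Subgroup.closure_le]
    set L := Subgroup.closure
      {rotZ (2 * Real.pi / r), rotX (Real.pi / 2), rotLine (Real.pi / r) (Real.pi / 2)}
    have hz : rotZ (2 * Real.pi / r) ∈ L := Subgroup.subset_closure (by simp)
    have hx : rotLine 0 (Real.pi / 2) ∈ L := by
      rw [rotLine_zero_left]; exact Subgroup.subset_closure (by simp)
    have hl : rotLine (Real.pi / r) (Real.pi / 2) ∈ L := Subgroup.subset_closure (by simp)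
    have hz4 := rotZ_half_pi_mem hr0 (hp4.trans hpr) hz
    rintro _ (rfl | rfl)
    · rw [rotA_eq]
      exact (rotLine_mem_iff_rotZ_mem hx hz4).2 (rotZ_div_mem_of_dvd hr0 hpr hz)
    · rw [rotB_eq, line_angle_eq hm hr0 hru]
      exact (rotLine_mem_iff_rotZ_mem ((rotLine_mem_iff_of_odd hj hz _).2 hl) hz4).2
        (rotZ_div_mem_of_dvd hr0 hqr hz)
  · rw [Subgroup.closure_le]
    have hA : rotLine 0 (2 * Real.pi / p) ∈ GFrac n m p q :=
      rotA_eq p ▸ Subgroup.subset_closure (by simp)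
    have hB : rotLine (2 * Real.pi * n / m) (2 * Real.pi / q) ∈ GFrac n m p q :=
      Subgroup.subset_closure (by simp [rotB_eq])
    set L := GFrac n m p q
    have hA4 := rotLine_half_pi_mem hp hp4 hA
    have hB4 := rotLine_half_pi_mem hq hq4 hB
    have hz := rotZ_half_mem hm h2m hnm (rotLine_pi_mem hp (dvd_trans (by norm_num) hp4) hA)
      (rotLine_pi_mem hq (dvd_trans (by norm_num) hq4) hB)
    have hz4 := rotZ_half_pi_mem hm2 (by omega) hz
    have hzr : rotZ (2 * Real.pi / r) ∈ L := by
      rw [hr]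
      exact rotZ_lcm_mem (Nat.lcm_ne_zero hp hq) hm2
        (rotZ_lcm_mem hp hq ((rotLine_mem_iff_rotZ_mem hA4 hz4).1 hA)
          ((rotLine_mem_iff_rotZ_mem hB4 hz4).1 hB)) hz
    rintro _ (rfl | rfl | rfl)
    · exact hzr
    · exact rotLine_zero_left (Real.pi / 2) ▸ hA4
    · rw [line_angle_eq hm hr0 hru] at hB4
      exact (rotLine_mem_iff_of_odd hj hzr _).1 hB4

/-- As in `gFrac_eq_of_four_dvd`, but only `A` is traded for a rotation about the `z`-axis, because
`q` need not be divisible by 4; so `q` survives in the generators. -/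
theorem gFrac_eq_of_four_dvd_left {n m p q s u : ℕ} (hm : m ≠ 0) (hp : p ≠ 0) (hq : q ≠ 0)
    (hnm : Nat.Coprime n m) (hp4 : 4 ∣ p) (hq2 : 2 ∣ q) (hm8 : 8 ∣ m)
    (hs : s = Nat.lcm p (m / 2)) (hu : Odd u) (hsu : 2 * s = m * u) :
    GFrac n m p q = Subgroup.closure
      {rotZ (2 * Real.pi / s), rotX (Real.pi / 2), rotLine (Real.pi / s) (2 * Real.pi / q)} := by
  have h2m : 2 ∣ m := dvd_trans (by norm_num) hm8
  have hm2 : m / 2 ≠ 0 := by omega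
  have hs0 : s ≠ 0 := hs ▸ Nat.lcm_ne_zero hp hm2
  have hn : Odd n := odd_of_coprime_of_two_dvd hnm h2m
  have hj : Odd (n * u) := hn.mul hu
  have hps : p ∣ s := hs ▸ Nat.dvd_lcm_left _ _
  apply le_antisymm
  · rw [GFrac, Subgroup.closure_le]
    set L := Subgroup.closure
      {rotZ (2 * Real.pi / s), rotX (Real.pi / 2), rotLine (Real.pi / s) (2 * Real.pi / q)}
    have hz : rotZ (2 * Real.pi / s) ∈ L := Subgroup.subset_closure (by simp)
    have hx : rotLine 0 (Real.pi / 2) ∈ L := by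
      rw [rotLine_zero_left]; exact Subgroup.subset_closure (by simp)
    have hl : rotLine (Real.pi / s) (2 * Real.pi / q) ∈ L := Subgroup.subset_closure (by simp)
    have hz4 := rotZ_half_pi_mem hs0 (hp4.trans hps) hz
    rintro _ (rfl | rfl)
    · rw [rotA_eq]
      exact (rotLine_mem_iff_rotZ_mem hx hz4).2 (rotZ_div_mem_of_dvd hs0 hps hz)
    · rw [rotB_eq, line_angle_eq hm hs0 hsu]
      exact (rotLine_mem_iff_of_odd hj hz _).2 hl
  · rw [Subgroup.closure_le]
    have hA : rotLine 0 (2 * Real.pi / p) ∈ GFrac n m p q :=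
      rotA_eq p ▸ Subgroup.subset_closure (by simp)
    have hB : rotLine (2 * Real.pi * n / m) (2 * Real.pi / q) ∈ GFrac n m p q :=
      Subgroup.subset_closure (by simp [rotB_eq])
    set L := GFrac n m p q
    have hA4 := rotLine_half_pi_mem hp hp4 hA
    have hz := rotZ_half_mem hm h2m hnm (rotLine_pi_mem hp (dvd_trans (by norm_num) hp4) hA)
      (rotLine_pi_mem hq hq2 hB)
    have hz4 := rotZ_half_pi_mem hm2 (by omega) hz
    have hzs : rotZ (2 * Real.pi / s) ∈ L := by
      rw [hs]
      exact rotZ_lcm_mem hp hm2 ((rotLine_mem_iff_rotZ_mem hA4 hz4).1 hA) hz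
    rintro _ (rfl | rfl | rfl)
    · exact hzs
    · exact rotLine_zero_left (Real.pi / 2) ▸ hA4
    · rw [line_angle_eq hm hs0 hsu] at hB
      exact (rotLine_mem_iff_of_odd hj hzs _).1 hB

/-- With `8 ∤ m` the half-turns yield no quarter turn about the `z`-axis. Instead their products
rotate `ℓ` onto the `y`-axis, which a quarter turn about the `x`-axis carries to the `z`-axis. -/
theorem gFrac_eq_of_four_mul_odd {n m p q t M : ℕ} (hp : p ≠ 0) (hq : q ≠ 0)
    (hnm : Nat.Coprime n m) (hp4 : 4 ∣ p) (hq2 : 2 ∣ q) (hM : Odd M) (hm : m = 4 * M)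
    (ht : t = Nat.lcm q (m / 2)) :
    GFrac n m p q = Subgroup.closure {rotX (2 * Real.pi / p), rotZ (2 * Real.pi / t)} := by
  have hM0 := hM.pos
  have hM0' : (M : ℝ) ≠ 0 := by exact_mod_cast hM0.ne'
  have h2m : 2 ∣ m := by omega
  have hm2 : m / 2 ≠ 0 := by omega
  have ht0 : t ≠ 0 := ht ▸ Nat.lcm_ne_zero hq hm2
  have hn : Odd n := odd_of_coprime_of_two_dvd hnm h2m
  obtain ⟨a, rfl⟩ := hn
  obtain ⟨b, rfl⟩ := hM
  -- With `n = 2a + 1` and `M = 2b + 1`, the line `ℓ` is the `y`-axis turned by `a - b` steps of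
  -- `4π/m`.
  have hφ : 2 * Real.pi * (2 * a + 1 : ℕ) / m =
      ((a - b : ℤ) : ℝ) * (2 * Real.pi / (m / 2 : ℕ)) + Real.pi / 2 := by
    rw [Nat.cast_div h2m (by norm_num), hm]
    push_cast at hM0' ⊢
    field_simp
    ring
  have hqt : q ∣ t := ht ▸ Nat.dvd_lcm_left _ _
  have hmt : m / 2 ∣ t := ht ▸ Nat.dvd_lcm_right _ _
  apply le_antisymm
  · rw [GFrac, Subgroup.closure_le]
    set L := Subgroup.closure {rotX (2 * Real.pi / p), rotZ (2 * Real.pi / t)}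
    have hx : rotX (2 * Real.pi / p) ∈ L := Subgroup.subset_closure (by simp)
    have hz : rotZ (2 * Real.pi / t) ∈ L := Subgroup.subset_closure (by simp)
    rintro _ (rfl | rfl)
    · exact hx
    · have hx4 := rotLine_half_pi_mem hp hp4 (φ := 0) (by rwa [rotLine_zero_left])
      rw [rotLine_zero_left] at hx4
      rw [rotB_eq, hφ]
      exact rotLine_add_mem (rotZ_int_mem (rotZ_div_mem_of_dvd ht0 hmt hz) _)
        ((rotLine_half_pi_mem_iff_rotZ_mem hx4).2 (rotZ_div_mem_of_dvd ht0 hqt hz))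
  · rw [Subgroup.closure_le]
    have hA : rotLine 0 (2 * Real.pi / p) ∈ GFrac (2 * a + 1) m p q :=
      rotA_eq p ▸ Subgroup.subset_closure (by simp)
    have hB : rotLine (2 * Real.pi * (2 * a + 1 : ℕ) / m) (2 * Real.pi / q) ∈
        GFrac (2 * a + 1) m p q := Subgroup.subset_closure (by simp [rotB_eq])
    set L := GFrac (2 * a + 1) m p q
    have hz := rotZ_half_mem (by omega) h2m hnm
      (rotLine_pi_mem hp (dvd_trans (by norm_num) hp4) hA) (rotLine_pi_mem hq hq2 hB)
    have hA4 := rotLine_half_pi_mem hp hp4 hA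
    rw [rotLine_zero_left] at hA4
    rintro _ (rfl | rfl)
    · exact rotLine_zero_left (2 * Real.pi / p) ▸ hA
    · rw [ht]
      refine rotZ_lcm_mem hq hm2 ((rotLine_half_pi_mem_iff_rotZ_mem hA4).1 ?_) hz
      have := rotLine_add_mem (rotZ_int_mem hz (-(a - b : ℤ))) hB
      rw [hφ] at this
      convert this using 2
      push_cast
      ring

end Generators

/-! ### Interchanging the `x`-axis and the `z`-axis. -/

section Swap

/-- The half-turn that interchanges the `x`-axis and the `z`-axis. -/
def swapXZ : SO3 :=
  ⟨!![0, 0, 1; 0, -1, 0; 1, 0, 0], by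
    rw [Matrix.mem_specialOrthogonalGroup_iff, Matrix.mem_orthogonalGroup_iff]
    constructor
    · ext i j
      fin_cases i <;> fin_cases j <;> simp [Matrix.mul_apply, Fin.sum_univ_three]
    · simp [Matrix.det_fin_three]⟩

theorem swapXZ_mul_rotX (θ : ℝ) : swapXZ * rotX θ = rotZ θ * swapXZ := by
  apply Subtype.ext
  ext i j
  fin_cases i <;> fin_cases j <;>
    simp [swapXZ, rotX, rotZ]

theorem swapXZ_mul_rotZ (θ : ℝ) : swapXZ * rotZ θ = rotX θ * swapXZ := by
  apply Subtype.ext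
  ext i j
  fin_cases i <;> fin_cases j <;>
    simp [swapXZ, rotX, rotZ]

theorem swapXZ_conj_rotX (θ : ℝ) : MulAut.conj swapXZ (rotX θ) = rotZ θ := by
  rw [MulAut.conj_apply, swapXZ_mul_rotX, mul_inv_cancel_right]

theorem swapXZ_conj_rotZ (θ : ℝ) : MulAut.conj swapXZ (rotZ θ) = rotX θ := by
  rw [MulAut.conj_apply, swapXZ_mul_rotZ, mul_inv_cancel_right]

theorem map_swapXZ_closure_pair (a b : ℝ) :
    (Subgroup.closure {rotX a, rotZ b}).map (MulAut.conj swapXZ).toMonoidHom =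
      Subgroup.closure {rotZ a, rotX b} := by
  rw [MonoidHom.map_closure, Set.image_pair]
  simp only [MulEquiv.coe_toMonoidHom, swapXZ_conj_rotX, swapXZ_conj_rotZ]

theorem map_swapXZ_gOrth (r : ℕ) :
    (GOrth r 4).map (MulAut.conj swapXZ).toMonoidHom =
      Subgroup.closure {rotZ (2 * Real.pi / r), rotX (Real.pi / 2)} := by
  rw [GOrth, map_swapXZ_closure_pair, two_pi_div_four]

theorem map_rotZ_closure_pair (φ a b : ℝ) :
    (Subgroup.closure {rotZ a, rotX b}).map (MulAut.conj (rotZ φ)).toMonoidHom =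
      Subgroup.closure {rotZ a, rotLine φ b} := by
  rw [MonoidHom.map_closure, Set.image_pair]
  simp only [MulEquiv.coe_toMonoidHom, MulAut.conj_apply]
  rw [← rotZ_add, add_comm, rotZ_add, mul_inv_cancel_right]
  rfl

end Swap

end

end RotationGroups

namespace RotationGroups

noncomputable section

open Complex

/-! ### The three amalgam decompositions. -/

section Amalgams

/-- Supplies the generation hypotheses of `isAmalgam_of_pingPong`. `K` is only bounded on both
sides, so that the centre and its intersection with the second factor both qualify. -/
theorem closure_octahedral_eq {φ : ℝ} {r : ℕ} (hr : r ≠ 0) (h4 : 4 ∣ r) {K : Subgroup SO3}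
    (hK : Subgroup.closure {rotZ (2 * Real.pi / r), rotLine φ Real.pi} ≤ K)
    (hKle : K ≤ Subgroup.closure {rotZ (2 * Real.pi / r), rotLine φ (Real.pi / 2)}) :
    Subgroup.closure {rotZ (2 * Real.pi / r), rotLine φ (Real.pi / 2)} =
      Subgroup.closure ((K : Set SO3) ∪
        (Subgroup.closure {rotLine φ (Real.pi / 2), rotZ (Real.pi / 2)} : Subgroup SO3)) := by
  apply le_antisymm
  · rw [Subgroup.closure_le]
    rintro _ (rfl | rfl)
    · exact Subgroup.subset_closure (Or.inl (hK (Subgroup.subset_closure (by simp))))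
    · exact Subgroup.subset_closure (Or.inr (Subgroup.subset_closure (by simp)))
  · rw [Subgroup.closure_le, Set.union_subset_iff]
    refine ⟨hKle, (Subgroup.closure_le _).2 ?_⟩
    rintro _ (rfl | rfl)
    · exact Subgroup.subset_closure (by simp)
    · exact rotZ_half_pi_mem hr h4 (Subgroup.subset_closure (by simp))

/-- The half-turns `rotX π` and `rotLine φ π` differ by `rotZ (2 * φ)`, so the centre looks the same
from the line of either leaf. -/
theorem center_eq_closure_line {φ : ℝ} {N : ℕ} {l : ℤ} (hl : 2 * φ = l * (2 * Real.pi / N)) :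
    Subgroup.closure {rotZ (2 * Real.pi / N), rotX Real.pi} =
      Subgroup.closure {rotZ (2 * Real.pi / N), rotLine φ Real.pi} := by
  apply le_antisymm <;> rw [Subgroup.closure_le] <;> rintro _ (rfl | rfl)
  · exact Subgroup.subset_closure (by simp)
  · refine (rotX_pi_mem_iff_rotLine (φ := φ) (hl ▸ rotZ_int_mem ?_ l)).2 ?_ <;>
      exact Subgroup.subset_closure (by simp)
  · exact Subgroup.subset_closure (by simp)
  · refine (rotX_pi_mem_iff_rotLine (φ := φ) (hl ▸ rotZ_int_mem ?_ l)).1 ?_ <;>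
      exact Subgroup.subset_closure (by simp)

theorem line_half_turn_le {φ : ℝ} {N : ℕ} (hN : N ≠ 0) (h4 : 4 ∣ N) :
    Subgroup.closure {rotZ (Real.pi / 2), rotLine φ Real.pi} ≤
      Subgroup.closure {rotZ (2 * Real.pi / N), rotLine φ Real.pi} := by
  rw [Subgroup.closure_le]
  rintro _ (rfl | rfl)
  · exact rotZ_half_pi_mem hN h4 (Subgroup.subset_closure (by simp))
  · exact Subgroup.subset_closure (by simp)

theorem center_le_octahedral {φ : ℝ} {N : ℕ} :
    Subgroup.closure {rotZ (2 * Real.pi / N), rotLine φ Real.pi} ≤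
      Subgroup.closure {rotZ (2 * Real.pi / N), rotLine φ (Real.pi / 2)} := by
  rw [Subgroup.closure_le]
  rintro _ (rfl | rfl)
  · exact Subgroup.subset_closure (by simp)
  · rw [← rotLine_half_pi_sq]
    exact mul_mem (Subgroup.subset_closure (by simp)) (Subgroup.subset_closure (by simp))

theorem rotLine_pi_mem_octahedral (φ : ℝ) :
    rotLine φ Real.pi ∈ Subgroup.closure {rotLine φ (Real.pi / 2), rotZ (Real.pi / 2)} := by
  rw [← rotLine_half_pi_sq]
  exact mul_mem (Subgroup.subset_closure (by simp)) (Subgroup.subset_closure (by simp))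

/-- Centre `D_r`, octahedral leaves on the lines at angles `0` and `π/r`, both discs of radius `v (1
- I)`. Each factor is the centre together with one leaf, so the amalgamated subgroup is the whole
centre. -/
theorem isAmalgam_two_octahedral {r : ℕ} (hr : r ≠ 0) (h4 : 4 ∣ r) :
    IsAmalgam
      (Subgroup.closure {rotZ (2 * Real.pi / r), rotX (Real.pi / 2)} ⊔
        Subgroup.closure {rotZ (2 * Real.pi / r), rotLine (Real.pi / r) (Real.pi / 2)})
      (Subgroup.closure {rotZ (2 * Real.pi / r), rotX (Real.pi / 2)})
      (Subgroup.closure {rotZ (2 * Real.pi / r), rotLine (Real.pi / r) (Real.pi / 2)})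
      (Subgroup.closure {rotZ (2 * Real.pi / r), rotX Real.pi}) := by
  obtain ⟨O, h2⟩ := exists_valuation_two_lt_one
  have h1 := val_one_sub_I_lt_one h2
  have hc : ∀ w : ℂ, w ^ r = 1 → w ^ 4 ≠ 1 → O.valuation (1 - I) < O.valuation (w - 1) :=
    fun w hw hw4 => val_one_sub_I_lt_val_sub_one h2 hr hw hw4
  have hc' : ∀ w : ℂ, w ^ r = -1 → O.valuation (1 - I) < O.valuation (w - 1) :=
    fun w hw => val_one_sub_I_lt_of_pow_eq_neg_one h2 hr h4 hw
  have hexp : exp ((Real.pi / r : ℝ) * I) ^ r = -1 := by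
    have := exp_odd_mul_pow hr odd_one
    rwa [Nat.cast_one, one_mul] at this
  have hφ : O.valuation (exp ((Real.pi / r : ℝ) * I)) = 1 := val_exp_of_pow_eq_neg_one hr hexp
  have hl : 2 * (Real.pi / r) = (1 : ℤ) * (2 * Real.pi / r) := by push_cast; ring
  have hl0 : 2 * (0 : ℝ) = (0 : ℤ) * (2 * Real.pi / r) := by simp
  have hK0 := center_eq_closure_line hl0
  have hK1 := center_eq_closure_line hl
  have hle : Subgroup.closure {rotZ (2 * Real.pi / r), rotX Real.pi} ≤
      Subgroup.closure {rotZ (2 * Real.pi / r), rotLine (Real.pi / r) (Real.pi / 2)} :=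
    hK1 ▸ center_le_octahedral
  have key := isAmalgam_of_pingPong complexAct complexAct_mul complexAct_one
    (Subgroup.closure {rotZ (2 * Real.pi / r), rotX (Real.pi / 2)})
    (Subgroup.closure {rotZ (2 * Real.pi / r), rotLine (Real.pi / r) (Real.pi / 2)})
    (Subgroup.closure {rotZ (2 * Real.pi / r), rotX Real.pi})
    ![Subgroup.closure {rotLine 0 (Real.pi / 2), rotZ (Real.pi / 2)},
      Subgroup.closure {rotLine (Real.pi / r) (Real.pi / 2), rotZ (Real.pi / 2)}]
    ![disc O.valuation 0 (O.valuation (1 - I)),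
      disc O.valuation (Real.pi / r) (O.valuation (1 - I))]
    ![codisc O.valuation 0 (O.valuation (1 - I)),
      codisc O.valuation (Real.pi / r) (O.valuation (1 - I))]
    (spinor 1 0) ?_ ?_ ?_ ?_ ?_ ?_ ?_
  · rwa [inf_eq_left.2 hle] at key
  · refine Fin.forall_fin_two.2 ⟨fun g hg => ?_, fun g hg => ?_⟩
    · exact (mem_or_octahedral_codisc h2 zero_angle hg).imp_left
        fun h => hK0 ▸ line_half_turn_le hr h4 h
    · exact (mem_or_octahedral_codisc h2 hφ hg).imp_left
        fun h => hK1 ▸ line_half_turn_le hr h4 h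
  · refine Fin.forall_fin_two.2 ⟨fun k hk => ?_, fun k hk => ?_⟩
    · exact mem_or_center_disc hr four_ne_zero hl0 zero_angle h1 hc
        (two_pi_div_four ▸ Subgroup.subset_closure (by simp)) (rotLine_pi_mem_octahedral 0) hk
    · exact mem_or_center_disc hr four_ne_zero hl hφ h1 hc
        (two_pi_div_four ▸ Subgroup.subset_closure (by simp)) (rotLine_pi_mem_octahedral _) hk
  · refine Fin.forall_fin_two.2 ⟨Fin.forall_fin_two.2 ⟨fun h => (h rfl).elim, ?_⟩,
      Fin.forall_fin_two.2 ⟨?_, fun h => (h rfl).elim⟩⟩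
    · intro _ k hk x hx
      exact center_disc_codisc hr hl0 zero_angle hφ
        (by rw [zero_sub]; exact exp_neg_pow hexp) h1 hc' hc' hk hx
    · intro _ k hk x hx
      exact center_disc_codisc hr hl hφ zero_angle (by rw [sub_zero]; exact hexp) h1 hc' hc' hk hx
  · refine Fin.forall_fin_two.2 ⟨fun k hk => ?_, fun k hk => ?_⟩
    · exact center_base_codisc zero_angle h1 hk
    · exact center_base_codisc hφ h1 hk
  · exact Fin.forall_fin_two.2 ⟨disjoint_disc_codisc _ _ _, disjoint_disc_codisc _ _ _⟩
  · rw [← rotLine_zero_left (Real.pi / 2)]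
    exact closure_octahedral_eq hr h4 hK0.ge (hK0 ▸ center_le_octahedral)
  · exact closure_octahedral_eq hr h4 (le_inf hK1.ge (hK1 ▸ hle))  inf_le_right

/-- The octahedral leaf has radius `v (1 - I)`, the dihedral leaf `v 2`. The centre belongs to the
first factor; the second factor is the dihedral leaf alone, which meets the centre in a Klein
four-group. -/
theorem isAmalgam_octahedral_dihedral {s q j M : ℕ} (hs : s ≠ 0) (h4 : 4 ∣ s) (hM : Odd M)
    (hq : q = 2 * M) (hj : Odd j) {φ : ℝ} (hφj : φ = j * (Real.pi / s)) :
    IsAmalgam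
      (Subgroup.closure {rotZ (2 * Real.pi / s), rotX (Real.pi / 2)} ⊔
        Subgroup.closure {rotLine φ (2 * Real.pi / q), rotZ Real.pi})
      (Subgroup.closure {rotZ (2 * Real.pi / s), rotX (Real.pi / 2)})
      (Subgroup.closure {rotLine φ (2 * Real.pi / q), rotZ Real.pi})
      (Subgroup.closure {rotLine φ Real.pi, rotZ Real.pi}) := by
  obtain ⟨O, h2⟩ := exists_valuation_two_lt_one
  have hq0 : q ≠ 0 := by have := hM.pos; omega
  have hs2 : 2 ∣ s := dvd_trans (by norm_num) h4
  have h1 := val_one_sub_I_lt_one h2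
  have hc : ∀ w : ℂ, w ^ s = 1 → w ^ 4 ≠ 1 → O.valuation (1 - I) < O.valuation (w - 1) :=
    fun w hw hw4 => val_one_sub_I_lt_val_sub_one h2 hs hw hw4
  have hc2 : ∀ w : ℂ, w ^ s = 1 → w ^ 2 ≠ 1 → O.valuation 2 < O.valuation (w - 1) :=
    fun w hw hw2 => val_two_lt_val_sub_one h2 hs hw hw2
  have hc' : ∀ w : ℂ, w ^ s = -1 → O.valuation (1 - I) < O.valuation (w - 1) :=
    fun w hw => val_one_sub_I_lt_of_pow_eq_neg_one h2 hs h4 hw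
  have hc2' : ∀ w : ℂ, w ^ s = -1 → O.valuation 2 < O.valuation (w - 1) :=
    fun w hw => val_two_lt_of_pow_eq_neg_one h2 hs hs2 hw
  have hexp : exp (φ * I) ^ s = -1 := hφj ▸ exp_odd_mul_pow hs hj
  have hφ : O.valuation (exp (φ * I)) = 1 := val_exp_of_pow_eq_neg_one hs hexp
  have hl : 2 * φ = (j : ℤ) * (2 * Real.pi / s) := hφj ▸ two_mul_line_angle j s
  have hl0 : 2 * (0 : ℝ) = (0 : ℤ) * (2 * Real.pi / s) := by simp
  have hK0 := center_eq_closure_line hl0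
  have hK1 := center_eq_closure_line hl
  have hedgeK : Subgroup.closure {rotLine φ Real.pi, rotZ Real.pi} ≤
      Subgroup.closure {rotZ (2 * Real.pi / s), rotX Real.pi} := by
    rw [hK1, Subgroup.closure_le]
    rintro _ (rfl | rfl)
    · exact Subgroup.subset_closure (by simp)
    · exact rotZ_pi_mem hs hs2 (Subgroup.subset_closure (by simp))
  have hlineD : rotLine φ Real.pi ∈
      Subgroup.closure {rotLine φ (2 * Real.pi / q), rotZ Real.pi} :=
    rotLine_pi_mem hq0 ⟨M, hq⟩ (Subgroup.subset_closure (by simp))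
  have hedgeD : Subgroup.closure {rotLine φ Real.pi, rotZ Real.pi} ≤
      Subgroup.closure {rotLine φ (2 * Real.pi / q), rotZ Real.pi} := by
    rw [Subgroup.closure_le]
    rintro _ (rfl | rfl)
    · exact hlineD
    · exact Subgroup.subset_closure (by simp)
  have hbase : ∀ k ∈ Subgroup.closure {rotZ (2 * Real.pi / s), rotX Real.pi},
      complexAct k (spinor 1 0) ∈ codisc O.valuation φ (O.valuation 2) :=
    fun k hk => center_base_codisc hφ h2 hk
  -- The leaf moves the base point into the disc unless the element lies in the Klein four-group,
  -- whereas the centre keeps it outside.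
  have hinf : Subgroup.closure {rotZ (2 * Real.pi / s), rotX Real.pi} ⊓
      Subgroup.closure {rotLine φ (2 * Real.pi / q), rotZ Real.pi} =
      Subgroup.closure {rotLine φ Real.pi, rotZ Real.pi} := by
    refine le_antisymm (fun g hg => ?_) (le_inf hedgeK hedgeD)
    refine (mem_or_dihedral_codisc h2 hM hq hφ hg.2).resolve_right fun h => ?_
    exact Set.disjoint_left.1 (disjoint_disc_codisc _ _ _)
      (h _ (complexAct_one (spinor 1 0) ▸ hbase 1 (one_mem _))) (hbase g hg.1)
  have key := isAmalgam_of_pingPong complexAct complexAct_mul complexAct_one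
    (Subgroup.closure {rotZ (2 * Real.pi / s), rotX (Real.pi / 2)})
    (Subgroup.closure {rotLine φ (2 * Real.pi / q), rotZ Real.pi})
    (Subgroup.closure {rotZ (2 * Real.pi / s), rotX Real.pi})
    ![Subgroup.closure {rotLine 0 (Real.pi / 2), rotZ (Real.pi / 2)},
      Subgroup.closure {rotLine φ (2 * Real.pi / q), rotZ Real.pi}]
    ![disc O.valuation 0 (O.valuation (1 - I)), disc O.valuation φ (O.valuation 2)]
    ![codisc O.valuation 0 (O.valuation (1 - I)), codisc O.valuation φ (O.valuation 2)]
    (spinor 1 0) ?_ ?_ ?_ ?_ ?_ ?_ ?_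
  · rwa [hinf] at key
  · refine Fin.forall_fin_two.2 ⟨fun g hg => ?_, fun g hg => ?_⟩
    · exact (mem_or_octahedral_codisc h2 zero_angle hg).imp_left
        fun h => hK0 ▸ line_half_turn_le hs h4 h
    · exact (mem_or_dihedral_codisc h2 hM hq hφ hg).imp_left fun h => hedgeK h
  · refine Fin.forall_fin_two.2 ⟨fun k hk => ?_, fun k hk => ?_⟩
    · exact mem_or_center_disc hs four_ne_zero hl0 zero_angle h1 hc
        (two_pi_div_four ▸ Subgroup.subset_closure (by simp)) (rotLine_pi_mem_octahedral 0) hk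
    · exact mem_or_center_disc hs two_ne_zero hl hφ h2 hc2
        (two_pi_div_two ▸ Subgroup.subset_closure (by simp)) hlineD hk
  · refine Fin.forall_fin_two.2 ⟨Fin.forall_fin_two.2 ⟨fun h => (h rfl).elim, ?_⟩,
      Fin.forall_fin_two.2 ⟨?_, fun h => (h rfl).elim⟩⟩
    · intro _ k hk x hx
      exact center_disc_codisc hs hl0 zero_angle hφ
        (by rw [zero_sub]; exact exp_neg_pow hexp) h1 hc' hc2' hk hx
    · intro _ k hk x hx
      exact center_disc_codisc hs hl hφ zero_angle (by rw [sub_zero]; exact hexp) h2 hc2' hc' hk hx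
  · refine Fin.forall_fin_two.2 ⟨fun k hk => ?_, fun k hk => ?_⟩
    · exact center_base_codisc zero_angle h1 hk
    · exact hbase k hk
  · exact Fin.forall_fin_two.2 ⟨disjoint_disc_codisc _ _ _, disjoint_disc_codisc _ _ _⟩
  · rw [← rotLine_zero_left (Real.pi / 2)]
    exact closure_octahedral_eq hs h4 hK0.ge (hK0 ▸ center_le_octahedral)
  · apply le_antisymm
    · exact fun g hg => Subgroup.subset_closure (Or.inr hg)
    · rw [Subgroup.closure_le]
      exact Set.union_subset inf_le_right subset_rfl

/-- Here `D_p` is the centre, its axis made vertical by `swapXZ`, and `D_t` is the only leaf, as `t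
≡ 2 mod 4`. -/
theorem isAmalgam_two_dihedral {p t M : ℕ} (hp : p ≠ 0) (hp2 : 2 ∣ p) (hM : Odd M)
    (ht : t = 2 * M) :
    IsAmalgam
      (Subgroup.closure {rotX (2 * Real.pi / p), rotZ Real.pi} ⊔
        Subgroup.closure {rotZ (2 * Real.pi / t), rotX Real.pi})
      (Subgroup.closure {rotX (2 * Real.pi / p), rotZ Real.pi})
      (Subgroup.closure {rotZ (2 * Real.pi / t), rotX Real.pi})
      (Subgroup.closure {rotZ Real.pi, rotX Real.pi}) := by
  obtain ⟨O, h2⟩ := exists_valuation_two_lt_one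
  have ht0 : t ≠ 0 := by have := hM.pos; omega
  have hc2 : ∀ w : ℂ, w ^ p = 1 → w ^ 2 ≠ 1 → O.valuation 2 < O.valuation (w - 1) :=
    fun w hw hw2 => val_two_lt_val_sub_one h2 hp hw hw2
  have hl0 : 2 * (0 : ℝ) = (0 : ℤ) * (2 * Real.pi / p) := by simp
  have hD₁ : ∀ g ∈ Subgroup.closure {rotX (2 * Real.pi / p), rotZ Real.pi},
      MulAut.conj swapXZ g ∈ Subgroup.closure {rotZ (2 * Real.pi / p), rotX Real.pi} :=
    fun g hg => map_swapXZ_closure_pair (2 * Real.pi / p) Real.pi ▸ Subgroup.mem_map_of_mem _ hg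
  have hD₂ : ∀ g, MulAut.conj swapXZ g ∈
      Subgroup.closure {rotLine 0 (2 * Real.pi / t), rotZ Real.pi} ↔
      g ∈ Subgroup.closure {rotZ (2 * Real.pi / t), rotX Real.pi} := by
    intro g
    rw [rotLine_zero_left, Set.pair_comm, Set.pair_comm (rotZ (2 * Real.pi / t)),
      ← map_swapXZ_closure_pair]
    exact Subgroup.mem_map_iff_mem (MulAut.conj swapXZ).injective
  have hE : ∀ g, MulAut.conj swapXZ g ∈ Subgroup.closure {rotLine 0 Real.pi, rotZ Real.pi} ↔
      g ∈ Subgroup.closure {rotZ Real.pi, rotX Real.pi} := by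
    intro g
    rw [rotLine_zero_left, Set.pair_comm]
    conv_rhs => rw [Set.pair_comm]
    rw [← map_swapXZ_closure_pair]
    exact Subgroup.mem_map_iff_mem (MulAut.conj swapXZ).injective
  have hEle₁ : Subgroup.closure {rotZ Real.pi, rotX Real.pi} ≤
      Subgroup.closure {rotX (2 * Real.pi / p), rotZ Real.pi} := by
    rw [Subgroup.closure_le]
    rintro _ (rfl | rfl)
    · exact Subgroup.subset_closure (by simp)
    · have := rotLine_pi_mem (φ := 0) hp hp2
        (S := Subgroup.closure {rotX (2 * Real.pi / p), rotZ Real.pi})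
        (by rw [rotLine_zero_left]; exact Subgroup.subset_closure (by simp))
      rwa [rotLine_zero_left] at this
  have hEle₂ : Subgroup.closure {rotZ Real.pi, rotX Real.pi} ≤
      Subgroup.closure {rotZ (2 * Real.pi / t), rotX Real.pi} := by
    rw [Subgroup.closure_le]
    rintro _ (rfl | rfl)
    · exact rotZ_pi_mem ht0 ⟨M, ht⟩ (Subgroup.subset_closure (by simp))
    · exact Subgroup.subset_closure (by simp)
  have hV : ∀ g ∈ Subgroup.closure {rotZ (2 * Real.pi / t), rotX Real.pi},
      g ∈ Subgroup.closure {rotZ Real.pi, rotX Real.pi} ∨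
      ∀ x ∈ codisc O.valuation 0 (O.valuation 2),
        complexAct (MulAut.conj swapXZ g) x ∈ disc O.valuation 0 (O.valuation 2) :=
    fun g hg => (mem_or_dihedral_codisc h2 hM ht zero_angle ((hD₂ g).2 hg)).imp_left (hE g).1
  have hbase : ∀ k ∈ Subgroup.closure {rotX (2 * Real.pi / p), rotZ Real.pi},
      complexAct (MulAut.conj swapXZ k) (spinor 1 0) ∈ codisc O.valuation 0 (O.valuation 2) :=
    fun k hk => center_base_codisc zero_angle h2 (hD₁ k hk)
  have hinf : Subgroup.closure {rotX (2 * Real.pi / p), rotZ Real.pi} ⊓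
      Subgroup.closure {rotZ (2 * Real.pi / t), rotX Real.pi} =
      Subgroup.closure {rotZ Real.pi, rotX Real.pi} := by
    refine le_antisymm (fun g hg => ?_) (le_inf hEle₁ hEle₂)
    refine (hV g hg.2).resolve_right fun h => ?_
    refine Set.disjoint_left.1 (disjoint_disc_codisc _ _ _) (h (spinor 1 0) ?_) (hbase g hg.1)
    have := hbase 1 (one_mem _)
    rwa [map_one, complexAct_one] at this
  have key := isAmalgam_of_pingPong (fun g => complexAct (MulAut.conj swapXZ g))
    (fun g h x => by simp only [map_mul, complexAct_mul])
    (fun x => by simp only [map_one, complexAct_one])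
    (Subgroup.closure {rotX (2 * Real.pi / p), rotZ Real.pi})
    (Subgroup.closure {rotZ (2 * Real.pi / t), rotX Real.pi})
    (Subgroup.closure {rotX (2 * Real.pi / p), rotZ Real.pi})
    -- The criterion expects two leaves; the first is a dummy, with trivial group and empty disc.
    ![⊥, Subgroup.closure {rotZ (2 * Real.pi / t), rotX Real.pi}]
    ![∅, disc O.valuation 0 (O.valuation 2)] ![Set.univ, codisc O.valuation 0 (O.valuation 2)]
    (spinor 1 0) ?_ ?_ ?_ ?_ ?_ ?_ ?_
  · rwa [hinf] at key
  · refine Fin.forall_fin_two.2 ⟨fun g hg => ?_, fun g hg => ?_⟩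
    · exact Or.inl (Subgroup.mem_bot.1 hg ▸ one_mem _)
    · exact (hV g hg).imp_left fun h => hEle₁ h
  · refine Fin.forall_fin_two.2 ⟨fun k hk => ?_, fun k hk => ?_⟩
    · exact Or.inr fun x hx => hx.elim
    · refine (mem_or_center_disc hp two_ne_zero hl0 zero_angle h2 hc2
        (V := Subgroup.closure {rotLine 0 (2 * Real.pi / t), rotZ Real.pi})
        (two_pi_div_two ▸ Subgroup.subset_closure (by simp))
        (rotLine_pi_mem ht0 ⟨M, ht⟩ (Subgroup.subset_closure (by simp))) (hD₁ k hk)).imp_left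
        (hD₂ k).1
  · refine Fin.forall_fin_two.2 ⟨Fin.forall_fin_two.2 ⟨fun h => (h rfl).elim, ?_⟩,
      Fin.forall_fin_two.2 ⟨?_, fun h => (h rfl).elim⟩⟩
    · exact fun _ k hk x hx => hx.elim
    · exact fun _ k hk x hx => Set.mem_univ _
  · exact Fin.forall_fin_two.2 ⟨fun k hk => Set.mem_univ _, fun k hk => hbase k hk⟩
  · exact Fin.forall_fin_two.2 ⟨Set.empty_disjoint _, disjoint_disc_codisc _ _ _⟩
  · apply le_antisymm
    · exact fun g hg => Subgroup.subset_closure (Or.inl hg)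
    · rw [Subgroup.closure_le]
      exact Set.union_subset subset_rfl (fun g hg => Subgroup.mem_bot.1 hg ▸ one_mem _)
  · apply le_antisymm
    · exact fun g hg => Subgroup.subset_closure (Or.inr hg)
    · rw [Subgroup.closure_le]
      exact Set.union_subset inf_le_right subset_rfl

end Amalgams

end

end RotationGroups

namespace RotationGroups

noncomputable section

open Complex

/-! ### The presentation and the quotient of `D_p *_{ℤ₂} D_q`. -/

section Presentation

/-- An injective homomorphism onto `G` gives an isomorphism onto `G`. -/
theorem exists_mulEquiv_of_injective {Γ : Type*} [Group Γ] {G : Subgroup SO3} (f : Γ →* SO3)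
    (hf : Function.Injective f) (hG : f.range = G) :
    ∃ e : Γ ≃* G, ∀ x, (e x : SO3) = f x :=
  ⟨(MonoidHom.ofInjective hf).trans (MulEquiv.subgroupCongr hG), fun _ => rfl⟩

theorem rotLine_zero_pi_mul (φ : ℝ) : rotLine 0 Real.pi * rotLine φ Real.pi = rotZ (-(2 * φ)) := by
  rw [rotLine_pi φ, rotLine_zero_left, ← mul_assoc, rotX_pi_mul_rotZ, mul_assoc, ← rotX_add,
    ← two_mul, rotX_two_pi, mul_one]

variable {Γ : Type*} [Group Γ] {α β γ : Γ} {n m p q M M' : ℕ}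

theorem mul_eq_inv_mul_of_sq {g t : Γ} (ht : t * t = 1) (h : (g * t) ^ 2 = 1) :
    t * g = g⁻¹ * t := by
  have h1 : g * (t * g * t) = 1 := by rw [← h, sq]; simp only [mul_assoc]
  rw [inv_eq_of_mul_eq_one_right h1, mul_assoc, ht, mul_one]

/-- A group with generators and relations as in the presentation maps isomorphically onto
`G_{n/m}(p,q)`. -/
theorem exists_mulEquiv_gFrac (hm0 : m ≠ 0) (hnm : Nat.Coprime n m) (hm4 : 4 ∣ m)
    (hM : Odd M) (hp : p = 2 * M) (hM' : Odd M') (hq : q = 2 * M')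
    (hα : α ^ p = 1) (hβ : β ^ q = 1) (hγ : γ ^ 2 = 1) (hαγ : (α * γ) ^ 2 = 1)
    (hβγ : (β * γ) ^ 2 = 1) (hlast : (α ^ (p / 2) * β ^ (q / 2)) ^ (m / 4) * γ = 1)
    (htop : Subgroup.closure {α, β, γ} = ⊤) (f : Γ →* SO3) (hfα : f α = rotA p)
    (hfβ : f β = rotB n m q) (hfγ : f γ = rotZ Real.pi) :
    ∃ e : Γ ≃* GFrac n m p q, ∀ x, (e x : SO3) = f x := by
  have hM0 := hM.pos
  have hM0' := hM'.pos
  have hp0 : p ≠ 0 := by omega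
  have hq0 : q ≠ 0 := by omega
  have hp2 : p / 2 = M := by omega
  have hq2 : q / 2 = M' := by omega
  have hpd : 2 ∣ p := ⟨M, hp⟩
  have hqd : 2 ∣ q := ⟨M', hq⟩
  have hmd : 2 ∣ m := dvd_trans (by norm_num) hm4
  have hn : Odd n := odd_of_coprime_of_two_dvd hnm hmd
  rw [rotA_eq] at hfα
  rw [rotB_eq] at hfβ
  obtain ⟨N, hN⟩ := hmd
  have hN0 : N ≠ 0 := by omega
  have hN2 : 2 ∣ N := by omega
  set φ := 2 * Real.pi * n / m with hφdef
  have hφn : φ = n * (Real.pi / N) := by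
    have := line_angle_eq (n := n) (u := 1) hm0 hN0 (by omega)
    rwa [mul_one] at this
  have hγ' : γ * γ = 1 := by rw [← sq, hγ]
  set a := α ^ M with ha
  set b := β ^ M' with hb
  rw [hp2, hq2] at hlast
  set δ := a * b with hδ
  have haa : a * a = 1 := by rw [ha, ← pow_add, ← two_mul, ← hp, hα]
  have hbb : b * b = 1 := by rw [hb, ← pow_add, ← two_mul, ← hq, hβ]
  -- The last relation makes `γ` a power of `δ`. So `a`, `b` and `γ` lie in the dihedral group
  -- generated by `δ` and `a`, which serves as the centre inside `Γ`.
  have hγδ : γ = δ ^ (m / 4) := by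
    rw [eq_inv_of_mul_eq_one_left hlast, inv_eq_of_mul_eq_one_right hγ']
  have haδ : a * δ = δ⁻¹ * a := by
    rw [hδ, mul_inv_rev, ← mul_assoc, haa, one_mul, mul_assoc, inv_mul_cancel, mul_one,
      inv_eq_of_mul_eq_one_right hbb]
  have hδN : δ ^ N = 1 := by
    rw [show N = m / 4 * 2 by omega, pow_mul, ← hγδ, hγ]
  have hfa : f a = rotLine 0 Real.pi := by
    rw [ha, map_pow, hfα, ← hp2, rotLine_pow_half hp0 hpd]
  have hfb : f b = rotLine φ Real.pi := by
    rw [hb, map_pow, hfβ, ← hq2, rotLine_pow_half hq0 hqd]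
  have hfδ : f δ = rotZ (-(2 * φ)) := by rw [hδ, map_mul, hfa, hfb, rotLine_zero_pi_mul]
  have hl : 2 * φ = (n : ℤ) * (2 * Real.pi / N) := hφn ▸ two_mul_line_angle n N
  have hl0 : 2 * (0 : ℝ) = (0 : ℤ) * (2 * Real.pi / N) := by simp
  set K := Subgroup.closure {δ, a}
  have hδK : δ ∈ K := Subgroup.subset_closure (by simp)
  have haK : a ∈ K := Subgroup.subset_closure (by simp)
  have hbK : b ∈ K := by
    have : b = a * δ := by rw [hδ, ← mul_assoc, haa, one_mul]
    exact this ▸ mul_mem haK hδK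
  have hγK : γ ∈ K := hγδ ▸ pow_mem hδK _
  have hfK : ∀ k ∈ K, f k ∈ Subgroup.closure {rotZ (2 * Real.pi / N), rotX Real.pi} := by
    suffices h : K ≤ (Subgroup.closure {rotZ (2 * Real.pi / N), rotX Real.pi}).comap f from h
    rw [Subgroup.closure_le]
    rintro _ (rfl | rfl)
    · change f δ ∈ Subgroup.closure {rotZ (2 * Real.pi / N), rotX Real.pi}
      rw [hfδ, hl, rotZ_neg]
      exact inv_mem (rotZ_int_mem (Subgroup.subset_closure (by simp)) _)
    · change f a ∈ Subgroup.closure {rotZ (2 * Real.pi / N), rotX Real.pi}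
      rw [hfa, rotLine_zero_left]
      exact Subgroup.subset_closure (by simp)
  -- `δ ^ N = 1`, and `f δ` has exact order `N` because `n` is prime to `N`; hence `f` is injective
  -- on `K`.
  have hKone : ∀ k ∈ K, f k = 1 → k = 1 := by
    intro k hk hfk
    obtain ⟨j, rfl | rfl⟩ := exists_zpow_of_mem_closure_pair haa haδ hk
    · rw [map_zpow, hfδ, rotZ_zpow] at hfk
      obtain ⟨i, hi⟩ := exists_of_rotZ_eq_one hfk
      have hdvd : (N : ℤ) ∣ -(j * n) := by
        refine natCast_dvd_of_mul_angle hN0 (m := i) ?_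
        rw [← hi, hl]
        push_cast
        ring
      rw [dvd_neg] at hdvd
      have hcop : IsCoprime (N : ℤ) (n : ℤ) :=
        Nat.isCoprime_iff_coprime.2 (hnm.coprime_dvd_right ⟨2, by omega⟩).symm
      obtain ⟨c, rfl⟩ := hcop.dvd_of_dvd_mul_right hdvd
      rw [zpow_mul, zpow_natCast, hδN, one_zpow]
    · rw [map_mul, map_zpow, hfδ, rotZ_zpow, hfa, rotLine_zero_left] at hfk
      rw [← inv_eq_iff_mul_eq_one, ← rotZ_neg] at hfk
      exact absurd hfk.symm (rotX_pi_ne_rotZ _)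
  have hKinj : ∀ k ∈ K, ∀ k' ∈ K, f k = f k' → k = k' := by
    intro k hk k' hk' h
    refine mul_inv_eq_one.1 (hKone _ (mul_mem hk (inv_mem hk')) ?_)
    rw [map_mul, map_inv, h, mul_inv_cancel]
  -- Edge groups are pulled back to `Γ`: injectivity on `K` turns membership of `f k` in a Klein
  -- four-group into membership of `k` in the leaf.
  have hedge : ∀ (V : Subgroup Γ) (c : Γ) (ψ : ℝ), c ∈ K → c ∈ V → γ ∈ V →
      f c = rotLine ψ Real.pi → ∀ k ∈ K,
      f k ∈ Subgroup.closure {rotLine ψ Real.pi, rotZ Real.pi} → k ∈ V := by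
    intro V c ψ hcK hcV hγV hfc k hk hfk
    have : Subgroup.closure {rotLine ψ Real.pi, rotZ Real.pi} ≤ (K ⊓ V).map f := by
      rw [Subgroup.closure_le]
      rintro _ (rfl | rfl)
      · exact ⟨c, ⟨hcK, hcV⟩, hfc⟩
      · exact ⟨γ, ⟨hγK, hγV⟩, hfγ⟩
    obtain ⟨k', hk', h⟩ := this hfk
    exact hKinj k' hk'.1 k hk h ▸ hk'.2
  obtain ⟨O, h2⟩ := exists_valuation_two_lt_one
  have hc2 : ∀ w : ℂ, w ^ N = 1 → w ^ 2 ≠ 1 → O.valuation 2 < O.valuation (w - 1) :=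
    fun w hw hw2 => val_two_lt_val_sub_one h2 hN0 hw hw2
  have hc2' : ∀ w : ℂ, w ^ N = -1 → O.valuation 2 < O.valuation (w - 1) :=
    fun w hw => val_two_lt_of_pow_eq_neg_one h2 hN0 hN2 hw
  have hexp : exp (φ * I) ^ N = -1 := hφn ▸ exp_odd_mul_pow hN0 hn
  have hφ : O.valuation (exp (φ * I)) = 1 := val_exp_of_pow_eq_neg_one hN0 hexp
  have hleaf : ∀ (g : Γ) (P L : ℕ) (ψ : ℝ), Odd L → P = 2 * L → g ^ L ∈ K →
      (g * γ) ^ 2 = 1 → f g = rotLine ψ (2 * Real.pi / P) → O.valuation (exp (ψ * I)) = 1 →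
      ∀ x ∈ Subgroup.closure {g, γ}, x ∈ K ∨ ∀ y ∈ codisc O.valuation ψ (O.valuation 2),
        complexAct (f x) y ∈ disc O.valuation ψ (O.valuation 2) := by
    intro g P L ψ hL hP hgK hgγ hfg hψ x hx
    obtain ⟨k, hk⟩ := exists_zpow_of_mem_closure_pair hγ' (mul_eq_inv_mul_of_sq hγ' hgγ) hx
    by_cases hLk : (L : ℤ) ∣ k
    · left
      have hpow : g ^ k ∈ K := by
        obtain ⟨i, rfl⟩ := hLk
        rw [zpow_mul, zpow_natCast]
        exact zpow_mem hgK i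
      rcases hk with rfl | rfl
      · exact hpow
      · exact mul_mem hpow hγK
    · right
      intro y hy
      rcases hk with rfl | rfl
      · rw [map_zpow, hfg]
        exact dihedral_codisc h2 hL hP hψ hLk hy
      · rw [map_mul, map_zpow, hfg, hfγ, complexAct_mul]
        exact dihedral_codisc h2 hL hP hψ hLk
          (rotZ_codisc_self val_exp_pi hψ val_exp_pi_sub_one.le hy)
  -- An element of the kernel acts trivially, so ping-pong puts it into `K`, where `f` is injective.
  have hinj : Function.Injective f := by
    rw [injective_iff_map_eq_one]
    intro g hg
    refine hKone g ?_ hg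
    refine mem_of_act_eq (fun g => complexAct (f g))
      (fun g h x => by simp only [map_mul, complexAct_mul])
      (fun x => by simp only [map_one, complexAct_one]) K
      ![Subgroup.closure {α, γ}, Subgroup.closure {β, γ}]
      ![disc O.valuation 0 (O.valuation 2), disc O.valuation φ (O.valuation 2)]
      ![codisc O.valuation 0 (O.valuation 2), codisc O.valuation φ (O.valuation 2)]
      (spinor 1 0) ?_ ?_ ?_ ?_ ?_ ?_ (by simp only [hg, complexAct_one])
    · refine Fin.forall_fin_two.2 ⟨fun x hx => ?_, fun x hx => ?_⟩
      · exact hleaf α p M 0 hM hp haK hαγ hfα zero_angle x hx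
      · exact hleaf β q M' φ hM' hq hbK hβγ hfβ hφ x hx
    · refine Fin.forall_fin_two.2 ⟨fun k hk => ?_, fun k hk => ?_⟩
      · exact (mem_or_center_disc hN0 two_ne_zero hl0 zero_angle h2 hc2
          (V := Subgroup.closure {rotLine 0 Real.pi, rotZ Real.pi})
          (two_pi_div_two ▸ Subgroup.subset_closure (by simp)) (Subgroup.subset_closure (by simp))
          (hfK k hk)).imp_left (hedge _ a 0 haK (pow_mem (Subgroup.subset_closure (by simp)) _)
            (Subgroup.subset_closure (by simp)) hfa k hk)
      · exact (mem_or_center_disc hN0 two_ne_zero hl hφ h2 hc2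
          (V := Subgroup.closure {rotLine φ Real.pi, rotZ Real.pi})
          (two_pi_div_two ▸ Subgroup.subset_closure (by simp)) (Subgroup.subset_closure (by simp))
          (hfK k hk)).imp_left (hedge _ b φ hbK (pow_mem (Subgroup.subset_closure (by simp)) _)
            (Subgroup.subset_closure (by simp)) hfb k hk)
    · refine Fin.forall_fin_two.2 ⟨Fin.forall_fin_two.2 ⟨fun h => (h rfl).elim, ?_⟩,
        Fin.forall_fin_two.2 ⟨?_, fun h => (h rfl).elim⟩⟩
      · intro _ k hk x hx
        exact center_disc_codisc hN0 hl0 zero_angle hφ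
          (by rw [zero_sub]; exact exp_neg_pow hexp) h2 hc2' hc2' (hfK k hk) hx
      · intro _ k hk x hx
        exact center_disc_codisc hN0 hl hφ zero_angle (by rw [sub_zero]; exact hexp) h2 hc2' hc2'
          (hfK k hk) hx
    · exact Fin.forall_fin_two.2 ⟨fun k hk => center_base_codisc zero_angle h2 (hfK k hk),
        fun k hk => center_base_codisc hφ h2 (hfK k hk)⟩
    · exact Fin.forall_fin_two.2 ⟨disjoint_disc_codisc _ _ _, disjoint_disc_codisc _ _ _⟩
    · have hle : Subgroup.closure {α, β, γ} ≤ Subgroup.closure ((K : Set Γ) ∪ ⋃ i,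
          ((![Subgroup.closure {α, γ}, Subgroup.closure {β, γ}] i : Subgroup Γ) : Set Γ)) := by
        rw [Subgroup.closure_le]
        rintro _ (rfl | rfl | rfl)
        · exact Subgroup.subset_closure (Or.inr (Set.mem_iUnion.2
            ⟨0, Subgroup.subset_closure (by simp)⟩))
        · exact Subgroup.subset_closure (Or.inr (Set.mem_iUnion.2
            ⟨1, Subgroup.subset_closure (by simp)⟩))
        · exact Subgroup.subset_closure (Or.inl hγK)
      exact hle (htop ▸ Subgroup.mem_top g)
  refine exists_mulEquiv_of_injective f hinj ?_
  have hαG : f α ∈ GFrac n m p q := by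
    rw [hfα, ← rotA_eq]; exact Subgroup.subset_closure (by simp)
  have hβG : f β ∈ GFrac n m p q := by
    rw [hfβ]; exact Subgroup.subset_closure (by simp [rotB_eq, hφdef])
  rw [MonoidHom.range_eq_map, ← htop, MonoidHom.map_closure]
  apply le_antisymm
  · rw [Subgroup.closure_le]
    rintro _ ⟨x, rfl | rfl | hx, rfl⟩
    · exact hαG
    · exact hβG
    · change f x ∈ GFrac n m p q
      rw [Set.mem_singleton_iff.1 hx, hγδ, map_pow, hδ, map_mul, ha, hb, map_pow, map_pow]
      exact pow_mem (mul_mem (pow_mem hαG _) (pow_mem hβG _)) _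
  · rw [GFrac, Subgroup.closure_le]
    rintro _ (rfl | rfl)
    · exact Subgroup.subset_closure ⟨α, by simp, by rw [hfα, rotA_eq]⟩
    · exact Subgroup.subset_closure ⟨β, by simp, by rw [hfβ, rotB_eq]⟩

theorem rotA_pow_self (hp : p ≠ 0) : rotA p ^ p = 1 := by
  have hp' : (p : ℝ) ≠ 0 := by exact_mod_cast hp
  rw [rotA_eq, rotLine_pow, mul_div_cancel₀ _ hp', rotLine_two_pi]

theorem rotB_pow_self (hq : q ≠ 0) : rotB n m q ^ q = 1 := by
  have hq' : (q : ℝ) ≠ 0 := by exact_mod_cast hq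
  rw [rotB_eq, rotLine_pow, mul_div_cancel₀ _ hq', rotLine_two_pi]

theorem rotLine_mul_rotZ_pi_sq (φ θ : ℝ) : (rotLine φ θ * rotZ Real.pi) ^ 2 = 1 := by
  rw [sq, mul_assoc, ← mul_assoc (rotZ Real.pi), rotZ_pi_mul_rotLine, mul_assoc, rotZ_pi_mul_self,
    mul_one, ← rotLine_add, add_neg_cancel, rotLine, rotX_zero, mul_one, mul_inv_cancel]

theorem rot_last_relation (hm0 : m ≠ 0) (hnm : Nat.Coprime n m) (hm4 : 4 ∣ m) (hp : p ≠ 0)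
    (hp2 : 2 ∣ p) (hq : q ≠ 0) (hq2 : 2 ∣ q) :
    (rotA p ^ (p / 2) * rotB n m q ^ (q / 2)) ^ (m / 4) * rotZ Real.pi = 1 := by
  have hn : Odd n := odd_of_coprime_of_two_dvd hnm (dvd_trans (by norm_num) hm4)
  obtain ⟨a, rfl⟩ := hn
  have hm' : (m : ℝ) ≠ 0 := by exact_mod_cast hm0
  have h1 : rotZ (2 * Real.pi) ∈ (⊥ : Subgroup SO3) := Subgroup.mem_bot.2 rotZ_two_pi
  rw [rotA_eq, rotB_eq, rotLine_pow_half hp hp2, rotLine_pow_half hq hq2, rotLine_zero_pi_mul,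
    rotZ_pow, ← rotZ_add, Nat.cast_div hm4 (by norm_num)]
  -- With `n = 2a + 1` the total angle is `-π n + π = -a · 2π`. Membership in `⊥` expresses that
  -- multiples of a full turn are trivial.
  convert Subgroup.mem_bot.1 (rotZ_int_mem h1 (-a)) using 2
  push_cast
  field_simp
  ring

theorem relators_lift (hm0 : m ≠ 0) (hnm : Nat.Coprime n m) (hm4 : 4 ∣ m) (hp : p ≠ 0)
    (hp2 : 2 ∣ p) (hq : q ≠ 0) (hq2 : 2 ∣ q) :
    ∀ r ∈ relators m p q, FreeGroup.lift ![rotA p, rotB n m q, rotZ Real.pi] r = 1 := by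
  rintro _ (rfl | rfl | rfl | rfl | rfl | rfl) <;>
    simp only [map_mul, map_pow, FreeGroup.lift_apply_of]
  · exact rotA_pow_self hp
  · exact rotB_pow_self hq
  · exact (sq _).trans rotZ_pi_mul_self
  · exact rotA_eq p ▸ rotLine_mul_rotZ_pi_sq 0 _
  · exact rotLine_mul_rotZ_pi_sq _ _
  · exact rot_last_relation hm0 hnm hm4 hp hp2 hq hq2

theorem presentedGroup_mulEquiv_gFrac (hm0 : m ≠ 0) (hnm : Nat.Coprime n m) (hm4 : 4 ∣ m)
    (hM : Odd M) (hp : p = 2 * M) (hM' : Odd M') (hq : q = 2 * M') :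
    ∃ e : PresentedGroup (relators m p q) ≃* GFrac n m p q,
      (e (PresentedGroup.of 0) : SO3) = rotA p ∧
      (e (PresentedGroup.of 1) : SO3) = rotB n m q ∧
      (e (PresentedGroup.of 2) : SO3) = rotZ Real.pi := by
  have hM0 := hM.pos
  have hM0' := hM'.pos
  have hrel := relators_lift hm0 hnm hm4 (p := p) (by omega) ⟨M, hp⟩ (q := q) (by omega) ⟨M', hq⟩
  have hof : ∀ i, PresentedGroup.toGroup hrel (PresentedGroup.of i) =
      ![rotA p, rotB n m q, rotZ Real.pi] i := fun i => PresentedGroup.toGroup.of hrel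
  have hone : ∀ r ∈ relators m p q, PresentedGroup.mk (relators m p q) r = 1 := fun r hr =>
    PresentedGroup.one_of_mem hr
  have htop : Subgroup.closure {(PresentedGroup.of 0 : PresentedGroup (relators m p q)),
      PresentedGroup.of 1, PresentedGroup.of 2} = ⊤ := by
    rw [← PresentedGroup.closure_range_of (relators m p q)]
    congr 1
    ext x
    simp [Set.mem_range, Fin.exists_fin_succ, eq_comm]
  obtain ⟨e, he⟩ := exists_mulEquiv_gFrac
    (α := (PresentedGroup.of 0 : PresentedGroup (relators m p q)))
    (β := PresentedGroup.of 1) (γ := PresentedGroup.of 2) hm0 hnm hm4 hM hp hM' hq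
    (hone (FreeGroup.of 0 ^ p) (by simp [relators])) (hone (FreeGroup.of 1 ^ q) (by simp [relators]))
    (hone (FreeGroup.of 2 ^ 2) (by simp [relators]))
    (hone ((FreeGroup.of 0 * FreeGroup.of 2) ^ 2) (by simp [relators]))
    (hone ((FreeGroup.of 1 * FreeGroup.of 2) ^ 2) (by simp [relators]))
    (hone ((FreeGroup.of 0 ^ (p / 2) * FreeGroup.of 1 ^ (q / 2)) ^ (m / 4) * FreeGroup.of 2)
      (by simp [relators])) htop (PresentedGroup.toGroup hrel) (hof 0) (hof 1) (hof 2)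
  exact ⟨e, by rw [he]; exact hof 0, by rw [he]; exact hof 1, by rw [he]; exact hof 2⟩

theorem reflHom_apply_of_ne (k : ℕ) : reflHom k (Multiplicative.ofAdd 1) = DihedralGroup.sr 0 := by
  change (if Multiplicative.ofAdd (1 : ZMod 2) = 1 then 1 else DihedralGroup.sr 0) =
    (DihedralGroup.sr 0 : DihedralGroup k)
  exact if_neg (by decide)

/-- The inclusion of the first factor in `D_p *_{ℤ₂} D_q`. -/
def dihedralInl (p q : ℕ) : DihedralGroup p →* DihedralAmalgam p q :=
  Monoid.PushoutI.of (φ := fun i : Fin 2 => reflHom ((![p, q] : Fin 2 → ℕ) i)) 0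

/-- The inclusion of the second factor in `D_p *_{ℤ₂} D_q`. -/
def dihedralInr (p q : ℕ) : DihedralGroup q →* DihedralAmalgam p q :=
  Monoid.PushoutI.of (φ := fun i : Fin 2 => reflHom ((![p, q] : Fin 2 → ℕ) i)) 1

theorem dihedralInl_r_one (p q : ℕ) :
    dihedralInl p q (DihedralGroup.r 1) = DihedralAmalgam.α p q := rfl

theorem dihedralInr_r_one (p q : ℕ) :
    dihedralInr p q (DihedralGroup.r 1) = DihedralAmalgam.β p q := rfl

theorem dihedralInl_sr_zero (p q : ℕ) :
    dihedralInl p q (DihedralGroup.sr 0) = DihedralAmalgam.γ p q :=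
  (congrArg (dihedralInl p q) (reflHom_apply_of_ne p)).symm.trans
    (Monoid.PushoutI.of_apply_eq_base (fun i : Fin 2 => reflHom ((![p, q] : Fin 2 → ℕ) i)) 0
      (Multiplicative.ofAdd 1))

theorem dihedralInr_sr_zero (p q : ℕ) :
    dihedralInr p q (DihedralGroup.sr 0) = DihedralAmalgam.γ p q :=
  (congrArg (dihedralInr p q) (reflHom_apply_of_ne q)).symm.trans
    (Monoid.PushoutI.of_apply_eq_base (fun i : Fin 2 => reflHom ((![p, q] : Fin 2 → ℕ) i)) 1
      (Multiplicative.ofAdd 1))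

theorem dihedralGroup_mem_closure (k : ℕ) (x : DihedralGroup k) :
    x ∈ Subgroup.closure {DihedralGroup.r 1, DihedralGroup.sr 0} := by
  have hr : ∀ i : ZMod k, DihedralGroup.r i ∈
      Subgroup.closure {(DihedralGroup.r 1 : DihedralGroup k), DihedralGroup.sr 0} := by
    intro i
    have : DihedralGroup.r i = (DihedralGroup.r 1 : DihedralGroup k) ^ (i.cast : ℤ) := by
      rw [DihedralGroup.r_one_zpow, ZMod.intCast_zmod_cast]
    rw [this]
    exact zpow_mem (Subgroup.subset_closure (by simp)) _
  rcases x with i | i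
  · exact hr i
  · rw [show DihedralGroup.sr i = DihedralGroup.sr 0 * DihedralGroup.r i by simp]
    exact mul_mem (Subgroup.subset_closure (by simp)) (hr i)

theorem dihedralAmalgam_closure (p q : ℕ) :
    Subgroup.closure {DihedralAmalgam.α p q, DihedralAmalgam.β p q, DihedralAmalgam.γ p q} = ⊤ := by
  rw [eq_top_iff]
  rintro x -
  set S := Subgroup.closure {DihedralAmalgam.α p q, DihedralAmalgam.β p q, DihedralAmalgam.γ p q}
  have h0 : ∀ g, dihedralInl p q g ∈ S := by
    suffices h : Subgroup.closure {(DihedralGroup.r 1 : DihedralGroup p), DihedralGroup.sr 0} ≤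
        S.comap (dihedralInl p q)
      from fun g => h (dihedralGroup_mem_closure p g)
    rw [Subgroup.closure_le]
    rintro _ (rfl | rfl)
    · exact Subgroup.subset_closure (Or.inl rfl)
    · exact Subgroup.subset_closure (Or.inr (Or.inr (dihedralInl_sr_zero p q)))
  have h1 : ∀ g, dihedralInr p q g ∈ S := by
    suffices h : Subgroup.closure {(DihedralGroup.r 1 : DihedralGroup q), DihedralGroup.sr 0} ≤
        S.comap (dihedralInr p q)
      from fun g => h (dihedralGroup_mem_closure q g)
    rw [Subgroup.closure_le]
    rintro _ (rfl | rfl)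
    · exact Subgroup.subset_closure (Or.inr (Or.inl rfl))
    · exact Subgroup.subset_closure (Or.inr (Or.inr (dihedralInr_sr_zero p q)))
  induction x using Monoid.PushoutI.induction_on with
  | of i g =>
    fin_cases i
    · exact h0 g
    · exact h1 g
  | base h =>
    rw [← Monoid.PushoutI.of_apply_eq_base (fun i : Fin 2 => reflHom ((![p, q] : Fin 2 → ℕ) i)) 0]
    exact h0 _
  | mul x y hx hy => exact mul_mem hx hy

/-- The homomorphism from `D_p *_{ℤ₂} D_q` given by two rotations and a common reflection. -/
theorem exists_dihedralAmalgam_hom (hα : α ^ p = 1) (hβ : β ^ q = 1) (hγ : γ * γ = 1)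
    (hαγ : γ * α = α⁻¹ * γ) (hβγ : γ * β = β⁻¹ * γ) :
    ∃ f : DihedralAmalgam p q →* Γ, f (DihedralAmalgam.α p q) = α ∧
      f (DihedralAmalgam.β p q) = β ∧ f (DihedralAmalgam.γ p q) = γ := by
  let F : ∀ i : Fin 2, DihedralGroup ((![p, q] : Fin 2 → ℕ) i) →* Γ := fun i =>
    match i with
    | 0 => dihedralLift p hα hγ hαγ
    | 1 => dihedralLift q hβ hγ hβγ
  let k : Multiplicative (ZMod 2) →* Γ := (dihedralLift p hα hγ hαγ).comp (reflHom p)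
  have key : ∀ z : Multiplicative (ZMod 2), z = 1 ∨ z = Multiplicative.ofAdd 1 := by decide
  have hF : ∀ i, (F i).comp (reflHom ((![p, q] : Fin 2 → ℕ) i)) = k := by
    refine Fin.forall_fin_two.2 ⟨rfl, ?_⟩
    refine MonoidHom.ext fun z => ?_
    rcases key z with rfl | rfl
    · rw [map_one, map_one]
    · change dihedralLift q hβ hγ hβγ (reflHom q (Multiplicative.ofAdd 1)) =
        dihedralLift p hα hγ hαγ (reflHom p (Multiplicative.ofAdd 1))
      rw [reflHom_apply_of_ne, reflHom_apply_of_ne, dihedralLift_sr_zero, dihedralLift_sr_zero]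
  refine ⟨Monoid.PushoutI.lift F k hF, ?_, ?_, ?_⟩
  · exact (Monoid.PushoutI.lift_of F k hF (i := 0) _).trans (dihedralLift_r_one p hα hγ hαγ)
  · exact (Monoid.PushoutI.lift_of F k hF (i := 1) _).trans (dihedralLift_r_one q hβ hγ hβγ)
  · rw [← dihedralInl_sr_zero]
    exact (Monoid.PushoutI.lift_of F k hF (i := 0) _).trans (dihedralLift_sr_zero p hα hγ hαγ)

theorem dihedralAmalgam_quotient_mulEquiv_gFrac (hm0 : m ≠ 0) (hnm : Nat.Coprime n m) (hm4 : 4 ∣ m)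
    (hM : Odd M) (hp : p = 2 * M) (hM' : Odd M') (hq : q = 2 * M') :
    ∃ e : (DihedralAmalgam p q ⧸ lastRelation m p q) ≃* GFrac n m p q,
      (e (QuotientGroup.mk (DihedralAmalgam.α p q)) : SO3) = rotA p ∧
      (e (QuotientGroup.mk (DihedralAmalgam.β p q)) : SO3) = rotB n m q ∧
      (e (QuotientGroup.mk (DihedralAmalgam.γ p q)) : SO3) = rotZ Real.pi := by
  have hM0 := hM.pos
  have hM0' := hM'.pos
  have hp0 : p ≠ 0 := by omega
  have hq0 : q ≠ 0 := by omega
  obtain ⟨F, hFα, hFβ, hFγ⟩ := exists_dihedralAmalgam_hom (α := rotA p) (β := rotB n m q)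
    (γ := rotZ Real.pi) (rotA_pow_self hp0) (rotB_pow_self hq0) rotZ_pi_mul_self
    (by rw [rotA_eq, rotZ_pi_mul_rotLine, rotLine_neg])
    (by rw [rotB_eq, rotZ_pi_mul_rotLine, rotLine_neg])
  have hker : lastRelation m p q ≤ F.ker := by
    refine Subgroup.normalClosure_le_normal (Set.singleton_subset_iff.2 ?_)
    rw [SetLike.mem_coe, MonoidHom.mem_ker]
    simp only [map_mul, map_pow, hFα, hFβ, hFγ]
    exact rot_last_relation hm0 hnm hm4 hp0 ⟨M, hp⟩ hq0 ⟨M', hq⟩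
  have hγsq : DihedralAmalgam.γ p q ^ 2 = 1 := by
    rw [← dihedralInl_sr_zero, ← map_pow, sq, DihedralGroup.sr_mul_self, map_one]
  have hαγ : (DihedralAmalgam.α p q * DihedralAmalgam.γ p q) ^ 2 = 1 := by
    rw [← dihedralInl_sr_zero, ← dihedralInl_r_one, ← map_mul, ← map_pow, sq,
      DihedralGroup.r_mul_sr, DihedralGroup.sr_mul_self, map_one]
  have hβγ : (DihedralAmalgam.β p q * DihedralAmalgam.γ p q) ^ 2 = 1 := by
    rw [← dihedralInr_sr_zero, ← dihedralInr_r_one, ← map_mul, ← map_pow, sq,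
      DihedralGroup.r_mul_sr, DihedralGroup.sr_mul_self, map_one]
  have hα : DihedralAmalgam.α p q ^ p = 1 := by
    rw [← dihedralInl_r_one, ← map_pow, DihedralGroup.r_one_pow_n, map_one]
  have hβ : DihedralAmalgam.β p q ^ q = 1 := by
    rw [← dihedralInr_r_one, ← map_pow, DihedralGroup.r_one_pow_n, map_one]
  let π := QuotientGroup.mk' (lastRelation m p q)
  obtain ⟨e, he⟩ := exists_mulEquiv_gFrac (α := π (DihedralAmalgam.α p q))
    (β := π (DihedralAmalgam.β p q)) (γ := π (DihedralAmalgam.γ p q)) hm0 hnm hm4 hM hp hM' hq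
    (by rw [← map_pow, hα, map_one]) (by rw [← map_pow, hβ, map_one])
    (by rw [← map_pow, hγsq, map_one]) (by rw [← map_mul, ← map_pow, hαγ, map_one])
    (by rw [← map_mul, ← map_pow, hβγ, map_one])
    (by
      simp only [← map_pow, ← map_mul]
      exact (QuotientGroup.eq_one_iff _).2 (Subgroup.subset_normalClosure rfl))
    (by
      have h := congrArg (Subgroup.map π) (dihedralAmalgam_closure p q)
      rw [MonoidHom.map_closure, ← MonoidHom.range_eq_map,
        MonoidHom.range_eq_top.2 (QuotientGroup.mk'_surjective _)] at h
      rw [← h]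
      congr 1
      simp only [Set.image_insert_eq, Set.image_singleton])
    (QuotientGroup.lift _ F hker) hFα hFβ hFγ
  exact ⟨e, (he _).trans hFα, (he _).trans hFβ, (he _).trans hFγ⟩

end Presentation

end

end RotationGroups

namespace RotationGroups

noncomputable section

/-! ### Assembling the cases. -/

section Conclusions

variable {n m p q : ℕ}

theorem gFrac_eq_sup_octahedral (hm : 2 < m) (hnm : Nat.Coprime n m) (hp : 0 < p) (hq : 0 < q)
    (hpm : padicValNat 2 p < padicValNat 2 m) (hqm : padicValNat 2 q < padicValNat 2 m)
    (hp1 : 1 < padicValNat 2 p) (hq1 : 1 < padicValNat 2 q) {r : ℕ}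
    (hr : r = Nat.lcm (Nat.lcm p q) (m / 2)) :
    GFrac n m p q = GFrac 1 (2 * r) 4 4 ∧
      GFrac n m p q = Subgroup.closure {rotZ (2 * Real.pi / r), rotX (Real.pi / 2)} ⊔
        Subgroup.closure {rotZ (2 * Real.pi / r), rotLine (Real.pi / r) (Real.pi / 2)} ∧
      r ≠ 0 ∧ 4 ∣ r := by
  have hlcm := Nat.lcm_ne_zero hp.ne' hq.ne'
  have hp4 := four_dvd_of_one_lt_padicValNat hp1
  have hq4 := four_dvd_of_one_lt_padicValNat hq1
  have hm8 : 8 ∣ m := (padicValNat_dvd_iff_le (p := 2) (by omega) (n := 3)).2 (by omega)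
  obtain ⟨u, hu, hru⟩ := exists_odd_lcm_half hlcm (m := m) (by omega)
    (by rw [padicValNat_two_lcm hp.ne' hq.ne']; exact max_lt hpm hqm)
  rw [← hr] at hru
  have hr0 : r ≠ 0 := hr ▸ Nat.lcm_ne_zero hlcm (by omega)
  have hr4 : 4 ∣ r := hp4.trans (hr ▸ (Nat.dvd_lcm_left p q).trans (Nat.dvd_lcm_left _ _))
  have e1 := gFrac_eq_of_four_dvd (by omega) hp.ne' hq.ne' hnm hp4 hq4 hm8 hr hu hru
  -- For `n = 1`, `m = 2r`, `p = q = 4` the least common multiple is again `r`, as `4 ∣ r`, and the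
  -- odd cofactor is `1`.
  have e2 := gFrac_eq_of_four_dvd (n := 1) (m := 2 * r) (p := 4) (q := 4) (r := r) (u := 1)
    (by omega) (by norm_num) (by norm_num) (Nat.coprime_one_left _) dvd_rfl dvd_rfl (by omega)
    (by rw [Nat.lcm_self, Nat.mul_div_cancel_left _ two_pos, Nat.lcm_eq_right hr4]) odd_one
    (mul_one _).symm
  refine ⟨e1.trans e2.symm, ?_, hr0, hr4⟩
  rw [e1, ← Subgroup.closure_union]
  congr 1
  ext x
  simp only [Set.mem_insert_iff, Set.mem_singleton_iff, Set.mem_union]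
  tauto

end Conclusions

end

end RotationGroups

theorem theorem5 (n m p q : ℕ) (hn : 0 < n) (hm : 2 < m) (hnm : Nat.Coprime n m)
    (hp : 0 < p) (hq : 0 < q) :
    -- Case 1
    ((1 < padicValNat 2 m ∧ padicValNat 2 p = 1 ∧ padicValNat 2 q = 1) →
      (∃ e : PresentedGroup (relators m p q) ≃* GFrac n m p q,
        (e (PresentedGroup.of 0) : SO3) = rotA p ∧
        (e (PresentedGroup.of 1) : SO3) = rotB n m q ∧
        (e (PresentedGroup.of 2) : SO3) = rotZ Real.pi) ∧
      (∃ e : (DihedralAmalgam p q ⧸ lastRelation m p q) ≃* GFrac n m p q,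
        (e (QuotientGroup.mk (DihedralAmalgam.α p q)) : SO3) = rotA p ∧
        (e (QuotientGroup.mk (DihedralAmalgam.β p q)) : SO3) = rotB n m q ∧
        (e (QuotientGroup.mk (DihedralAmalgam.γ p q)) : SO3) = rotZ Real.pi)) ∧
    -- Case 2
    ((padicValNat 2 p < padicValNat 2 m ∧ padicValNat 2 q < padicValNat 2 m ∧
        1 < padicValNat 2 p ∧ 1 < padicValNat 2 q) →
      ∀ r : ℕ, r = Nat.lcm (Nat.lcm p q) (m / 2) →
      ∀ H₁ H₂ K : Subgroup SO3,
        H₁ = Subgroup.closure {rotZ (2 * Real.pi / r), rotX (Real.pi / 2)} →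
        H₂ = H₁.map (MulAut.conj (rotZ (Real.pi / r))).toMonoidHom →
        K = Subgroup.closure {rotZ (2 * Real.pi / r), rotX Real.pi} →
        GFrac n m p q = GFrac 1 (2 * r) 4 4 ∧
        (∃ g : SO3, (GOrth r 4).map (MulAut.conj g).toMonoidHom = H₁) ∧
        Nonempty (K ≃* DihedralGroup r) ∧
        IsAmalgam (GFrac n m p q) H₁ H₂ K) ∧
    -- Case 3
    ((padicValNat 2 p < padicValNat 2 m ∧ 1 < padicValNat 2 p ∧ padicValNat 2 q = 1) →
      ∀ s : ℕ, s = Nat.lcm p (m / 2) →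
      ∀ H D K : Subgroup SO3,
        H = Subgroup.closure {rotZ (2 * Real.pi / s), rotX (Real.pi / 2)} →
        D = Subgroup.closure {rotB n m q, rotZ Real.pi} →
        K = Subgroup.closure {rotB n m q ^ (q / 2), rotZ Real.pi} →
        GFrac n m p q = GFrac 1 (2 * s) 4 q ∧
        (∃ g : SO3, (GOrth s 4).map (MulAut.conj g).toMonoidHom = H) ∧
        Nonempty (D ≃* DihedralGroup q) ∧
        Nonempty (K ≃* DihedralGroup 2) ∧
        IsAmalgam (GFrac n m p q) H D K) ∧
    -- Case 4
    ((1 < padicValNat 2 p ∧ padicValNat 2 q = 1 ∧ padicValNat 2 m = 2) →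
      ∀ t : ℕ, t = Nat.lcm q (m / 2) →
      ∀ D₁ D₂ K : Subgroup SO3,
        D₁ = Subgroup.closure {rotA p, rotZ Real.pi} →
        D₂ = Subgroup.closure {rotZ (2 * Real.pi / t), rotB n m q ^ (q / 2)} →
        K = Subgroup.closure {rotZ Real.pi, rotA p ^ (p / 2)} →
        GFrac n m p q = GFrac 1 (2 * t) p 2 ∧
        rotA p ^ (p / 2) = rotB n m q ^ (q / 2) * rotZ (4 * Real.pi * n / m) ∧
        rotA p ^ (p / 2) = rotB 1 (2 * t) 2 * rotZ (2 * Real.pi / t) ∧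
        Nonempty (D₁ ≃* DihedralGroup p) ∧
        Nonempty (D₂ ≃* DihedralGroup t) ∧
        Nonempty (K ≃* DihedralGroup 2) ∧
        IsAmalgam (GFrac n m p q) D₁ D₂ K) := by
  have hp0 := hp.ne'
  have hq0 := hq.ne'
  have hm0 : m ≠ 0 := by omega
  refine ⟨?_, ?_, ?_, ?_⟩
  · rintro ⟨h1, h2, h3⟩
    obtain ⟨M, hM, hpM⟩ := exists_odd_of_padicValNat_eq_one h2
    obtain ⟨M', hM', hqM⟩ := exists_odd_of_padicValNat_eq_one h3
    have hm4 := four_dvd_of_one_lt_padicValNat h1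
    exact ⟨presentedGroup_mulEquiv_gFrac hm0 hnm hm4 hM hpM hM' hqM,
      dihedralAmalgam_quotient_mulEquiv_gFrac hm0 hnm hm4 hM hpM hM' hqM⟩
  · rintro ⟨h1, h2, h3, h4⟩ r hr H₁ H₂ K rfl rfl rfl
    obtain ⟨e1, e2, hr0, hr4⟩ := gFrac_eq_sup_octahedral hm hnm hp hq h1 h2 h3 h4 hr
    refine ⟨e1, ⟨swapXZ, map_swapXZ_gOrth r⟩, nonempty_center_mulEquiv hr0, ?_⟩
    rw [map_rotZ_closure_pair, e2]
    exact isAmalgam_two_octahedral hr0 hr4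
  · rintro ⟨h1, h2, h3⟩ s hs H D K rfl rfl rfl
    obtain ⟨M, hM, hqM⟩ := exists_odd_of_padicValNat_eq_one h3
    have hp4 := four_dvd_of_one_lt_padicValNat h2
    have hq2 : 2 ∣ q := ⟨M, hqM⟩
    have hm8 : 8 ∣ m := (padicValNat_dvd_iff_le (p := 2) hm0 (n := 3)).2 (by omega)
    obtain ⟨u, hu, hsu⟩ := exists_odd_lcm_half hp0 hm0 h1
    rw [← hs] at hsu
    have hs0 : s ≠ 0 := hs ▸ Nat.lcm_ne_zero hp0 (by omega)
    have hs4 : 4 ∣ s := hp4.trans (hs ▸ Nat.dvd_lcm_left _ _)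
    have hj : Odd (n * u) := (odd_of_coprime_of_two_dvd hnm (dvd_trans (by norm_num) hm8)).mul hu
    have e1 := gFrac_eq_of_four_dvd_left hm0 hp0 hq0 hnm hp4 hq2 hm8 hs hu hsu
    have e2 := gFrac_eq_of_four_dvd_left (n := 1) (m := 2 * s) (p := 4) (q := q) (s := s) (u := 1)
      (by omega) (by norm_num) hq0 (Nat.coprime_one_left _) dvd_rfl hq2 (by omega)
      (by rw [Nat.mul_div_cancel_left _ two_pos, Nat.lcm_eq_right hs4]) odd_one (mul_one _).symm
    have hB : rotB n m q ^ (q / 2) = rotLine (2 * Real.pi * n / m) Real.pi :=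
      rotLine_pow_half hq0 hq2
    have hφ := line_angle_eq (n := n) hm0 hs0 hsu
    have hG : GFrac n m p q = Subgroup.closure {rotZ (2 * Real.pi / s), rotX (Real.pi / 2)} ⊔
        Subgroup.closure {rotB n m q, rotZ Real.pi} := by
      rw [e1, ← Subgroup.closure_union]
      apply le_antisymm
      · rw [Subgroup.closure_le]
        rintro _ (rfl | rfl | rfl)
        · exact Subgroup.subset_closure (by simp)
        · exact Subgroup.subset_closure (by simp)
        -- `ℓ` lies at the odd multiple `n * u` of `π/s`, so rotations by multiples of `2π/s` take
        -- it to the line at angle `π/s`.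
        · rw [SetLike.mem_coe, ← rotLine_mem_iff_of_odd hj (Subgroup.subset_closure (by simp)),
            ← hφ, ← rotB_eq]
          exact Subgroup.subset_closure (by simp)
      · rw [Subgroup.closure_le]
        rintro _ ((rfl | rfl) | (rfl | rfl))
        · exact Subgroup.subset_closure (by simp)
        · exact Subgroup.subset_closure (by simp)
        · rw [SetLike.mem_coe, rotB_eq, hφ,
            rotLine_mem_iff_of_odd hj (Subgroup.subset_closure (by simp))]
          exact Subgroup.subset_closure (by simp)
        · exact rotZ_pi_mem hs0 (dvd_trans (by norm_num) hs4) (Subgroup.subset_closure (by simp))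
    refine ⟨e1.trans e2.symm, ⟨swapXZ, map_swapXZ_gOrth s⟩, nonempty_line_mulEquiv _ hq0, ?_, ?_⟩
    · rw [hB]
      have := nonempty_line_mulEquiv (2 * Real.pi * n / m) two_ne_zero
      rwa [two_pi_div_two] at this
    · rw [hB, hG]
      exact isAmalgam_octahedral_dihedral hs0 hs4 hM hqM hj hφ
  · rintro ⟨h1, h2, h3⟩ t ht D₁ D₂ K rfl rfl rfl
    obtain ⟨M, hM, hqM⟩ := exists_odd_of_padicValNat_eq_one h2
    have hp4 := four_dvd_of_one_lt_padicValNat h1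
    have hp2 : 2 ∣ p := dvd_trans (by norm_num) hp4
    have hq2 : 2 ∣ q := ⟨M, hqM⟩
    have hm4 : 4 ∣ m := four_dvd_of_one_lt_padicValNat (by omega)
    have hm2 : m / 2 ≠ 0 := by omega
    obtain ⟨L, hL, hmL⟩ : ∃ L, Odd L ∧ m / 2 = 2 * L :=
      exists_odd_of_padicValNat_eq_one (by
        rw [padicValNat.div (dvd_trans (by norm_num) hm4), h3])
    have ht0 : t ≠ 0 := ht ▸ Nat.lcm_ne_zero hq0 hm2
    -- The exponent of 2 in `t` is `max 1 (2 - 1) = 1`, so `D_t` qualifies as a leaf.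
    obtain ⟨T, hT, htT⟩ : ∃ T, Odd T ∧ t = 2 * T :=
      exists_odd_of_padicValNat_eq_one (by
        rw [ht, padicValNat_two_lcm hq0 hm2, h2, padicValNat.div (dvd_trans (by norm_num) hm4), h3]
        rfl)
    have e1 := gFrac_eq_of_four_mul_odd hp0 hq0 hnm hp4 hq2 hL (m := m) (by omega) ht
    have e2 := gFrac_eq_of_four_mul_odd (n := 1) (m := 2 * t) (p := p) (q := 2) (t := t) hp0
      two_ne_zero (Nat.coprime_one_left _) hp4 dvd_rfl hT (by omega)
      (by rw [Nat.mul_div_cancel_left _ two_pos, Nat.lcm_eq_right ⟨T, htT⟩])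
    have hA : rotA p ^ (p / 2) = rotX Real.pi := by
      rw [rotA_eq, rotLine_pow_half hp0 hp2, rotLine_zero_left]
    have hB : rotB n m q ^ (q / 2) = rotLine (2 * Real.pi * n / m) Real.pi :=
      rotLine_pow_half hq0 hq2
    -- Horizontal half-turns whose axes are at angle `φ` differ by a rotation by `2φ` about the
    -- `z`-axis; this gives both formulas for `A^{p/2}`.
    have hAB : ∀ φ a, a = 2 * φ → rotX Real.pi = rotLine φ Real.pi * rotZ a := by
      rintro φ _ rfl
      rw [rotLine_pi_mul_rotZ, rotLine_pi, ← mul_assoc, ← rotZ_add, neg_add_cancel, rotZ_zero,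
        one_mul]
    obtain ⟨c, hc⟩ : m / 2 ∣ t := ht ▸ Nat.dvd_lcm_right _ _
    -- `ℓ` lies at a multiple of `π/t`, so the half-turn about it may be replaced by the one about
    -- the `x`-axis in the generators of `D₂`.
    have hφ : 2 * (2 * Real.pi * n / m) = ((n * c : ℕ) : ℤ) * (2 * Real.pi / t) := by
      rw [line_angle_eq hm0 ht0 (u := c)
        (by rw [hc, ← mul_assoc, Nat.mul_div_cancel' (dvd_trans (by norm_num) hm4)]),
        two_mul_line_angle]
    have hD₂ : Subgroup.closure {rotZ (2 * Real.pi / t), rotB n m q ^ (q / 2)} =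
        Subgroup.closure {rotZ (2 * Real.pi / t), rotX Real.pi} := by
      rw [hB, center_eq_closure_line hφ]
    have hG : GFrac n m p q = Subgroup.closure {rotA p, rotZ Real.pi} ⊔
        Subgroup.closure {rotZ (2 * Real.pi / t), rotX Real.pi} := by
      rw [e1, ← Subgroup.closure_union]
      apply le_antisymm
      · rw [Subgroup.closure_le]
        rintro _ (rfl | rfl)
        · exact Subgroup.subset_closure (by simp [rotA])
        · exact Subgroup.subset_closure (by simp)
      · rw [Subgroup.closure_le]
        have hx : rotA p ∈ Subgroup.closure {rotX (2 * Real.pi / p), rotZ (2 * Real.pi / t)} :=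
          Subgroup.subset_closure (by simp [rotA])
        rintro _ ((rfl | rfl) | (rfl | rfl))
        · exact hx
        · exact rotZ_pi_mem ht0 ⟨T, htT⟩ (Subgroup.subset_closure (by simp))
        · exact Subgroup.subset_closure (by simp)
        · exact hA ▸ pow_mem hx _
    refine ⟨e1.trans e2.symm, ?_, ?_, ?_, ?_, ?_, ?_⟩
    · rw [hA, hB]
      exact hAB _ _ (by ring)
    · rw [hA, rotB_eq, two_pi_div_two]
      refine hAB _ _ ?_
      push_cast
      ring
    · have := nonempty_line_mulEquiv 0 hp0
      rwa [rotLine_zero_left] at this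
    · rw [hD₂]
      exact nonempty_center_mulEquiv ht0
    · have := nonempty_center_mulEquiv two_ne_zero
      rwa [two_pi_div_two, ← hA] at this
    · rw [hD₂, hA, hG]
      exact isAmalgam_two_dihedral hp0 hp2 hT htT
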